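/- Let $n$ be a natural number, $I=[a,b]\subset\mathbb R$ ($a<b$) a compact interval, $\gamma\colon I\to\mathbb R^n$ a smooth curve, and $\chi\in C^\infty(\mathbb R)$ a real-valued bump function supported in the interior of $I$. For $t>0$ let $$A_tf(x):=\int_{\mathbb R} f(x-t\gamma(s))\,\chi(s)\,\mathrm ds,\qquad M_\gamma f(x):=\sup_{t>0}|A_tf(x)|.$$ Let $\rho\in C_c^\infty(\mathbb R)$ be real-valued, not identically zero, with $\operatorname{supp}\rho\subseteq[1,2]$, and put $\mathfrak A_\gamma f(x,t):=\rho(t)\,A_tf(x)$ for $(x,t)\in\mathbb R^n\times\mathbb R=\mathbb R^{n+1}$. Let $L^p_\sigma(\mathbb R^{n+1})$ be the Bessel potential space of tempered distributions $F$ with $(1-\Delta)^{\sigma/2}F\in L^p(\mathbb R^{n+1})$, with norm $\|(1-\Delta)^{\sigma/2}F\|_{L^p}$. Functions are complex-valued. **Proposition.** Suppose that $\mathfrak A_\gamma$ maps $L^p(\mathbb R^n)$ boundedly into $L^p_\sigma(\mathbb R^{n+1})$ for some $2\le p<\infty$ and some $\sigma>1/p$. Then $M_\gamma$ is bounded on $L^p(\mathbb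 R^n)$. Here boundedness of $M_\gamma$ means that there is a finite constant $C$ with the following properties for every $f\in L^p(\mathbb R^n)$. 1. If $\chi\ge0$ or $f$ is continuous, then for almost every $x$ the integrals $A_tf(x)$ converge absolutely for all $t>0$ simultaneously, $M_\gamma f$ is Lebesgue measurable, and $\|M_\gamma f\|_{L^p(\mathbb R^n)}\le C\|f\|_{L^p(\mathbb R^n)}$. 2. With no condition on the sign of $\chi$ or on the continuity of $f$ (so that each $A_tf$ is determined only up to null sets), for every countable set $T\subset(0,\infty)$ and almost every $x$ the integrals $A_tf(x)$, $t\in T$, converge absolutely, $\sup_{t\in T}|A_tf|$ is Lebesgue measurable, and $\big\|\sup_{t\in T}|A_tf|\big\|_{L^p(\mathbb R^n)}\le C\|f\|_{L^p(\mathbb R^n)}$, with $C$ independent of $T$. -/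

import Mathlib

open MeasureTheory Set
open scoped ENNReal NNReal ContDiff SchwartzMap

noncomputable section

namespace LocalSmoothing

/-- The Euclidean space `ℝⁿ`. -/
abbrev Space (n : ℕ) : Type := EuclideanSpace ℝ (Fin n)

/-- Space-time `ℝⁿ⁺¹ = ℝⁿ × ℝ` with points `(x, t)`, carrying the Euclidean inner product
and hence Lebesgue measure. -/
abbrev SpaceTime (n : ℕ) : Type := WithLp 2 (Space n × ℝ)

/-- The averaging operator `A_t f(x) = ∫ f(x - t γ(s)) χ(s) ds`. -/
def average {n : ℕ} (γ : ℝ → Space n) (χ : ℝ → ℝ) (t : ℝ) (f : Space n → ℂ) (x : Space n) : ℂ :=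
  ∫ s : ℝ, χ s • f (x - t • γ s)

/-- The maximal function `sup_{t ∈ T} |A_t f(x)|`; for `T = (0, ∞)` this is `M_γ f(x)`. -/
def maximalFunction {n : ℕ} (γ : ℝ → Space n) (χ : ℝ → ℝ) (T : Set ℝ) (f : Space n → ℂ)
    (x : Space n) : ℝ≥0∞ :=
  ⨆ t ∈ T, ‖average γ χ t f x‖ₑ

/-- The time-localised space-time operator `(x, t) ↦ ρ(t) A_t f(x)`. -/
def localizedAverage {n : ℕ} (γ : ℝ → Space n) (χ ρ : ℝ → ℝ) (f : Space n → ℂ)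
    (z : SpaceTime n) : ℂ :=
  ρ z.snd • average γ χ z.snd f z.fst

/-- The operator `U` maps `L^p(ℝⁿ)` boundedly into the Bessel potential space
`L^p_σ(ℝⁿ⁺¹)`: for every `f ∈ L^p`, the function `U f` is (a.e. equal to) an `L^p` function `F`,
the tempered distribution `(1 + |D|²)^{σ/2} F` is an `L^p` function `G`, and
`‖G‖_p ≤ C ‖f‖_p` with `C` independent of `f`. -/
def MapsLpBoundedlyIntoSobolev {n : ℕ} (p : ℝ≥0∞) [Fact (1 ≤ p)] (σ : ℝ)
    (U : (Space n → ℂ) → SpaceTime n → ℂ) : Prop :=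
  ∃ C : ℝ≥0, ∀ f : Space n → ℂ, MemLp f p volume →
    ∃ F G : Lp ℂ p (volume : Measure (SpaceTime n)),
      F =ᵐ[volume] U f ∧
      TemperedDistribution.besselPotential (SpaceTime n) ℂ σ (F : 𝓢'(SpaceTime n, ℂ)) =
        (G : 𝓢'(SpaceTime n, ℂ)) ∧
      ‖G‖ₑ ≤ C * eLpNorm f p volume

/-- The maximal estimate for `f` over the set of dilation parameters `T`, with constant `C`:
for almost every `x` all the averages `A_t f(x)`, `t ∈ T`, are given by absolutely convergent
integrals, the maximal function is measurable, and its `L^p` norm is at most `C ‖f‖_p`. -/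
def MaximalEstimate {n : ℕ} (γ : ℝ → Space n) (χ : ℝ → ℝ) (p : ℝ≥0∞) (C : ℝ≥0) (T : Set ℝ)
    (f : Space n → ℂ) : Prop :=
  (∀ᵐ x : Space n, ∀ t ∈ T, Integrable (fun s : ℝ => χ s • f (x - t • γ s)) volume) ∧
  AEMeasurable (maximalFunction γ χ T f) volume ∧
  eLpNorm (maximalFunction γ χ T f) p volume ≤ C * eLpNorm f p volume

/-- Boundedness of `M_γ` on `L^p(ℝⁿ)`. For a nonnegative cutoff `χ`, and for continuous `f`, the
supremum is the genuine pointwise one over all `t > 0`. When `χ` changes sign, the averages of a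
discontinuous `f` need not converge absolutely for all `t` at once; since each `A_t f` is then
determined up to null sets only, the supremum is in that case taken over an arbitrary countable set
of parameters (for instance a dense one), with a constant that does not depend on this set. -/
def MaximalFunctionBoundedOnLp {n : ℕ} (γ : ℝ → Space n) (χ : ℝ → ℝ) (p : ℝ≥0∞) : Prop :=
  ∃ C : ℝ≥0, ∀ f : Space n → ℂ, MemLp f p volume →
    ((Continuous f ∨ ∀ s, 0 ≤ χ s) → MaximalEstimate γ χ p C (Ioi 0) f) ∧
    (∀ T : Set ℝ, T ⊆ Ioi 0 → T.Countable → MaximalEstimate γ χ p C T f)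

end LocalSmoothing

end

/-! Write q for the exponent p and P_u for the heat semigroup, normalised to have symbol
exp(-u‖ξ‖²). The averages A_t commute with P_u, and the maximal function is split at frequency about
1/t.

Local decay. By hypothesis F(x,t) = ρ(t)A_t f(x) is the Bessel potential of some G with ‖G‖_q ≲
‖f‖_q, and the Bessel kernel is a Gamma superposition of Gaussians h_u(x)h_u(t). Applying 1 - P_s in
the space variables alone turns the first factor into h_u - h_{u+s}, of L¹ norm O((s/u)^θ) for 0 < θ
≤ 1. The second factor maps L^q in t to L^∞ with norm O(u^{-1/(2q)}). The integral against
u^{σ/2-1}e^{-u} converges when θ + 1/(2q) < σ/2, and σ > 1/q leaves room for some θ > 0. So on a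
window [c,d] where |ρ| is bounded below, the supremum of |A_t(f - P_s f)| has L^q norm O(s^θ)‖f‖_q
(`exists_majorant_of_besselPotential_eq`, `exists_lintegral_iSup_average_sub_heat_le`). Parabolic
scaling gives the same bound on κ[c,d], with P_{κ²s} in place of P_s.

Globalisation. Put l = d/c, so that the windows l^k[c,d] cover (0,∞), and let a_m = l^{-2m}, D_m =
P_{a_{m+1}}f - P_{a_m}f. For t in the k-th window, A_t f is the limit of A_t(2P_a - P_a²)f along a =
a_{j-k}, j → ∞. Since 2P_a - P_a² = 1 - (1 - P_a)², each increment is A_t applied to (1 - P_a)D + (1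
- P_{a'})D, where D = D_{j-k} and a, a' are consecutive scales (`enorm_average_le_add_tsum`). Local
decay bounds it with a factor a_j^θ, summable in j. For fixed j the supremum over k is at most the
ℓ^q sum, and ∑‖D_m‖_q^q ≲ ‖f‖_q^q for q ≥ 2 by Clarkson's inequality
(`tsum_lintegral_heat_sub_heat_rpow_le`). The initial terms, at frequency about 1/t, are dominated
by the heat maximal function, which is bounded on L² by a duality argument and on L^q by Jensen
(`lintegral_iSup_heatE_rpow_le`).

Passage to L^p. The bound for bounded continuous functions extends by approximation and Fatou. For
countably many t the exceptional null sets can be united. For χ ≥ 0 the maximal inequality, applied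
to small open neighbourhoods of a null set, shows that for almost every x this set is negligible on
all dilated curves through x at once. -/

set_option linter.unusedSectionVars false

noncomputable section

namespace LocalSmoothing

open scoped Real Topology
open Filter

/-! ### Gaussian heat kernels, their semigroup law and scaling. -/

section HeatKernel

variable {V : Type*} [NormedAddCommGroup V] [InnerProductSpace ℝ V] [FiniteDimensional ℝ V]
  [MeasurableSpace V] [BorelSpace V]

/-- The heat kernel, normalised so that its Fourier transform is `exp (-u ‖ξ‖ ^ 2)`. -/
def heatKernel (u : ℝ) (x : V) : ℝ :=
  (π / u) ^ (Module.finrank ℝ V / 2 : ℝ) * Real.exp (-(π ^ 2 / u) * ‖x‖ ^ 2)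

variable (V) in
/-- The Gaussian measure whose density is the heat kernel. -/
def heatMeasure (u : ℝ) : Measure V :=
  volume.withDensity fun x => ENNReal.ofReal (heatKernel u x)

theorem heatKernel_pos {u : ℝ} (hu : 0 < u) (x : V) : 0 < heatKernel u x := by
  unfold heatKernel; positivity

theorem measurable_heatKernel : Measurable fun z : ℝ × V => heatKernel z.1 z.2 := by
  unfold heatKernel; fun_prop

theorem continuous_heatKernel (u : ℝ) : Continuous fun x : V => heatKernel u x := by
  unfold heatKernel; fun_prop

theorem integrable_heatKernel {u : ℝ} (hu : 0 < u) :
    Integrable (fun x : V => heatKernel u x) := by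
  have h := (GaussianFourier.integrable_cexp_neg_mul_sq_norm_add (V := V)
    (b := ((π ^ 2 / u : ℝ) : ℂ)) (by rw [Complex.ofReal_re]; positivity) 0 0).norm
  refine (h.const_mul ((π / u) ^ (Module.finrank ℝ V / 2 : ℝ))).congr (ae_of_all _ fun x => ?_)
  simp only [heatKernel, Complex.norm_exp]
  congr 2
  simp only [zero_mul, add_zero]
  rw [← Complex.ofReal_neg, ← Complex.ofReal_pow, ← Complex.ofReal_mul, Complex.ofReal_re]

theorem integral_heatKernel {u : ℝ} (hu : 0 < u) : ∫ x : V, heatKernel u x = 1 := by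
  unfold heatKernel
  rw [integral_const_mul, GaussianFourier.integral_rexp_neg_mul_sq_norm (by positivity),
    ← Real.mul_rpow (by positivity) (by positivity)]
  have : π / u * (π / (π ^ 2 / u)) = 1 := by field_simp
  rw [this, Real.one_rpow]

theorem lintegral_heatKernel {u : ℝ} (hu : 0 < u) :
    ∫⁻ x : V, ENNReal.ofReal (heatKernel u x) = 1 := by
  rw [← ofReal_integral_eq_lintegral_ofReal (integrable_heatKernel hu)
    (ae_of_all _ fun x => (heatKernel_pos hu x).le), integral_heatKernel hu, ENNReal.ofReal_one]

theorem isProbabilityMeasure_heatMeasure {u : ℝ} (hu : 0 < u) :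
    IsProbabilityMeasure (heatMeasure V u) :=
  ⟨by rw [heatMeasure, withDensity_apply _ MeasurableSet.univ, Measure.restrict_univ,
    lintegral_heatKernel hu]⟩

instance (u : ℝ) : SFinite (heatMeasure V u) := by unfold heatMeasure; infer_instance

theorem measurable_ofReal_heatKernel (u : ℝ) :
    Measurable fun x : V => ENNReal.ofReal (heatKernel u x) :=
  (continuous_heatKernel u).measurable.ennreal_ofReal

theorem lintegral_heatMeasure (u : ℝ) {f : V → ℝ≥0∞} (hf : AEMeasurable f) :
    ∫⁻ x, f x ∂heatMeasure V u = ∫⁻ x, ENNReal.ofReal (heatKernel u x) * f x := by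
  rw [heatMeasure, lintegral_withDensity_eq_lintegral_mul₀
    (measurable_ofReal_heatKernel u).aemeasurable hf]
  rfl

theorem integral_heatMeasure {u : ℝ} (hu : 0 < u) (f : V → ℂ) :
    ∫ x, f x ∂heatMeasure V u = ∫ x, heatKernel u x • f x := by
  rw [heatMeasure, integral_withDensity_eq_integral_toReal_smul
    (measurable_ofReal_heatKernel u) (ae_of_all _ fun x => ENNReal.ofReal_lt_top)]
  refine integral_congr_ae (ae_of_all _ fun x => ?_)
  simp only [ENNReal.toReal_ofReal (heatKernel_pos hu x).le]

theorem charFun_heatMeasure {u : ℝ} (hu : 0 < u) (t : V) :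
    charFun (heatMeasure V u) t = Complex.exp (-(u / (4 * π ^ 2) * ‖t‖ ^ 2 : ℝ)) := by
  rw [charFun_apply, integral_heatMeasure hu]
  have hb : 0 < ((π ^ 2 / u : ℝ) : ℂ).re := by rw [Complex.ofReal_re]; positivity
  have h := GaussianFourier.integral_cexp_neg_mul_sq_norm_add hb Complex.I t
  calc _ = ∫ x : V, (((π / u) ^ (Module.finrank ℝ V / 2 : ℝ) : ℝ) : ℂ) *
        Complex.exp (-((π ^ 2 / u : ℝ) : ℂ) * ‖x‖ ^ 2 + Complex.I * (inner ℝ t x : ℝ)) := by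
        refine integral_congr_ae (ae_of_all _ fun x => ?_)
        simp only [heatKernel, Complex.real_smul]
        rw [Complex.exp_add, Complex.ofReal_mul, Complex.ofReal_exp, real_inner_comm]
        push_cast
        ring_nf
    _ = _ := by
        rw [integral_const_mul, h]
        have h1 : ((π : ℂ) / ((π ^ 2 / u : ℝ) : ℂ)) ^ (Module.finrank ℝ V / 2 : ℂ) =
            (((π / (π ^ 2 / u)) ^ (Module.finrank ℝ V / 2 : ℝ) : ℝ) : ℂ) := by
          rw [Complex.ofReal_cpow (by positivity)]
          push_cast; rfl
        rw [h1, ← mul_assoc, ← Complex.ofReal_mul, ← Real.mul_rpow (by positivity) (by positivity)]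
        have : π / u * (π / (π ^ 2 / u)) = 1 := by field_simp
        rw [this, Real.one_rpow, Complex.ofReal_one, one_mul]
        congr 1
        rw [Complex.I_sq]
        push_cast
        have : (π : ℂ) ≠ 0 := by exact_mod_cast Real.pi_ne_zero
        have : (u : ℂ) ≠ 0 := by exact_mod_cast hu.ne'
        field_simp

/-- Characteristic functions determine finite measures, and those of Gaussians multiply by adding
the times. -/
theorem heatMeasure_conv {u v : ℝ} (hu : 0 < u) (hv : 0 < v) :
    (heatMeasure V u).conv (heatMeasure V v) = heatMeasure V (u + v) := by
  have := isProbabilityMeasure_heatMeasure (V := V) hu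
  have := isProbabilityMeasure_heatMeasure (V := V) hv
  have := isProbabilityMeasure_heatMeasure (V := V) (add_pos hu hv)
  apply Measure.ext_of_charFun
  ext t
  rw [charFun_conv, charFun_heatMeasure hu, charFun_heatMeasure hv,
    charFun_heatMeasure (add_pos hu hv), ← Complex.exp_add]
  congr 1
  push_cast
  ring

theorem map_neg_heatMeasure {u : ℝ} (hu : 0 < u) :
    (heatMeasure V u).map (fun x => -x) = heatMeasure V u := by
  have := isProbabilityMeasure_heatMeasure (V := V) hu
  have : IsProbabilityMeasure ((heatMeasure V u).map (fun x => -x)) :=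
    Measure.isProbabilityMeasure_map (by fun_prop)
  apply Measure.ext_of_charFun
  ext t
  rw [show (fun x : V => -x) = fun x => (-1 : ℝ) • x by ext; simp, charFun_map_smul,
    charFun_heatMeasure hu, charFun_heatMeasure hu]
  simp

theorem map_smul_heatMeasure {u c : ℝ} (hu : 0 < u) (hc : 0 < c) :
    (heatMeasure V u).map (fun x => c • x) = heatMeasure V (c ^ 2 * u) := by
  have hcu : 0 < c ^ 2 * u := by positivity
  have := isProbabilityMeasure_heatMeasure (V := V) hu
  have := isProbabilityMeasure_heatMeasure (V := V) hcu
  have : IsProbabilityMeasure ((heatMeasure V u).map (fun x => c • x)) :=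
    Measure.isProbabilityMeasure_map (by fun_prop)
  apply Measure.ext_of_charFun
  ext t
  rw [charFun_map_smul, charFun_heatMeasure hu, charFun_heatMeasure hcu, norm_smul, mul_pow]
  congr 1
  simp
  ring

theorem lintegral_heatMeasure_neg {u : ℝ} (hu : 0 < u) {f : V → ℝ≥0∞} (hf : Measurable f) :
    ∫⁻ x, f (-x) ∂heatMeasure V u = ∫⁻ x, f x ∂heatMeasure V u := by
  conv_rhs => rw [← map_neg_heatMeasure hu]
  rw [lintegral_map hf (by fun_prop)]

/-- The heat kernels are almost increasing in time. -/
theorem heatKernel_le {u v : ℝ} (hu : 0 < u) (huv : u ≤ v) (x : V) :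
    heatKernel u x ≤ (v / u) ^ (Module.finrank ℝ V / 2 : ℝ) * heatKernel v x := by
  have hv := hu.trans_le huv
  unfold heatKernel
  rw [← mul_assoc, ← Real.mul_rpow (by positivity) (by positivity)]
  have : v / u * (π / v) = π / u := by field_simp
  rw [this]
  gcongr

/-- Translates of heat kernels are controlled by heat kernels on the parabolic scale. -/
theorem heatKernel_sub_le {u B : ℝ} (hu : 0 < u) {x v : V} (hv : ‖v‖ ^ 2 ≤ B * u) :
    heatKernel u (x - v) ≤
      2 ^ (Module.finrank ℝ V / 2 : ℝ) * Real.exp (π ^ 2 * B) * heatKernel (2 * u) x := by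
  unfold heatKernel
  have h1 : (2 : ℝ) ^ (Module.finrank ℝ V / 2 : ℝ) * (π / (2 * u)) ^ (Module.finrank ℝ V / 2 : ℝ)
      = (π / u) ^ (Module.finrank ℝ V / 2 : ℝ) := by
    rw [← Real.mul_rpow (by positivity) (by positivity)]
    congr 1; field_simp
  calc _ ≤ (π / u) ^ (Module.finrank ℝ V / 2 : ℝ) *
        Real.exp (π ^ 2 * B + -(π ^ 2 / (2 * u)) * ‖x‖ ^ 2) := by
        gcongr
        -- Passing from u to 2u halves the Gaussian exponent, which exactly pays for the factor 2
        -- here.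
        have h2 : ‖x‖ ^ 2 ≤ 2 * ‖x - v‖ ^ 2 + 2 * ‖v‖ ^ 2 := by
          have := norm_add_le (x - v) v
          rw [sub_add_cancel] at this
          nlinarith [sq_nonneg (‖x - v‖ - ‖v‖), norm_nonneg x, norm_nonneg v, norm_nonneg (x - v)]
        have h3 : π ^ 2 / (2 * u) * ‖x‖ ^ 2 ≤
            π ^ 2 / (2 * u) * (2 * ‖x - v‖ ^ 2 + 2 * (B * u)) := by
          gcongr
          linarith
        have h4 : π ^ 2 / (2 * u) * (2 * ‖x - v‖ ^ 2 + 2 * (B * u)) =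
            π ^ 2 / u * ‖x - v‖ ^ 2 + π ^ 2 * B := by
          field_simp
        linarith
    _ = _ := by rw [Real.exp_add, ← h1]; ring

end HeatKernel

end LocalSmoothing

end

noncomputable section

namespace LocalSmoothing

open scoped Real Topology
open Filter

/-! ### Jensen's and Young's inequalities for finite measures. -/

section Jensen

variable {α : Type*} [MeasurableSpace α] {ν : Measure α}

theorem rpow_lintegral_le [IsFiniteMeasure ν] {q : ℝ} (hq : 1 ≤ q) {g : α → ℝ≥0∞}
    (hg : AEMeasurable g ν) :
    (∫⁻ y, g y ∂ν) ^ q ≤ ν univ ^ (q - 1) * ∫⁻ y, g y ^ q ∂ν := by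
  have hq0 : 0 < q := by linarith
  have h := eLpNorm'_le_eLpNorm'_mul_rpow_measure_univ one_pos hq hg.aestronglyMeasurable
  simp only [eLpNorm', enorm_eq_self, ENNReal.rpow_one, div_one] at h
  calc _ ≤ ((∫⁻ y, g y ^ q ∂ν) ^ (1 / q) * ν univ ^ (1 - 1 / q)) ^ q := by gcongr
    _ = _ := by
      rw [ENNReal.mul_rpow_of_nonneg _ _ hq0.le, ← ENNReal.rpow_mul, ← ENNReal.rpow_mul, mul_comm]
      congr 2
      · field_simp
      · rw [one_div_mul_cancel hq0.ne', ENNReal.rpow_one]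

theorem rpow_lintegral_le_lintegral_rpow [IsProbabilityMeasure ν] {q : ℝ} (hq : 1 ≤ q)
    {g : α → ℝ≥0∞} (hg : AEMeasurable g ν) :
    (∫⁻ y, g y ∂ν) ^ q ≤ ∫⁻ y, g y ^ q ∂ν := by
  simpa using rpow_lintegral_le hq hg

theorem enorm_integral_rpow_le [IsProbabilityMeasure ν] {q : ℝ} (hq : 1 ≤ q) {g : α → ℂ}
    (hg : AEStronglyMeasurable g ν) :
    ‖∫ y, g y ∂ν‖ₑ ^ q ≤ ∫⁻ y, ‖g y‖ₑ ^ q ∂ν :=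
  (ENNReal.rpow_le_rpow (enorm_integral_le_lintegral_enorm _) (by linarith)).trans
    (rpow_lintegral_le_lintegral_rpow hq hg.enorm)

end Jensen

section Young

variable {V : Type*} [NormedAddCommGroup V] [InnerProductSpace ℝ V] [FiniteDimensional ℝ V]
  [MeasurableSpace V] [BorelSpace V]

theorem lintegral_lintegral_sub (ν : Measure V) [SFinite ν] {g : V → ℝ≥0∞} (hg : Measurable g) :
    ∫⁻ x, ∫⁻ y, g (x - y) ∂ν = ν univ * ∫⁻ x, g x := by
  rw [lintegral_lintegral_swap (by fun_prop)]
  simp_rw [lintegral_sub_right_eq_self g, lintegral_const, mul_comm]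

/-- Young's inequality for the convolution with a finite measure. -/
theorem lintegral_conv_rpow_le (ν : Measure V) [IsFiniteMeasure ν] {q : ℝ} (hq : 1 ≤ q)
    {g : V → ℝ≥0∞} (hg : Measurable g) :
    ∫⁻ x, (∫⁻ y, g (x - y) ∂ν) ^ q ≤ ν univ ^ q * ∫⁻ x, g x ^ q := by
  calc _ ≤ ∫⁻ x, ν univ ^ (q - 1) * ∫⁻ y, g (x - y) ^ q ∂ν :=
        lintegral_mono fun x => rpow_lintegral_le hq (by fun_prop)
    _ = ν univ ^ (q - 1) * (ν univ * ∫⁻ x, g x ^ q) := by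
        rw [lintegral_const_mul _ (by fun_prop),
          lintegral_lintegral_sub ν (g := fun x => g x ^ q) (by fun_prop)]
    _ = _ := by
        rw [← mul_assoc]
        congr 1
        by_cases h : ν univ = 0
        · rw [h, mul_zero, ENNReal.zero_rpow_of_pos (by linarith)]
        · rw [ENNReal.rpow_sub _ _ h (measure_ne_top _ _), ENNReal.rpow_one,
            ENNReal.div_mul_cancel h (measure_ne_top _ _)]

/-- A null set is missed by almost every translate of any measure. -/
theorem ae_ae_sub_of_ae (ν : Measure V) [SFinite ν] {P : V → Prop} (h : ∀ᵐ x : V, P x) :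
    ∀ᵐ x : V, ∀ᵐ y ∂ν, P (x - y) := by
  obtain ⟨N, hN, hNm, hN0⟩ := exists_measurable_superset_of_null (ae_iff.1 h)
  have hφ : Measurable (N.indicator (1 : V → ℝ≥0∞)) := measurable_one.indicator hNm
  have h1 := lintegral_lintegral_sub ν hφ
  have hm : Measurable fun z : V × V => N.indicator (1 : V → ℝ≥0∞) (z.1 - z.2) :=
    hφ.comp (by fun_prop)
  rw [lintegral_indicator_one hNm, hN0, mul_zero, lintegral_eq_zero_iff hm.lintegral_prod_right]
    at h1
  filter_upwards [h1] with x hx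
  rw [Pi.zero_apply, lintegral_eq_zero_iff (f := fun y => N.indicator (1 : V → ℝ≥0∞) (x - y))
    (hφ.comp (by fun_prop))] at hx
  filter_upwards [hx] with y hy
  by_contra hP
  have : x - y ∈ N := hN hP
  simp [this] at hy

end Young

/-! ### The L¹ distance between heat kernels at two times. -/

section HeatKernel

variable {V : Type*} [NormedAddCommGroup V] [InnerProductSpace ℝ V] [FiniteDimensional ℝ V]
  [MeasurableSpace V] [BorelSpace V]

/-- Almost monotonicity in time gives (u/v)^{d/2} h_u ≤ h_v, so the positive part of h_u - h_v is at
most the fraction 1 - (u/v)^{d/2} of h_u. -/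
theorem lintegral_heatKernel_tsub_le {u v : ℝ} (hu : 0 < u) (huv : u ≤ v) :
    ∫⁻ x : V, (ENNReal.ofReal (heatKernel u x) - ENNReal.ofReal (heatKernel v x)) ≤
      ENNReal.ofReal (1 - (u / v) ^ (Module.finrank ℝ V / 2 : ℝ)) := by
  have hv := hu.trans_le huv
  set c : ℝ := (u / v) ^ (Module.finrank ℝ V / 2 : ℝ) with hc
  have hc0 : 0 < c := by positivity
  have hc1 : c ≤ 1 := Real.rpow_le_one (by positivity) ((div_le_one hv).2 huv) (by positivity)
  calc _ ≤ ∫⁻ x : V, ENNReal.ofReal (1 - c) * ENNReal.ofReal (heatKernel u x) := by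
        refine lintegral_mono fun x => ?_
        rw [← ENNReal.ofReal_sub _ (heatKernel_pos hv x).le,
          ← ENNReal.ofReal_mul (by linarith)]
        refine ENNReal.ofReal_le_ofReal ?_
        have h := mul_le_mul_of_nonneg_left (heatKernel_le hu huv x) hc0.le
        rw [← mul_assoc, hc, ← Real.mul_rpow (by positivity) (by positivity)] at h
        have h1 : u / v * (v / u) = 1 := by field_simp
        rw [h1, Real.one_rpow, one_mul, ← hc] at h
        linarith
    _ = _ := by
        rw [lintegral_const_mul _ (measurable_ofReal_heatKernel u), lintegral_heatKernel hu,
          mul_one]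

/-- Both kernels have mass one and share the mass of their minimum, so the remainders have equal
mass. -/
theorem lintegral_heatKernel_tsub_comm {u v : ℝ} (hu : 0 < u) (hv : 0 < v) :
    ∫⁻ x : V, (ENNReal.ofReal (heatKernel u x) - ENNReal.ofReal (heatKernel v x)) =
      ∫⁻ x : V, (ENNReal.ofReal (heatKernel v x) - ENNReal.ofReal (heatKernel u x)) := by
  have hmu := measurable_ofReal_heatKernel (V := V) u
  have hmv := measurable_ofReal_heatKernel (V := V) v
  have key : ∀ a b : ℝ≥0∞, min a b + (a - b) = a := by
    intro a b
    rcases le_total a b with h | h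
    · rw [min_eq_left h, tsub_eq_zero_of_le h, add_zero]
    · rw [min_eq_right h, add_tsub_cancel_of_le h]
  have h1 : ∫⁻ x : V, min (ENNReal.ofReal (heatKernel u x)) (ENNReal.ofReal (heatKernel v x)) +
      (ENNReal.ofReal (heatKernel u x) - ENNReal.ofReal (heatKernel v x)) = 1 := by
    simp_rw [key, lintegral_heatKernel hu]
  have h2 : ∫⁻ x : V, min (ENNReal.ofReal (heatKernel v x)) (ENNReal.ofReal (heatKernel u x)) +
      (ENNReal.ofReal (heatKernel v x) - ENNReal.ofReal (heatKernel u x)) = 1 := by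
    simp_rw [key, lintegral_heatKernel hv]
  rw [lintegral_add_left (hmu.min hmv)] at h1
  rw [lintegral_add_left (hmv.min hmu)] at h2
  simp_rw [min_comm (ENNReal.ofReal (heatKernel v _))] at h2
  rw [← h1] at h2
  refine ((ENNReal.add_right_inj ?_).1 h2).symm
  intro h
  rw [h] at h1
  simp at h1

/-- Bernoulli's inequality gives O(s/u) when s ≤ u, and the left side is at most 1 otherwise.
Weakening s/u to (s/u)^θ keeps the later integral over small u convergent. -/
theorem one_sub_div_rpow_le {u s θ : ℝ} (d : ℕ) (hu : 0 < u) (hs : 0 < s) (hθ : 0 < θ)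
    (hθ1 : θ ≤ 1) :
    1 - (u / (u + s)) ^ (d / 2 : ℝ) ≤ (d + 1) * (s / u) ^ θ := by
  have hus : 0 < u + s := by positivity
  rcases le_total 1 (s / u) with h | h
  · have h1 : 1 ≤ (s / u) ^ θ := Real.one_le_rpow h hθ.le
    have h2 : 0 ≤ (u / (u + s)) ^ (d / 2 : ℝ) := by positivity
    nlinarith [(Nat.cast_nonneg d : (0 : ℝ) ≤ d)]
  · have h0 : 0 < s / u := by positivity
    have h1 : s / u ≤ (s / u) ^ θ := by
      simpa using Real.rpow_le_rpow_of_exponent_ge h0 h hθ1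
    have h2 : (u / (u + s)) ^ (d : ℝ) ≤ (u / (u + s)) ^ (d / 2 : ℝ) :=
      Real.rpow_le_rpow_of_exponent_ge (by positivity) ((div_le_one hus).2 (by linarith))
        (by linarith [(Nat.cast_nonneg d : (0 : ℝ) ≤ d)])
    have h3 : u / (u + s) = 1 + -(s / (u + s)) := by field_simp; ring
    have h4 : 1 + (d : ℝ) * -(s / (u + s)) ≤ (u / (u + s)) ^ d := by
      rw [h3]
      refine one_add_mul_le_pow ?_ d
      have : s / (u + s) ≤ 1 := (div_le_one hus).2 (by linarith)
      linarith
    rw [Real.rpow_natCast] at h2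
    have h5 : s / (u + s) ≤ s / u := by gcongr; linarith
    nlinarith [(Nat.cast_nonneg d : (0 : ℝ) ≤ d), mul_le_mul_of_nonneg_left
      (h5.trans h1) (Nat.cast_nonneg d : (0 : ℝ) ≤ d)]

theorem lintegral_heatKernel_tsub_add_tsub_le {u s θ : ℝ} (hu : 0 < u) (hs : 0 < s) (hθ : 0 < θ)
    (hθ1 : θ ≤ 1) :
    ∫⁻ x : V, ((ENNReal.ofReal (heatKernel u x) - ENNReal.ofReal (heatKernel (u + s) x)) +
      (ENNReal.ofReal (heatKernel (u + s) x) - ENNReal.ofReal (heatKernel u x))) ≤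
      ENNReal.ofReal (2 * (Module.finrank ℝ V + 1) * (s / u) ^ θ) := by
  have h := (lintegral_heatKernel_tsub_le (V := V) hu (by linarith : u ≤ u + s)).trans
    (ENNReal.ofReal_le_ofReal (one_sub_div_rpow_le (Module.finrank ℝ V) hu hs hθ hθ1))
  rw [lintegral_add_left (f := fun x : V => ENNReal.ofReal (heatKernel u x) -
      ENNReal.ofReal (heatKernel (u + s) x))
      ((measurable_ofReal_heatKernel u).sub (measurable_ofReal_heatKernel _)),
    lintegral_heatKernel_tsub_comm (V := V) (add_pos hu hs) hu, ← two_mul, mul_assoc,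
    ENNReal.ofReal_mul zero_le_two, ENNReal.ofReal_ofNat]
  gcongr

end HeatKernel

section SpaceTime

variable {V : Type*} [NormedAddCommGroup V] [InnerProductSpace ℝ V] [FiniteDimensional ℝ V]
  [MeasurableSpace V] [BorelSpace V]

/-- This factorisation allows smoothing in space while the time factor is left for an L^q to L^∞
bound. -/
theorem heatKernel_prod {u : ℝ} (hu : 0 < u) (z : WithLp 2 (V × ℝ)) :
    heatKernel u z = heatKernel u z.fst * heatKernel u z.snd := by
  have h1 : Module.finrank ℝ (WithLp 2 (V × ℝ)) = Module.finrank ℝ V + 1 := by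
    rw [(WithLp.linearEquiv 2 ℝ (V × ℝ)).finrank_eq, Module.finrank_prod, Module.finrank_self]
  simp only [heatKernel]
  rw [h1, WithLp.prod_norm_sq_eq_of_L2, mul_add, Real.exp_add, Module.finrank_self]
  push_cast
  rw [add_div, Real.rpow_add (by positivity)]
  ring

end SpaceTime

end LocalSmoothing

end

/-! ### Uniform convexity and the Littlewood–Paley inequality for the heat semigroup. -/

noncomputable section

namespace LocalSmoothing

open scoped Real Topology
open Filter

/-- Clarkson's inequality: the parallelogram law raised to the power q/2 ≥ 1, using superadditivity
of the power on the left and convexity on the right. -/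
theorem enorm_add_rpow_add_enorm_sub_rpow_le {q : ℝ} (hq : 2 ≤ q) (a b : ℂ) :
    ‖a + b‖ₑ ^ q + ‖a - b‖ₑ ^ q ≤ 2 ^ (q - 1) * (‖a‖ₑ ^ q + ‖b‖ₑ ^ q) := by
  have hpar : ‖a + b‖ₑ ^ (2 : ℝ) + ‖a - b‖ₑ ^ (2 : ℝ) =
      2 * ‖a‖ₑ ^ (2 : ℝ) + 2 * ‖b‖ₑ ^ (2 : ℝ) := by
    have h := parallelogram_law_with_norm ℝ a b
    simp only [← ofReal_norm, ENNReal.rpow_two]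
    rw [← ENNReal.ofReal_pow (norm_nonneg _), ← ENNReal.ofReal_pow (norm_nonneg _),
      ← ENNReal.ofReal_pow (norm_nonneg _), ← ENNReal.ofReal_pow (norm_nonneg _),
      ← ENNReal.ofReal_add (by positivity) (by positivity), ← ENNReal.ofReal_ofNat,
      ← ENNReal.ofReal_mul zero_le_two, ← ENNReal.ofReal_mul zero_le_two,
      ← ENNReal.ofReal_add (by positivity) (by positivity)]
    congr 1
    nlinarith
  have hr : 1 ≤ q / 2 := by linarith
  have hpow : ∀ z : ℂ, ‖z‖ₑ ^ q = (‖z‖ₑ ^ (2 : ℝ)) ^ (q / 2) := fun z => by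
    rw [← ENNReal.rpow_mul]; congr 1; ring
  rw [hpow, hpow]
  calc _ ≤ (‖a + b‖ₑ ^ (2 : ℝ) + ‖a - b‖ₑ ^ (2 : ℝ)) ^ (q / 2) :=
        ENNReal.add_rpow_le_rpow_add _ _ hr
    _ ≤ 2 ^ (q / 2 - 1) * ((2 * ‖a‖ₑ ^ (2 : ℝ)) ^ (q / 2) + (2 * ‖b‖ₑ ^ (2 : ℝ)) ^ (q / 2)) := by
        rw [hpar]
        exact ENNReal.rpow_add_le_mul_rpow_add_rpow _ _ hr
    _ = _ := by
        rw [ENNReal.mul_rpow_of_nonneg _ _ (by linarith),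
          ENNReal.mul_rpow_of_nonneg _ _ (by linarith), ← mul_add, ← mul_assoc,
          ← ENNReal.rpow_add _ _ two_ne_zero ENNReal.ofNat_ne_top, ← hpow, ← hpow]
        congr 2
        ring

section Heat

variable {V : Type*} [NormedAddCommGroup V] [InnerProductSpace ℝ V] [FiniteDimensional ℝ V]
  [MeasurableSpace V] [BorelSpace V]

/-- Bounded continuous functions. -/
structure BddCont {X : Type*} [TopologicalSpace X] (f : X → ℂ) : Prop where
  continuous : Continuous f
  bounded : ∃ M : ℝ, ∀ x, ‖f x‖ ≤ M

theorem BddCont.sub {X : Type*} [TopologicalSpace X] {f g : X → ℂ} (hf : BddCont f)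
    (hg : BddCont g) : BddCont fun x => f x - g x := by
  obtain ⟨M, hM⟩ := hf.bounded
  obtain ⟨N, hN⟩ := hg.bounded
  exact ⟨hf.continuous.sub hg.continuous, M + N, fun x =>
    (norm_sub_le _ _).trans (add_le_add (hM x) (hN x))⟩

theorem BddCont.comp {X Y : Type*} [TopologicalSpace X] [TopologicalSpace Y] {f : X → ℂ}
    (hf : BddCont f) {φ : Y → X} (hφ : Continuous φ) : BddCont fun y => f (φ y) := by
  obtain ⟨M, hM⟩ := hf.bounded
  exact ⟨hf.continuous.comp hφ, M, fun x => hM _⟩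

theorem BddCont.integrable {X : Type*} [TopologicalSpace X] [MeasurableSpace X] [BorelSpace X]
    {f : X → ℂ} (hf : BddCont f) (ν : Measure X) [IsFiniteMeasure ν] : Integrable f ν := by
  obtain ⟨M, hM⟩ := hf.bounded
  exact Integrable.of_bound hf.continuous.measurable.aestronglyMeasurable M (ae_of_all _ hM)

theorem BddCont.integrable_sub {f : V → ℂ} (hf : BddCont f) (ν : Measure V) [IsFiniteMeasure ν]
    (x : V) : Integrable (fun y => f (x - y)) ν :=
  (hf.comp (by fun_prop : Continuous fun y : V => x - y)).integrable ν

/-- The heat semigroup. -/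
def heat (u : ℝ) (f : V → ℂ) (x : V) : ℂ := ∫ y, f (x - y) ∂heatMeasure V u

theorem BddCont.heat {f : V → ℂ} (hf : BddCont f) {u : ℝ} (hu : 0 < u) :
    BddCont (heat u f) := by
  have := isProbabilityMeasure_heatMeasure (V := V) hu
  obtain ⟨M, hM⟩ := hf.bounded
  refine ⟨?_, M, fun x => ?_⟩
  · refine continuous_of_dominated (bound := fun _ => M) (fun x => ?_) (fun x => ?_)
      (integrable_const _) ?_
    · exact (hf.integrable_sub _ x).aestronglyMeasurable
    · exact ae_of_all _ fun y => hM _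
    · exact ae_of_all _ fun y => hf.continuous.comp (by fun_prop)
  · refine (norm_integral_le_of_norm_le_const (ae_of_all _ fun y => hM (x - y))).trans ?_
    simp

theorem heat_sub {f g : V → ℂ} (hf : BddCont f) (hg : BddCont g) {u : ℝ} (hu : 0 < u) (x : V) :
    heat u (fun x => f x - g x) x = heat u f x - heat u g x := by
  have := isProbabilityMeasure_heatMeasure (V := V) hu
  exact integral_sub (hf.integrable_sub _ x) (hg.integrable_sub _ x)

theorem heat_heat {f : V → ℂ} (hf : BddCont f) {u v : ℝ} (hu : 0 < u) (hv : 0 < v) (x : V) :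
    heat v (heat u f) x = heat (u + v) f x := by
  have := isProbabilityMeasure_heatMeasure (V := V) hu
  have := isProbabilityMeasure_heatMeasure (V := V) hv
  have := isProbabilityMeasure_heatMeasure (V := V) (add_pos hv hu)
  unfold heat
  rw [add_comm u v, ← heatMeasure_conv hv hu, integral_conv]
  · simp_rw [sub_sub]
  · rw [heatMeasure_conv hv hu]
    exact hf.integrable_sub _ x

theorem heat_eq_integral_add {f : V → ℂ} (hf : BddCont f) {u : ℝ} (hu : 0 < u) (x : V) :
    heat u f x = ∫ y, f (x + y) ∂heatMeasure V u := by
  unfold heat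
  conv_rhs => rw [← map_neg_heatMeasure hu]
  rw [integral_map (f := fun y => f (x + y)) (by fun_prop)
    (hf.continuous.comp (by fun_prop)).measurable.aestronglyMeasurable]
  simp_rw [sub_eq_add_neg]

theorem enorm_heat_rpow_le {f : V → ℂ} (hf : BddCont f) {u q : ℝ} (hu : 0 < u) (hq : 1 ≤ q)
    (x : V) : ‖heat u f x‖ₑ ^ q ≤ ∫⁻ y, ‖f (x - y)‖ₑ ^ q ∂heatMeasure V u := by
  have := isProbabilityMeasure_heatMeasure (V := V) hu
  exact enorm_integral_rpow_le hq (hf.integrable_sub _ x).aestronglyMeasurable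

theorem lintegral_heatMeasure_sub {g : V → ℝ≥0∞} (hg : Measurable g) {u : ℝ} (hu : 0 < u) :
    ∫⁻ x, ∫⁻ y, g (x - y) ∂heatMeasure V u = ∫⁻ x, g x := by
  have := isProbabilityMeasure_heatMeasure (V := V) hu
  rw [lintegral_lintegral_sub _ hg, measure_univ, one_mul]

theorem measurable_enorm_rpow {X : Type*} [TopologicalSpace X] [MeasurableSpace X]
    [OpensMeasurableSpace X] {f : X → ℂ} (hf : Continuous f) (q : ℝ) :
    Measurable fun x => ‖f x‖ₑ ^ q :=
  hf.measurable.enorm.pow_const q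

theorem lintegral_heat_rpow_le {f : V → ℂ} (hf : BddCont f) {u q : ℝ} (hu : 0 < u) (hq : 1 ≤ q) :
    ∫⁻ x, ‖heat u f x‖ₑ ^ q ≤ ∫⁻ x, ‖f x‖ₑ ^ q := by
  rw [← lintegral_heatMeasure_sub (measurable_enorm_rpow hf.continuous q) hu]
  exact lintegral_mono fun x => enorm_heat_rpow_le hf hu hq x

/-- A quantitative Jensen inequality. Clarkson is applied to the values f(x - y) and their mean b.
The sum f(x - y) + b has mean 2b, so its contribution is at least |2b|^q = 2·2^{q-1}|b|^q, and one
half of this cancels the |b|^q term on the right. -/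
theorem lintegral_sub_mean_rpow_add_le {f : V → ℂ} (hf : BddCont f) {τ q : ℝ} (hτ : 0 < τ)
    (hq : 2 ≤ q) (x : V) :
    ∫⁻ y, ‖f (x - y) - heat τ f x‖ₑ ^ q ∂heatMeasure V τ + 2 ^ (q - 1) * ‖heat τ f x‖ₑ ^ q ≤
      2 ^ (q - 1) * ∫⁻ y, ‖f (x - y)‖ₑ ^ q ∂heatMeasure V τ := by
  have := isProbabilityMeasure_heatMeasure (V := V) hτ
  set b := heat τ f x with hb
  have hint := hf.integrable_sub (heatMeasure V τ) x
  have hm : ∀ c : ℂ, Measurable fun y => ‖f (x - y) + c‖ₑ ^ q := fun c =>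
    measurable_enorm_rpow ((hf.continuous.comp (by fun_prop)).add continuous_const) q
  have h1 : ‖2 * b‖ₑ ^ q ≤ ∫⁻ y, ‖f (x - y) + b‖ₑ ^ q ∂heatMeasure V τ := by
    have h := enorm_integral_rpow_le (ν := heatMeasure V τ) (q := q) (by linarith)
      (hint.add (integrable_const b)).aestronglyMeasurable
    have h2 : ∫ y, ((fun y => f (x - y)) + fun _ : V => b) y ∂heatMeasure V τ = 2 * b := by
      rw [integral_add' hint (integrable_const b), integral_const, two_mul, hb]
      simp [heat]
    rwa [h2] at h
  have h2 : ‖2 * b‖ₑ ^ q = 2 ^ (q - 1) * ‖b‖ₑ ^ q + 2 ^ (q - 1) * ‖b‖ₑ ^ q := by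
    have h3 : ‖(2 : ℂ)‖ₑ = 2 := by
      rw [← ofReal_norm]; simp
    rw [enorm_mul, h3, ENNReal.mul_rpow_of_nonneg _ _ (by linarith), ← two_mul, ← mul_assoc]
    congr 1
    conv_rhs => rw [← ENNReal.rpow_one 2]
    rw [← ENNReal.rpow_mul, one_mul, ← ENNReal.rpow_add _ _ two_ne_zero ENNReal.ofNat_ne_top]
    congr 1; ring
  have h3 : ∫⁻ y, (‖f (x - y) + b‖ₑ ^ q + ‖f (x - y) - b‖ₑ ^ q) ∂heatMeasure V τ ≤
      ∫⁻ y, 2 ^ (q - 1) * (‖f (x - y)‖ₑ ^ q + ‖b‖ₑ ^ q) ∂heatMeasure V τ :=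
    lintegral_mono fun y => enorm_add_rpow_add_enorm_sub_rpow_le hq _ _
  have hm0 : Measurable fun y => ‖f (x - y)‖ₑ ^ q := by simpa using hm 0
  rw [lintegral_add_left (hm b), lintegral_const_mul _ (hm0.add_const _),
    lintegral_add_left hm0, lintegral_const, measure_univ, mul_one, mul_add] at h3
  have hfin : (2 : ℝ≥0∞) ^ (q - 1) * ‖b‖ₑ ^ q ≠ ⊤ :=
    ENNReal.mul_ne_top (ENNReal.rpow_ne_top_of_nonneg (by linarith) ENNReal.ofNat_ne_top)
      (ENNReal.rpow_ne_top_of_nonneg (by linarith) enorm_ne_top)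
  refine (ENNReal.add_le_add_iff_right hfin).1 (le_trans ?_ h3)
  rw [add_assoc, ← h2, add_comm]
  gcongr

/-- A quantitative form of the contractivity of the heat semigroup, by uniform convexity. -/
theorem lintegral_sub_heat_rpow_add_le {f : V → ℂ} (hf : BddCont f) {τ q : ℝ} (hτ : 0 < τ)
    (hq : 2 ≤ q) :
    (∫⁻ x, ‖f x - heat (τ + τ) f x‖ₑ ^ q) + 2 ^ (q - 1) * ∫⁻ x, ‖heat τ f x‖ₑ ^ q ≤
      2 ^ (q - 1) * ∫⁻ x, ‖f x‖ₑ ^ q := by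
  have := isProbabilityMeasure_heatMeasure (V := V) hτ
  have hh := hf.heat hτ
  have h := lintegral_mono (μ := volume) (lintegral_sub_mean_rpow_add_le hf hτ hq)
  have hm : Measurable fun z : V × V => ‖f (z.1 - z.2) - heat τ f z.1‖ₑ ^ q := by
    have h1 := hf.continuous
    have h2 := hh.continuous
    exact (by fun_prop : Continuous fun z : V × V => f (z.1 - z.2) - heat τ f z.1).measurable.enorm.pow_const q
  rw [lintegral_add_left hm.lintegral_prod_right,
    lintegral_const_mul _ (measurable_enorm_rpow hh.continuous q),
    lintegral_const_mul _ (by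
      refine Measurable.lintegral_prod_right' (f := fun z : V × V => ‖f (z.1 - z.2)‖ₑ ^ q) ?_
      exact measurable_enorm_rpow (f := fun z : V × V => f (z.1 - z.2))
        (hf.continuous.comp (by fun_prop)) q),
    lintegral_heatMeasure_sub (measurable_enorm_rpow hf.continuous q) hτ] at h
  refine le_trans ?_ h
  refine add_le_add_left ?_ _
  -- Translating x by y moves the shift onto P_τ f. Averaging over y with Jensen then produces P_τ
  -- P_τ f = P_{2τ} f.
  rw [lintegral_lintegral_swap hm.aemeasurable]
  have h4 : ∀ y : V, ∫⁻ x, ‖f (x - y) - heat τ f x‖ₑ ^ q = ∫⁻ x, ‖f x - heat τ f (x + y)‖ₑ ^ q :=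
    fun y => by
      rw [← lintegral_sub_right_eq_self (fun x => ‖f x - heat τ f (x + y)‖ₑ ^ q) y]
      simp
  simp_rw [h4]
  rw [lintegral_lintegral_swap (by
    have h1 := hf.continuous
    have h2 := hh.continuous
    exact (by fun_prop : Continuous fun z : V × V =>
      f z.2 - heat τ f (z.2 + z.1)).measurable.enorm.pow_const q |>.aemeasurable)]
  refine lintegral_mono fun x => ?_
  have hi : Integrable (fun y => heat τ f (x + y)) (heatMeasure V τ) :=
    (hh.comp (by fun_prop : Continuous fun y : V => x + y)).integrable _
  have h5 := enorm_integral_rpow_le (ν := heatMeasure V τ) (q := q) (by linarith)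
    ((integrable_const (f x)).sub hi).aestronglyMeasurable
  have h6 : ∫ y, ((fun _ : V => f x) - fun y => heat τ f (x + y)) y ∂heatMeasure V τ =
      f x - heat (τ + τ) f x := by
    rw [integral_sub' (integrable_const (f x)) hi, ← heat_eq_integral_add hh hτ, heat_heat hf hτ hτ]
    simp
  rwa [h6] at h5

/-- The previous estimate is applied to P_u f with τ = (v - u)/2. The energy at the midpoint time
dominates the one at time v by contractivity, which puts the inequality in telescoping form. -/
theorem lintegral_heat_sub_heat_rpow_add_le {f : V → ℂ} (hf : BddCont f) {u v q : ℝ} (hu : 0 < u)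
    (huv : u < v) (hq : 2 ≤ q) :
    (∫⁻ x, ‖heat u f x - heat v f x‖ₑ ^ q) + 2 ^ (q - 1) * ∫⁻ x, ‖heat v f x‖ₑ ^ q ≤
      2 ^ (q - 1) * ∫⁻ x, ‖heat u f x‖ₑ ^ q := by
  have hτ : 0 < (v - u) / 2 := by linarith
  have hg := hf.heat hu
  have h := lintegral_sub_heat_rpow_add_le hg hτ hq
  have h1 := lintegral_heat_rpow_le (hg.heat hτ) hτ (by linarith : 1 ≤ q)
  have h2 : ∀ x, heat ((v - u) / 2 + (v - u) / 2) (heat u f) x = heat v f x := fun x => by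
    rw [heat_heat hf hu (by linarith)]; congr 1; ring
  simp_rw [heat_heat hg hτ hτ, h2] at h1
  simp_rw [h2] at h
  refine le_trans ?_ h
  gcongr

/-- The hypothesis reads x m ≤ c(e(m+1) - e m), written additively because `e` may be infinite. -/
theorem tsum_int_le_of_telescoping {x e : ℤ → ℝ≥0∞} {c K : ℝ≥0∞}
    (h : ∀ m, x m + c * e m ≤ c * e (m + 1)) (hK : ∀ m, e m ≤ K) : ∑' m, x m ≤ c * K := by
  have h1 : ∀ (m : ℤ) (N : ℕ), ∑ i ∈ Finset.range N, x (m + i) + c * e m ≤ c * e (m + N) := by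
    intro m N
    induction N with
    | zero => simp
    | succ N ih =>
      rw [Finset.sum_range_succ, add_right_comm, add_comm]
      calc _ ≤ x (m + N) + c * e (m + N) := by gcongr
        _ ≤ _ := by
          convert h (m + N) using 3
          push_cast; ring
  rw [ENNReal.tsum_eq_iSup_sum]
  refine iSup_le fun s => ?_
  set N := s.sup Int.natAbs
  -- The 2N + 1 integers from -N to N contain `s`.
  have hs : s ⊆ (Finset.range (2 * N + 1)).image fun i : ℕ => -(N : ℤ) + i := by
    intro i hi
    have : i.natAbs ≤ N := Finset.le_sup hi
    rw [Finset.mem_image]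
    exact ⟨(i + N).toNat, Finset.mem_range.2 (by omega), by omega⟩
  calc ∑ m ∈ s, x m ≤ ∑ m ∈ (Finset.range (2 * N + 1)).image fun i : ℕ => -(N : ℤ) + i, x m :=
        Finset.sum_le_sum_of_subset hs
    _ = ∑ i ∈ Finset.range (2 * N + 1), x (-(N : ℤ) + i) :=
        Finset.sum_image fun i _ j _ hij => by simpa using hij
    _ ≤ c * e (-(N : ℤ) + (2 * N + 1 : ℕ)) := le_self_add.trans (h1 _ _)
    _ ≤ c * K := by gcongr; exact hK _

/-- The Littlewood–Paley inequality for differences of the heat semigroup. -/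
theorem tsum_lintegral_heat_sub_heat_rpow_le {f : V → ℂ} (hf : BddCont f) {q : ℝ} (hq : 2 ≤ q)
    {a : ℤ → ℝ} (ha : ∀ m, 0 < a m) (hanti : ∀ m, a (m + 1) < a m) :
    ∑' m, ∫⁻ x, ‖heat (a (m + 1)) f x - heat (a m) f x‖ₑ ^ q ≤
      2 ^ (q - 1) * ∫⁻ x, ‖f x‖ₑ ^ q :=
  tsum_int_le_of_telescoping (e := fun m => ∫⁻ x, ‖heat (a m) f x‖ₑ ^ q)
    (fun m => lintegral_heat_sub_heat_rpow_add_le hf (ha _) (hanti m) hq)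
    fun m => lintegral_heat_rpow_le hf (ha m) (by linarith)

end Heat

end LocalSmoothing

end

noncomputable section

namespace LocalSmoothing

open scoped Real Topology
open Filter

/-! ### The heat maximal function on L² and L^q. -/

section HeatMaximal

theorem measurable_finset_sup {ι α : Type*} [MeasurableSpace α] (s : Finset ι)
    {f : ι → α → ℝ≥0∞} (hf : ∀ i ∈ s, Measurable (f i)) :
    Measurable fun x => s.sup fun i => f i x := by
  simp_rw [Finset.sup_eq_iSup]
  exact Measurable.biSup _ s.countable_toSet hf

variable {V : Type*} [NormedAddCommGroup V] [InnerProductSpace ℝ V] [FiniteDimensional ℝ V]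
  [MeasurableSpace V] [BorelSpace V]

/-- The heat semigroup on nonnegative functions. -/
def heatE (u : ℝ) (g : V → ℝ≥0∞) (x : V) : ℝ≥0∞ := ∫⁻ y, g (x - y) ∂heatMeasure V u

@[fun_prop]
theorem measurable_heatE {g : V → ℝ≥0∞} (hg : Measurable g) (u : ℝ) : Measurable (heatE u g) :=
  Measurable.lintegral_prod_right' (f := fun z : V × V => g (z.1 - z.2)) (by fun_prop)

theorem heatE_eq {g : V → ℝ≥0∞} (hg : Measurable g) (u : ℝ) (x : V) :
    heatE u g x = ∫⁻ y, ENNReal.ofReal (heatKernel u y) * g (x - y) :=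
  lintegral_heatMeasure u (by fun_prop)

theorem heatE_le {g : V → ℝ≥0∞} (hg : Measurable g) {u v : ℝ} (hu : 0 < u) (huv : u ≤ v) (x : V) :
    heatE u g x ≤ ENNReal.ofReal ((v / u) ^ (Module.finrank ℝ V / 2 : ℝ)) * heatE v g x := by
  have hv := hu.trans_le huv
  rw [heatE_eq hg, heatE_eq hg,
    ← lintegral_const_mul _ (by have := measurable_ofReal_heatKernel (V := V) v; fun_prop)]
  refine lintegral_mono fun y => ?_
  rw [← mul_assoc, ← ENNReal.ofReal_mul (by positivity)]
  gcongr
  exact heatKernel_le hu huv y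

theorem heatE_heatE {g : V → ℝ≥0∞} (hg : Measurable g) {u v : ℝ} (hu : 0 < u) (hv : 0 < v)
    (x : V) : heatE u (heatE v g) x = heatE (u + v) g x := by
  unfold heatE
  rw [← heatMeasure_conv hu hv, Measure.lintegral_conv (by fun_prop)]
  simp_rw [sub_sub]

/-- The Gaussian is even: translating x by y and reflecting y exchanges the two pairings. -/
theorem lintegral_mul_heatE_comm {φ ψ : V → ℝ≥0∞} (hφ : Measurable φ) (hψ : Measurable ψ) {u : ℝ}
    (hu : 0 < u) : ∫⁻ x, φ x * heatE u ψ x = ∫⁻ x, ψ x * heatE u φ x := by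
  have h1 : ∀ {φ ψ : V → ℝ≥0∞}, Measurable φ → Measurable ψ →
      ∫⁻ x, φ x * heatE u ψ x = ∫⁻ y, ∫⁻ x, φ x * ψ (x - y) ∂volume ∂heatMeasure V u := by
    intro φ ψ hφ hψ
    unfold heatE
    have : ∀ x, φ x * ∫⁻ y, ψ (x - y) ∂heatMeasure V u =
        ∫⁻ y, φ x * ψ (x - y) ∂heatMeasure V u := fun x =>
      (lintegral_const_mul _ (by fun_prop)).symm
    simp_rw [this]
    exact lintegral_lintegral_swap (by fun_prop)
  rw [h1 hφ hψ, h1 hψ hφ, ← lintegral_heatMeasure_neg hu (f := fun y => ∫⁻ x, ψ x * φ (x - y))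
    (Measurable.lintegral_prod_right' (f := fun z : V × V => ψ z.2 * φ (z.2 - z.1))
      (by fun_prop))]
  refine lintegral_congr fun y => ?_
  rw [← lintegral_add_right_eq_self (fun x => φ x * ψ (x - y)) y]
  refine lintegral_congr fun x => ?_
  rw [add_sub_cancel_right, mul_comm, sub_neg_eq_add]

theorem lintegral_heatE_rpow_le {g : V → ℝ≥0∞} (hg : Measurable g) {u q : ℝ} (hu : 0 < u)
    (hq : 1 ≤ q) : ∫⁻ x, heatE u g x ^ q ≤ ∫⁻ x, g x ^ q := by
  have := isProbabilityMeasure_heatMeasure (V := V) hu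
  simpa [heatE] using lintegral_conv_rpow_le (heatMeasure V u) hq hg

theorem lintegral_mul_le_sqrt {α : Type*} [MeasurableSpace α] (μ : Measure α) {f g : α → ℝ≥0∞}
    (hf : Measurable f) (hg : Measurable g) :
    ∫⁻ x, f x * g x ∂μ ≤ (∫⁻ x, f x ^ (2 : ℝ) ∂μ) ^ (1 / 2 : ℝ) *
      (∫⁻ x, g x ^ (2 : ℝ) ∂μ) ^ (1 / 2 : ℝ) :=
  ENNReal.lintegral_mul_le_Lp_mul_Lq μ Real.HolderConjugate.two_two hf.aemeasurable hg.aemeasurable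

/-- Absorption of √v into the left side; this is where a priori finiteness is needed. -/
theorem le_sq_mul_of_le_mul_rpow_mul_rpow {v X C : ℝ≥0∞} (hv : v ≠ ⊤)
    (h : v ≤ C * (X ^ (1 / 2 : ℝ) * v ^ (1 / 2 : ℝ))) : v ≤ C ^ 2 * X := by
  by_cases h0 : v = 0
  · simp [h0]
  have h1 : v ^ (1 / 2 : ℝ) ≠ 0 := by simp [h0]
  have h2 : v ^ (1 / 2 : ℝ) ≠ ⊤ := ENNReal.rpow_ne_top_of_nonneg (by norm_num) hv
  have h3 : v = v ^ (1 / 2 : ℝ) * v ^ (1 / 2 : ℝ) := by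
    rw [← ENNReal.rpow_add _ _ h0 hv]; norm_num
  have h4 : v ^ (1 / 2 : ℝ) ≤ C * X ^ (1 / 2 : ℝ) := by
    rw [← mul_assoc] at h
    conv_lhs at h => rw [h3]
    exact (ENNReal.mul_le_mul_iff_left h1 h2).1 h
  calc v = (v ^ (1 / 2 : ℝ)) ^ 2 := by rw [sq, ← h3]
    _ ≤ (C * X ^ (1 / 2 : ℝ)) ^ 2 := by gcongr
    _ = C ^ 2 * X := by
      rw [mul_pow, ← ENNReal.rpow_natCast (X ^ (1 / 2 : ℝ)), ← ENNReal.rpow_mul]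
      norm_num

/-- The dual form of the maximal inequality for the heat semigroup on `L²`. -/
theorem lintegral_sum_heatE_sq_le (S : Finset ℝ) (hS : ∀ r ∈ S, 0 < r) {φ : ℝ → V → ℝ≥0∞}
    (hφ : ∀ r, Measurable (φ r)) {a : ℝ} (ha : 0 < a) :
    ∫⁻ x, (∑ r ∈ S, heatE (a * r) (φ r) x) ^ (2 : ℝ) ≤
      2 * ENNReal.ofReal (2 ^ (Module.finrank ℝ V / 2 : ℝ)) *
        ∫⁻ x, (∑ r ∈ S, φ r x) * ∑ r ∈ S, heatE (2 * a * r) (φ r) x := by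
  set K := ENNReal.ofReal (2 ^ (Module.finrank ℝ V / 2 : ℝ))
  set J : ℝ → ℝ → ℝ≥0∞ := fun r s => ∫⁻ x, φ r x * heatE (2 * a * s) (φ s) x with hJ
  have hm : ∀ c r, Measurable (heatE c (φ r)) := fun c r => measurable_heatE (hφ r) c
  -- For r ≤ s one has a(r + s) ≤ 2as ≤ 2a(r + s), so almost monotonicity replaces the time a(r + s)
  -- by 2as at the cost 2^{d/2}. The new time depends on s only, so the double sum becomes a product
  -- of two sums.
  have hterm : ∀ r s, 0 < r → 0 < s → r ≤ s → ∫⁻ x, φ r x * heatE (a * r + a * s) (φ s) x ≤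
      K * J r s := by
    intro r s hr hs hrs
    simp only [hJ]
    rw [← lintegral_const_mul _ (by fun_prop)]
    refine lintegral_mono fun x => ?_
    rw [mul_left_comm]
    gcongr
    have h1 : 0 < a * r + a * s := by positivity
    have h2 : a * r + a * s ≤ 2 * a * s := by nlinarith
    refine (heatE_le (hφ s) h1 h2 x).trans ?_
    have h3 : 2 * a * s / (a * r + a * s) ≤ 2 := by
      rw [div_le_iff₀ h1]
      nlinarith
    have h4 : ENNReal.ofReal ((2 * a * s / (a * r + a * s)) ^ (Module.finrank ℝ V / 2 : ℝ)) ≤ K :=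
      ENNReal.ofReal_le_ofReal (Real.rpow_le_rpow (by positivity) h3 (by positivity))
    gcongr
  have hpair : ∀ r ∈ S, ∀ s ∈ S,
      ∫⁻ x, heatE (a * r) (φ r) x * heatE (a * s) (φ s) x ≤ K * J r s + K * J s r := by
    intro r hr s hs
    have hr := hS r hr
    have hs := hS s hs
    rw [← lintegral_mul_heatE_comm (hφ r) (hm _ _) (mul_pos ha hr) |>.trans
      (lintegral_congr fun x => mul_comm _ _)]
    simp_rw [heatE_heatE (hφ s) (mul_pos ha hr) (mul_pos ha hs)]
    rcases le_total r s with h | h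
    · exact (hterm r s hr hs h).trans le_self_add
    · rw [lintegral_mul_heatE_comm (hφ r) (hφ s) (by positivity), add_comm (a * r)]
      exact (hterm s r hs hr h).trans le_add_self
  calc _ = ∫⁻ x, ∑ r ∈ S, ∑ s ∈ S, heatE (a * r) (φ r) x * heatE (a * s) (φ s) x := by
        refine lintegral_congr fun x => ?_
        rw [ENNReal.rpow_two, sq, Finset.sum_mul_sum]
    _ = ∑ r ∈ S, ∑ s ∈ S, ∫⁻ x, heatE (a * r) (φ r) x * heatE (a * s) (φ s) x := by
        rw [lintegral_finsetSum _ fun r _ => by fun_prop]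
        refine Finset.sum_congr rfl fun r _ => ?_
        rw [lintegral_finsetSum _ fun s _ => by fun_prop]
    _ ≤ ∑ r ∈ S, ∑ s ∈ S, (K * J r s + K * J s r) :=
        Finset.sum_le_sum fun r hr => Finset.sum_le_sum fun s hs => hpair r hr s hs
    _ = 2 * K * ∑ r ∈ S, ∑ s ∈ S, J r s := by
        simp_rw [Finset.sum_add_distrib]
        rw [Finset.sum_comm (f := fun r s => K * J s r), ← two_mul]
        simp_rw [← Finset.mul_sum]
        rw [mul_assoc]
    _ = _ := by
        congr 1
        simp_rw [Finset.sum_mul_sum]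
        rw [lintegral_finsetSum _ fun r _ => by fun_prop]
        refine Finset.sum_congr rfl fun r _ => ?_
        rw [lintegral_finsetSum _ fun s _ => by fun_prop]

/-- A bootstrap over the common time dilation a. The previous estimate bounds the energy at a by a
pairing at 2a, so the supremum v over all a > 0 satisfies v ≤ K‖∑φ_r‖₂ v^{1/2}. -/
theorem lintegral_sum_heatE_sq_le' (S : Finset ℝ) (hS : ∀ r ∈ S, 0 < r) {φ : ℝ → V → ℝ≥0∞}
    (hφ : ∀ r, Measurable (φ r)) (hfin : ∀ r ∈ S, ∫⁻ x, φ r x ^ (2 : ℝ) ≠ ⊤) :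
    ∫⁻ x, (∑ r ∈ S, heatE r (φ r) x) ^ (2 : ℝ) ≤
      (2 * ENNReal.ofReal (2 ^ (Module.finrank ℝ V / 2 : ℝ))) ^ 2 *
        ∫⁻ x, (∑ r ∈ S, φ r x) ^ (2 : ℝ) := by
  set K := 2 * ENNReal.ofReal (2 ^ (Module.finrank ℝ V / 2 : ℝ))
  have hm : ∀ c r, Measurable (heatE c (φ r)) := fun c r => measurable_heatE (hφ r) c
  set A : ℝ → ℝ≥0∞ := fun a => ∫⁻ x, (∑ r ∈ S, heatE (a * r) (φ r) x) ^ (2 : ℝ) with hA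
  set v : ℝ≥0∞ := ⨆ a : Ioi (0 : ℝ), A a with hv
  have hAv : ∀ a : ℝ, 0 < a → A a ≤ v := fun a ha =>
    le_iSup (fun a : Ioi (0 : ℝ) => A a) ⟨a, ha⟩
  -- A crude bound, exponential in the number of times but uniform in a; it serves only to make v
  -- finite.
  have hsum : ∀ (T : Finset ℝ) (a : ℝ), (∀ r ∈ T, 0 < r) → 0 < a →
      ∫⁻ x, (∑ r ∈ T, heatE (a * r) (φ r) x) ^ (2 : ℝ) ≤
        2 ^ T.card * ∑ r ∈ T, ∫⁻ x, φ r x ^ (2 : ℝ) := by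
    intro T a
    induction T using Finset.induction_on with
    | empty => simp
    | insert r T hr ih =>
      intro hT ha
      have ih := ih (fun s hs => hT s (Finset.mem_insert_of_mem hs)) ha
      have hr0 := hT r (Finset.mem_insert_self r T)
      simp_rw [Finset.sum_insert hr, Finset.card_insert_of_notMem hr]
      calc _ ≤ ∫⁻ x, 2 * (heatE (a * r) (φ r) x ^ (2 : ℝ) +
            (∑ r ∈ T, heatE (a * r) (φ r) x) ^ (2 : ℝ)) := by
            refine lintegral_mono fun x => ?_
            refine (ENNReal.rpow_add_le_mul_rpow_add_rpow _ _ one_le_two).trans ?_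
            norm_num
        _ = 2 * (∫⁻ x, heatE (a * r) (φ r) x ^ (2 : ℝ)) +
            2 * ∫⁻ x, (∑ r ∈ T, heatE (a * r) (φ r) x) ^ (2 : ℝ) := by
            rw [lintegral_const_mul _ (by fun_prop), lintegral_add_left (by fun_prop), mul_add]
        _ ≤ 2 ^ (T.card + 1) * (∫⁻ x, φ r x ^ (2 : ℝ)) +
            2 * (2 ^ T.card * ∑ r ∈ T, ∫⁻ x, φ r x ^ (2 : ℝ)) := by
            refine add_le_add (mul_le_mul' (le_self_pow₀ one_le_two (by omega)) ?_)
              (mul_le_mul' le_rfl ih)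
            exact lintegral_heatE_rpow_le (hφ r) (mul_pos ha hr0) one_le_two
        _ = _ := by ring
  have hvfin : v ≠ ⊤ := by
    refine ne_top_of_le_ne_top ?_ (iSup_le fun a : Ioi (0 : ℝ) => hsum S a hS a.2)
    exact ENNReal.mul_ne_top (by simp) (ENNReal.sum_ne_top.2 hfin)
  have hvle : v ≤ K * ((∫⁻ x, (∑ r ∈ S, φ r x) ^ (2 : ℝ)) ^ (1 / 2 : ℝ) * v ^ (1 / 2 : ℝ)) := by
    refine iSup_le fun a : Ioi (0 : ℝ) => ?_
    have ha : (0 : ℝ) < a := a.2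
    refine (lintegral_sum_heatE_sq_le S hS hφ ha).trans ?_
    gcongr
    refine (lintegral_mul_le_sqrt _ (Finset.measurable_sum _ fun s _ => hφ _)
      (Finset.measurable_sum _ fun s _ => hm _ _)).trans ?_
    gcongr
    exact hAv (2 * a) (by positivity)
  have := hAv 1 one_pos
  simp only [hA, one_mul] at this
  exact this.trans (le_sq_mul_of_le_mul_rpow_mul_rpow hvfin hvle)

/-- The maximal inequality for the heat semigroup on `L²`, for finitely many times. -/
theorem lintegral_sup_heatE_sq_le (S : Finset ℝ) (hS : ∀ r ∈ S, 0 < r) {g : V → ℝ≥0∞}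
    (hg : Measurable g) :
    ∫⁻ x, (S.sup fun r => heatE r g x) ^ (2 : ℝ) ≤
      (2 * ENNReal.ofReal (2 ^ (Module.finrank ℝ V / 2 : ℝ))) ^ 2 * ∫⁻ x, g x ^ (2 : ℝ) := by
  set K := 2 * ENNReal.ofReal (2 ^ (Module.finrank ℝ V / 2 : ℝ)) with hK
  have hK0 : K ≠ 0 := by
    rw [hK]; simp; positivity
  by_cases hgfin : ∫⁻ x, g x ^ (2 : ℝ) = ⊤
  · rw [hgfin, ENNReal.mul_top (by simp [hK0])]; exact le_top
  rcases S.eq_empty_or_nonempty with rfl | hSne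
  · simp
  have hm : ∀ r, Measurable (heatE r g) := measurable_heatE hg
  set M : V → ℝ≥0∞ := fun x => S.sup fun r => heatE r g x with hM
  have hMm : Measurable M := measurable_finset_sup S fun r _ => hm r
  -- Linearisation of the supremum: φ_r is M restricted to the points where r is the least time
  -- attaining it. Hence the φ_r sum to M, and φ_r M = φ_r P_r g.
  set φ : ℝ → V → ℝ≥0∞ := fun r =>
    {x | heatE r g x = M x ∧ ∀ s ∈ S, s < r → heatE s g x ≠ M x}.indicator M with hφ
  have hφm : ∀ r, Measurable (φ r) := fun r => by
    refine hMm.indicator ?_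
    have : {x | heatE r g x = M x ∧ ∀ s ∈ S, s < r → heatE s g x ≠ M x} =
        {x | heatE r g x = M x} ∩ ⋂ s ∈ S.filter (· < r), {x | heatE s g x = M x}ᶜ := by
      ext x; simp
    rw [this]
    exact (measurableSet_eq_fun (hm r) hMm).inter (Finset.measurableSet_biInter _ fun s _ =>
      (measurableSet_eq_fun (hm s) hMm).compl)
  have hφM : ∀ x, ∑ r ∈ S, φ r x = M x := by
    intro x
    obtain ⟨r₁, hr₁, hr₁e⟩ := Finset.exists_mem_eq_sup S hSne fun r => heatE r g x
    have hne : (S.filter fun r => heatE r g x = M x).Nonempty :=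
      ⟨r₁, Finset.mem_filter.2 ⟨hr₁, hr₁e.symm⟩⟩
    set r₀ := (S.filter fun r => heatE r g x = M x).min' hne
    have hr₀ := Finset.min'_mem _ hne
    rw [Finset.mem_filter] at hr₀
    rw [Finset.sum_eq_single r₀]
    · simp only [hφ]
      rw [indicator_of_mem]
      refine ⟨hr₀.2, fun s hs hlt he => ?_⟩
      exact absurd (Finset.min'_le _ s (Finset.mem_filter.2 ⟨hs, he⟩)) (not_le.2 hlt)
    · intro s hs hne'
      refine indicator_of_notMem (fun hmem => ?_) M
      have h1 : r₀ ≤ s := Finset.min'_le _ s (Finset.mem_filter.2 ⟨hs, hmem.1⟩)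
      exact hmem.2 r₀ hr₀.1 (lt_of_le_of_ne h1 (Ne.symm hne')) hr₀.2
    · exact fun h => absurd hr₀.1 h
  have hφle : ∀ r x, φ r x ≤ heatE r g x := by
    intro r x
    simp only [hφ, indicator_apply]
    split_ifs with h
    · exact h.1.ge
    · exact zero_le
  have hφmul : ∀ r x, φ r x * M x = φ r x * heatE r g x := by
    intro r x
    simp only [hφ, indicator_apply]
    split_ifs with h
    · rw [h.1]
    · simp
  have hφfin : ∀ r ∈ S, ∫⁻ x, φ r x ^ (2 : ℝ) ≠ ⊤ := fun r hr =>
    ne_top_of_le_ne_top hgfin ((lintegral_mono fun x => by gcongr; exact hφle r x).trans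
      (lintegral_heatE_rpow_le hg (hS r hr) one_le_two))
  have hdual := lintegral_sum_heatE_sq_le' S hS hφm hφfin
  simp_rw [hφM] at hdual
  -- Self-adjointness moves each P_r onto φ_r, so the dual inequality applies after Cauchy–Schwarz.
  have hMeq : ∫⁻ x, M x ^ (2 : ℝ) = ∫⁻ x, g x * ∑ r ∈ S, heatE r (φ r) x := by
    calc _ = ∫⁻ x, ∑ r ∈ S, φ r x * heatE r g x := by
          refine lintegral_congr fun x => ?_
          simp_rw [← hφmul, ← Finset.sum_mul, hφM, ENNReal.rpow_two, sq]
      _ = ∑ r ∈ S, ∫⁻ x, g x * heatE r (φ r) x := by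
          rw [lintegral_finsetSum _ fun r _ => by fun_prop]
          exact Finset.sum_congr rfl fun r hr =>
            lintegral_mul_heatE_comm (hφm r) hg (hS r hr)
      _ = _ := by
          simp_rw [Finset.mul_sum]
          rw [lintegral_finsetSum _ fun r _ => by fun_prop]
  have hMfin : ∫⁻ x, M x ^ (2 : ℝ) ≠ ⊤ := by
    refine ne_top_of_le_ne_top (b := ∑ r ∈ S, ∫⁻ x, g x ^ (2 : ℝ))
      (ENNReal.sum_ne_top.2 fun _ _ => hgfin) ?_
    calc _ ≤ ∫⁻ x, ∑ r ∈ S, heatE r g x ^ (2 : ℝ) := by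
          refine lintegral_mono fun x => ?_
          obtain ⟨r₁, hr₁, hr₁e⟩ := Finset.exists_mem_eq_sup S hSne fun r => heatE r g x
          simp only [hM, hr₁e]
          exact Finset.single_le_sum (f := fun r => heatE r g x ^ (2 : ℝ))
            (fun _ _ => zero_le) hr₁
      _ = ∑ r ∈ S, ∫⁻ x, heatE r g x ^ (2 : ℝ) :=
          lintegral_finsetSum _ fun r _ => (hm r).pow_const _
      _ ≤ _ := Finset.sum_le_sum fun r hr => lintegral_heatE_rpow_le hg (hS r hr) one_le_two
  refine le_sq_mul_of_le_mul_rpow_mul_rpow hMfin ?_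
  conv_lhs => rw [hMeq]
  refine (lintegral_mul_le_sqrt _ hg
    (Finset.measurable_sum _ fun r _ => measurable_heatE (hφm r) r)).trans ?_
  rw [mul_left_comm]
  gcongr
  calc _ ≤ (K ^ 2 * ∫⁻ x, M x ^ (2 : ℝ)) ^ (1 / 2 : ℝ) := by gcongr
    _ = _ := by
      rw [ENNReal.mul_rpow_of_nonneg _ _ (by norm_num), ← ENNReal.rpow_natCast, ← ENNReal.rpow_mul]
      norm_num [hM]

/-- The maximal inequality for the heat semigroup on `L^q`, `q ≥ 2`. -/
theorem lintegral_iSup_heatE_rpow_le {q : ℝ} (hq : 2 ≤ q) {r : ℕ → ℝ} (hr : ∀ i, 0 < r i)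
    {g : V → ℝ≥0∞} (hg : Measurable g) :
    ∫⁻ x, (⨆ i, heatE (r i) g x) ^ q ≤
      (2 * ENNReal.ofReal (2 ^ (Module.finrank ℝ V / 2 : ℝ))) ^ 2 * ∫⁻ x, g x ^ q := by
  classical
  have hq2 : 1 ≤ q / 2 := by linarith
  have hm : ∀ r, Measurable (heatE r g) := measurable_heatE hg
  set S : ℕ → Finset ℝ := fun N => (Finset.range N).image r with hS
  have hSpos : ∀ N, ∀ s ∈ S N, 0 < s := by
    intro N s hs
    obtain ⟨i, -, rfl⟩ := Finset.mem_image.1 hs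
    exact hr i
  have hsup : ∀ x, ⨆ i, heatE (r i) g x = ⨆ N, (S N).sup fun s => heatE s g x := by
    intro x
    refine le_antisymm (iSup_le fun i => ?_) (iSup_le fun N => Finset.sup_le fun s hs => ?_)
    · refine le_iSup_of_le (i + 1) (Finset.le_sup (f := fun s => heatE s g x) ?_)
      exact Finset.mem_image_of_mem _ (Finset.self_mem_range_succ i)
    · obtain ⟨i, -, rfl⟩ := Finset.mem_image.1 hs
      exact le_iSup (fun i => heatE (r i) g x) i
  have hmono : Monotone fun N x => ((S N).sup fun s => heatE s g x) ^ q := by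
    intro N N' h x
    simp only
    gcongr
    exact Finset.image_subset_image (Finset.range_mono h)
  have hiSup : ∀ x, (⨆ i, heatE (r i) g x) ^ q = ⨆ N, ((S N).sup fun s => heatE s g x) ^ q := by
    intro x
    rw [hsup x]
    exact (ENNReal.orderIsoRpow q (by linarith)).map_iSup _
  simp_rw [hiSup]
  rw [lintegral_iSup (fun N => (measurable_finset_sup _ fun s _ => hm s).pow_const q) hmono]
  refine iSup_le fun N => ?_
  -- Jensen gives (P_s g)^{q/2} ≤ P_s(g^{q/2}), which reduces L^q to L² for the function g^{q/2}.
  calc _ ≤ ∫⁻ x, ((S N).sup fun s => heatE s (fun y => g y ^ (q / 2)) x) ^ (2 : ℝ) := by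
        refine lintegral_mono fun x => ?_
        rcases (S N).eq_empty_or_nonempty with h | h
        · rw [h, Finset.sup_empty]
          simp [ENNReal.zero_rpow_of_pos (by linarith : 0 < q)]
        · obtain ⟨s, hs, hse⟩ := Finset.exists_mem_eq_sup (S N) h fun s => heatE s g x
          have hqq : heatE s g x ^ q = (heatE s g x ^ (q / 2)) ^ (2 : ℝ) := by
            rw [← ENNReal.rpow_mul]; congr 1; ring
          rw [hse, hqq]
          gcongr
          refine le_trans ?_ (Finset.le_sup (f := fun s => heatE s (fun y => g y ^ (q / 2)) x) hs)
          have := isProbabilityMeasure_heatMeasure (V := V) (hSpos N s hs)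
          exact rpow_lintegral_le_lintegral_rpow hq2 (by fun_prop)
    _ ≤ _ := lintegral_sup_heatE_sq_le (S N) (hSpos N) (hg.pow_const _)
    _ = _ := by
        simp_rw [← ENNReal.rpow_mul]
        congr 4
        ext x
        congr 1
        ring

end HeatMaximal

end LocalSmoothing

end

noncomputable section

namespace LocalSmoothing

open scoped Real Topology FourierTransform
open Filter

/-! ### The Bessel kernel as a Gamma mixture of heat kernels. -/

section GammaWeight

/-- The Gamma distribution with shape `a` and rate `1`. -/
def gammaWeight (a : ℝ) : Measure ℝ :=
  (volume.restrict (Ioi 0)).withDensity fun u =>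
    ENNReal.ofReal (u ^ (a - 1) * Real.exp (-u) / Real.Gamma a)

theorem measurable_gammaWeight_density (a : ℝ) :
    Measurable fun u : ℝ => ENNReal.ofReal (u ^ (a - 1) * Real.exp (-u) / Real.Gamma a) := by
  fun_prop

instance (a : ℝ) : SFinite (gammaWeight a) := by unfold gammaWeight; infer_instance

theorem ae_gammaWeight_pos (a : ℝ) : ∀ᵐ u ∂gammaWeight a, 0 < u :=
  (withDensity_absolutelyContinuous _ _).ae_le (ae_restrict_mem measurableSet_Ioi)

/-- Used with a = σ/2 and b = θ + 1/(2q): the finiteness of this negative moment is the point where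
σ > 1/p is spent. -/
theorem lintegral_gammaWeight_rpow_neg {a b : ℝ} (ha : 0 < a) (hab : b < a) :
    ∫⁻ u, ENNReal.ofReal (u ^ (-b)) ∂gammaWeight a =
      ENNReal.ofReal (Real.Gamma (a - b) / Real.Gamma a) := by
  have hint := Real.GammaIntegral_convergent (sub_pos.2 hab)
  rw [gammaWeight, lintegral_withDensity_eq_lintegral_mul _ (measurable_gammaWeight_density a)
    (by fun_prop), Real.Gamma_eq_integral (sub_pos.2 hab), ← integral_div,
    ofReal_integral_eq_lintegral_ofReal (hint.div_const _)]
  · refine setLIntegral_congr_fun measurableSet_Ioi fun u hu => ?_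
    have hu : 0 < u := hu
    have hΓ := Real.Gamma_pos_of_pos ha
    simp only [Pi.mul_apply]
    rw [← ENNReal.ofReal_mul (by positivity)]
    congr 1
    rw [show a - b - 1 = (a - 1) + -b by ring, Real.rpow_add hu]
    ring
  · filter_upwards [ae_restrict_mem measurableSet_Ioi] with u hu
    have hu : 0 < u := hu
    have hΓ := Real.Gamma_pos_of_pos ha
    simp only [Pi.zero_apply]
    positivity

theorem isProbabilityMeasure_gammaWeight {a : ℝ} (ha : 0 < a) :
    IsProbabilityMeasure (gammaWeight a) := by
  refine ⟨?_⟩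
  have h := lintegral_gammaWeight_rpow_neg ha ha
  simpa [(Real.Gamma_pos_of_pos ha).ne'] using h

/-- With a = σ/2 and x = ‖ξ‖², this Laplace transform writes the symbol of the Bessel potential as a
superposition of the Gaussians exp(-u‖ξ‖²). -/
theorem integral_gammaWeight_exp {a x : ℝ} (ha : 0 < a) (hx : 0 ≤ x) :
    ∫ u, Real.exp (-(u * x)) ∂gammaWeight a = (1 + x) ^ (-a) := by
  have hΓ := Real.Gamma_pos_of_pos ha
  rw [gammaWeight, integral_withDensity_eq_integral_toReal_smul (measurable_gammaWeight_density a)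
    (ae_of_all _ fun _ => ENNReal.ofReal_lt_top)]
  calc _ = ∫ u in Ioi (0 : ℝ), (u ^ (a - 1) * Real.exp (-((1 + x) * u))) / Real.Gamma a := by
        refine setIntegral_congr_fun measurableSet_Ioi fun u hu => ?_
        have hu : 0 < u := hu
        simp only [smul_eq_mul]
        rw [ENNReal.toReal_ofReal (by positivity),
          show -((1 + x) * u) = -u + -(u * x) by ring, Real.exp_add]
        ring
    _ = _ := by
        rw [integral_div, Real.integral_rpow_mul_exp_neg_mul_Ioi ha (by linarith),
          mul_div_cancel_right₀ _ hΓ.ne', one_div, Real.inv_rpow (by linarith),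
          Real.rpow_neg (by linarith)]

end GammaWeight

section Mixture

variable {E : Type*} [NormedAddCommGroup E] [InnerProductSpace ℝ E] [FiniteDimensional ℝ E]
  [MeasurableSpace E] [BorelSpace E]

/-- The superposition of the measures with density `κ u`, where `u` is Gamma distributed. -/
def mixture (σ : ℝ) (κ : ℝ × E → ℝ≥0∞) : Measure E :=
  (((gammaWeight (σ / 2)).prod volume).withDensity κ).map Prod.snd

variable (E) in
/-- The measure whose density is the kernel of the Bessel potential of order `-σ`. -/
def besselMeasure (σ : ℝ) : Measure E :=
  mixture σ fun z : ℝ × E => ENNReal.ofReal (heatKernel z.1 z.2)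

theorem lintegral_mixture (σ : ℝ) {κ : ℝ × E → ℝ≥0∞} (hκ : Measurable κ) {φ : E → ℝ≥0∞}
    (hφ : Measurable φ) :
    ∫⁻ y, φ y ∂mixture σ κ = ∫⁻ u, ∫⁻ y, κ (u, y) * φ y ∂volume ∂gammaWeight (σ / 2) := by
  rw [mixture, lintegral_map hφ measurable_snd, lintegral_withDensity_eq_lintegral_mul _ hκ
    (by fun_prop), lintegral_prod _ (by fun_prop)]
  rfl

theorem mixture_add (σ : ℝ) {κ κ' : ℝ × E → ℝ≥0∞} (hκ : Measurable κ) :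
    mixture σ (κ + κ') = mixture σ κ + mixture σ κ' := by
  rw [mixture, withDensity_add_left hκ, Measure.map_add _ _ measurable_snd]
  rfl

theorem lintegral_besselMeasure (σ : ℝ) {φ : E → ℝ≥0∞} (hφ : Measurable φ) :
    ∫⁻ y, φ y ∂besselMeasure E σ =
      ∫⁻ u, ∫⁻ y, φ y ∂heatMeasure E u ∂gammaWeight (σ / 2) := by
  rw [besselMeasure, lintegral_mixture σ measurable_heatKernel.ennreal_ofReal hφ]
  simp_rw [lintegral_heatMeasure _ hφ.aemeasurable]

theorem isProbabilityMeasure_besselMeasure {σ : ℝ} (hσ : 0 < σ) :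
    IsProbabilityMeasure (besselMeasure E σ) := by
  have := isProbabilityMeasure_gammaWeight (half_pos hσ)
  refine ⟨?_⟩
  rw [← lintegral_one, lintegral_besselMeasure σ (φ := fun _ => 1) measurable_const,
    lintegral_congr_ae (g := fun _ => 1)]
  · simp
  · filter_upwards [ae_gammaWeight_pos (σ / 2)] with u hu
    have := isProbabilityMeasure_heatMeasure (V := E) hu
    simp

theorem integral_besselMeasure {σ : ℝ} (hσ : 0 < σ) {f : E → ℂ} (hf : BddCont f) :
    ∫ y, f y ∂besselMeasure E σ =
      ∫ u, ∫ y, f y ∂heatMeasure E u ∂gammaWeight (σ / 2) := by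
  have hP := isProbabilityMeasure_besselMeasure (E := E) hσ
  have hκ : Measurable fun z : ℝ × E => ENNReal.ofReal (heatKernel z.1 z.2) :=
    measurable_heatKernel.ennreal_ofReal
  have hint := hf.integrable (besselMeasure E σ)
  unfold besselMeasure mixture at *
  rw [integral_map measurable_snd.aemeasurable hf.continuous.measurable.aestronglyMeasurable]
  rw [integrable_map_measure hf.continuous.measurable.aestronglyMeasurable
    measurable_snd.aemeasurable, integrable_withDensity_iff_integrable_smul' hκ
    (ae_of_all _ fun _ => ENNReal.ofReal_lt_top)] at hint
  simp only [Function.comp_def] at hint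
  rw [integral_withDensity_eq_integral_toReal_smul hκ (ae_of_all _ fun _ => ENNReal.ofReal_lt_top),
    integral_prod _ hint]
  refine integral_congr_ae ?_
  filter_upwards [ae_gammaWeight_pos (σ / 2)] with u hu
  rw [integral_heatMeasure hu]
  refine integral_congr_ae (ae_of_all _ fun y => ?_)
  simp only [ENNReal.toReal_ofReal (heatKernel_pos hu y).le]

end Mixture

section Bessel

variable {E : Type*} [NormedAddCommGroup E] [InnerProductSpace ℝ E] [FiniteDimensional ℝ E]
  [MeasurableSpace E] [BorelSpace E]

theorem _root_.SchwartzMap.bddCont (ψ : 𝓢(E, ℂ)) : BddCont ψ := by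
  refine ⟨ψ.continuous, ?_⟩
  obtain ⟨C, hC⟩ := ψ.decay 0 0
  exact ⟨C, fun x => by simpa using hC.2 x⟩

/-- After ξ ↦ -ξ the integral pairs a modulated Gaussian with the transform of ψ. Moving the
transform onto the Gaussian, where it is explicit, gives the heat kernel centred at z. -/
theorem fourier_gaussian_mul_fourierInv (ψ : 𝓢(E, ℂ)) {u : ℝ} (hu : 0 < u) (z : E) :
    ∫ ξ : E, 𝐞 (-inner ℝ ξ z) • ((Real.exp (-(u * ‖ξ‖ ^ 2)) : ℝ) • (𝓕⁻ ψ) ξ) =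
      heat u ψ z := by
  have hb : 0 < (u : ℂ).re := by simpa using hu
  set f : E → ℂ := fun v => Complex.exp (-(u : ℂ) * ‖v‖ ^ 2 + 2 * π * Complex.I * inner ℝ z v)
    with hf
  have hfi : Integrable f := by
    have := GaussianFourier.integrable_cexp_neg_mul_sq_norm_add hb (2 * π * Complex.I) z
    exact this
  have hflip : ∫ ξ, 𝓕 f ξ • ψ ξ = ∫ x, f x • 𝓕 (ψ : E → ℂ) x := by
    simpa using! VectorFourier.integral_fourierIntegral_smul_eq_flip (L := innerₗ E)
      Real.continuous_fourierChar continuous_inner hfi ψ.integrable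
  have h1 : ∀ ξ, 𝓕 f ξ = heatKernel u (z - ξ) := by
    intro ξ
    rw [hf, fourier_gaussian_innerProductSpace' hb]
    simp only [heatKernel]
    rw [Complex.ofReal_mul, Complex.ofReal_cpow (by positivity), Complex.ofReal_exp]
    push_cast
    congr 2
    ring
  calc _ = ∫ ξ, f (-ξ) • 𝓕 (ψ : E → ℂ) (-ξ) := by
        refine integral_congr_ae (ae_of_all _ fun ξ => ?_)
        simp only [hf]
        rw [SchwartzMap.fourierInv_coe, Real.fourierInv_eq_fourier_neg, Circle.smul_def,
          Real.fourierChar_apply, Complex.exp_add, norm_neg, smul_eq_mul, smul_eq_mul,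
          Complex.real_smul, Complex.ofReal_exp, ← mul_assoc, mul_comm (Complex.exp _)]
        congr 2
        · push_cast; ring_nf
        · rw [inner_neg_right, real_inner_comm]; push_cast; ring_nf
    _ = ∫ ξ, f ξ • 𝓕 (ψ : E → ℂ) ξ := integral_neg_eq_self (fun ξ => f ξ • 𝓕 (ψ : E → ℂ) ξ) _
    _ = ∫ ξ, heatKernel u (z - ξ) • ψ ξ := by
        rw [← hflip]
        simp_rw [h1]
        rfl
    _ = ∫ ξ, heatKernel u ξ • ψ (z - ξ) := by
        rw [← integral_sub_left_eq_self (fun ξ => heatKernel u (z - ξ) • ψ ξ) volume z]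
        simp
    _ = _ := by
        rw [heat, integral_heatMeasure hu]

theorem heat_eq_besselMeasure {σ : ℝ} (hσ : 0 < σ) (ψ : 𝓢(E, ℂ)) (z : E) :
    ∫ u, heat u ψ z ∂gammaWeight (σ / 2) = ∫ y, ψ (z + y) ∂besselMeasure E σ := by
  rw [integral_besselMeasure hσ (ψ.bddCont.comp (by fun_prop : Continuous fun y : E => z + y))]
  refine integral_congr_ae ?_
  filter_upwards [ae_gammaWeight_pos (σ / 2)] with u hu
  exact heat_eq_integral_add ψ.bddCont hu z

/-- The Bessel potential of negative order on Schwartz functions is given by its kernel. -/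
theorem fourier_smulLeftCLM_fourierInv_eq {σ : ℝ} (hσ : 0 < σ) (ψ : 𝓢(E, ℂ)) (z : E) :
    𝓕 (SchwartzMap.smulLeftCLM ℂ (fun x : E => (((1 + ‖x‖ ^ 2) ^ (-σ / 2) : ℝ) : ℂ)) (𝓕⁻ ψ)) z =
      ∫ y, ψ (z + y) ∂besselMeasure E σ := by
  have hP := isProbabilityMeasure_gammaWeight (half_pos hσ)
  have hΨ : Integrable (𝓕⁻ ψ : 𝓢(E, ℂ)) := (𝓕⁻ ψ).integrable
  rw [← heat_eq_besselMeasure hσ, SchwartzMap.fourier_coe, Real.fourier_eq]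
  -- The Gaussian factor is at most 1 for u > 0, so the integrand is dominated by the integrable
  -- function |𝓕⁻ψ|.
  have hswap : Integrable (fun x : E × ℝ => 𝐞 (-inner ℝ x.1 z) •
      ((Real.exp (-(x.2 * ‖x.1‖ ^ 2)) : ℝ) • (𝓕⁻ ψ) x.1)) (volume.prod (gammaWeight (σ / 2))) := by
    refine Integrable.mono' (hΨ.norm.comp_fst (gammaWeight (σ / 2))) ?_ ?_
    · have h1 := (𝓕⁻ ψ).continuous
      have h2 := Real.continuous_fourierChar
      refine Continuous.aestronglyMeasurable ?_
      exact (h2.comp (by fun_prop)).smul (by fun_prop)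
    · have h1 : ∀ᵐ x ∂(volume : Measure E).prod (gammaWeight (σ / 2)), 0 < x.2 :=
        Measure.quasiMeasurePreserving_snd.ae (ae_gammaWeight_pos _)
      filter_upwards [h1] with x hx
      rw [Circle.norm_smul, norm_smul, Real.norm_eq_abs, abs_of_pos (Real.exp_pos _)]
      refine mul_le_of_le_one_left (norm_nonneg _) (Real.exp_le_one_iff.2 ?_)
      have : 0 ≤ x.2 * ‖x.1‖ ^ 2 := by positivity
      linarith
  calc _ = ∫ ξ : E, ∫ u, 𝐞 (-inner ℝ ξ z) • ((Real.exp (-(u * ‖ξ‖ ^ 2)) : ℝ) • (𝓕⁻ ψ) ξ)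
          ∂gammaWeight (σ / 2) := by
        refine integral_congr_ae (ae_of_all _ fun ξ => ?_)
        simp only [Circle.smul_def]
        rw [integral_smul, integral_smul_const,
          integral_gammaWeight_exp (half_pos hσ) (by positivity),
          SchwartzMap.smulLeftCLM_apply_apply (by fun_prop), neg_div]
        rfl
    _ = ∫ u, ∫ ξ : E, 𝐞 (-inner ℝ ξ z) • ((Real.exp (-(u * ‖ξ‖ ^ 2)) : ℝ) • (𝓕⁻ ψ) ξ)
          ∂volume ∂gammaWeight (σ / 2) := integral_integral_swap hswap
    _ = _ := by
        refine integral_congr_ae ?_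
        filter_upwards [ae_gammaWeight_pos (σ / 2)] with u hu
        exact fourier_gaussian_mul_fourierInv ψ hu z

end Bessel

end LocalSmoothing

end

/-! ### From the distributional identity to convolution with the Bessel kernel. -/

noncomputable section

namespace LocalSmoothing

open scoped Real Topology FourierTransform
open Filter

theorem lintegral_enorm_rpow_eq {α : Type*} [MeasurableSpace α] {μ : Measure α} {p : ℝ≥0∞}
    (hp0 : p ≠ 0) (hp : p ≠ ⊤) {ε : Type*} [ENorm ε] (f : α → ε) :
    ∫⁻ x, ‖f x‖ₑ ^ p.toReal ∂μ = eLpNorm f p μ ^ p.toReal := by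
  rw [eLpNorm_eq_lintegral_rpow_enorm_toReal hp0 hp, ← ENNReal.rpow_mul,
    one_div_mul_cancel (ENNReal.toReal_pos hp0 hp).ne', ENNReal.rpow_one]

theorem lintegral_enorm_rpow_ne_top {α : Type*} [MeasurableSpace α] {μ : Measure α} {p : ℝ≥0∞}
    (hp0 : p ≠ 0) (hp : p ≠ ⊤) {f : α → ℂ} (hf : MemLp f p μ) :
    ∫⁻ x, ‖f x‖ₑ ^ p.toReal ∂μ ≠ ⊤ := by
  rw [lintegral_enorm_rpow_eq hp0 hp]
  exact ENNReal.rpow_ne_top_of_nonneg ENNReal.toReal_nonneg hf.2.ne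

section Convolution

variable {E : Type*} [NormedAddCommGroup E] [InnerProductSpace ℝ E] [FiniteDimensional ℝ E]
  [MeasurableSpace E] [BorelSpace E]

theorem ae_integrable_sub {G : E → ℂ} (hG : StronglyMeasurable G) {q : ℝ} (hq : 1 ≤ q)
    (hGq : ∫⁻ x, ‖G x‖ₑ ^ q ≠ ⊤) (ν : Measure E) [IsFiniteMeasure ν] :
    ∀ᵐ z, Integrable (fun y => G (z - y)) ν := by
  have h := lintegral_conv_rpow_le ν hq hG.measurable.enorm
  have hfin : ∫⁻ x, (∫⁻ y, ‖G (x - y)‖ₑ ∂ν) ^ q ≠ ⊤ := ne_top_of_le_ne_top (ENNReal.mul_ne_top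
    (ENNReal.rpow_ne_top_of_nonneg (by linarith) (measure_ne_top _ _)) hGq) h
  have hm : Measurable fun x => (∫⁻ y, ‖G (x - y)‖ₑ ∂ν) ^ q :=
    (Measurable.lintegral_prod_right' (f := fun z : E × E => ‖G (z.1 - z.2)‖ₑ)
      (hG.measurable.enorm.comp (by fun_prop))).pow_const q
  filter_upwards [ae_lt_top hm hfin] with z hz
  refine ⟨(hG.comp_measurable (by fun_prop)).aestronglyMeasurable, ?_⟩
  rwa [ENNReal.rpow_lt_top_iff_of_pos (by linarith)] at hz

/-- Pointwise h ≤ 1 or h ≤ h^q, so integrability and boundedness of ψ suffice. -/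
theorem lintegral_schwartz_mul_ne_top (ψ : 𝓢(E, ℂ)) {h : E → ℝ≥0∞} (hm : Measurable h) {q : ℝ}
    (hq : 1 ≤ q) (hfin : ∫⁻ x, h x ^ q ≠ ⊤) : ∫⁻ x, ‖ψ x‖ₑ * h x ≠ ⊤ := by
  obtain ⟨M, hM⟩ := ψ.bddCont.bounded
  have hψm : Measurable fun x => ‖ψ x‖ₑ := ψ.continuous.measurable.enorm
  have hle : ∀ x, ‖ψ x‖ₑ * h x ≤ ‖ψ x‖ₑ + ENNReal.ofReal M * h x ^ q := by
    intro x
    rcases le_total (h x) 1 with h1 | h1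
    · exact (mul_le_of_le_one_right' h1).trans le_self_add
    · refine le_trans ?_ le_add_self
      gcongr
      · rw [← ofReal_norm]; exact ENNReal.ofReal_le_ofReal (hM x)
      · simpa using ENNReal.rpow_le_rpow_of_exponent_le h1 hq
  refine ne_top_of_le_ne_top ?_ (lintegral_mono hle)
  rw [lintegral_add_left hψm, lintegral_const_mul _ (hm.pow_const q)]
  exact ENNReal.add_ne_top.2 ⟨ψ.integrable.2.ne, ENNReal.mul_ne_top ENNReal.ofReal_ne_top hfin⟩

/-- Fubini and translation invariance transfer the convolution from the test function to G. -/
theorem integral_mul_conv_eq (ψ : 𝓢(E, ℂ)) {G : E → ℂ} (hG : StronglyMeasurable G) {q : ℝ}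
    (hq : 1 ≤ q) (hGq : ∫⁻ x, ‖G x‖ₑ ^ q ≠ ⊤) (ν : Measure E) [IsFiniteMeasure ν] :
    ∫ z, (∫ y, ψ (z + y) ∂ν) • G z = ∫ z, ψ z • ∫ y, G (z - y) ∂ν := by
  have hGm := hG.measurable
  have hψm := ψ.continuous.measurable
  have hm : Measurable fun z => ∫⁻ y, ‖G (z - y)‖ₑ ∂ν :=
    Measurable.lintegral_prod_right' (f := fun z : E × E => ‖G (z.1 - z.2)‖ₑ) (by fun_prop)
  have hfin : ∫⁻ x, ‖ψ x‖ₑ * ∫⁻ y, ‖G (x - y)‖ₑ ∂ν ≠ ⊤ := by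
    refine lintegral_schwartz_mul_ne_top ψ hm hq (ne_top_of_le_ne_top (ENNReal.mul_ne_top
      (ENNReal.rpow_ne_top_of_nonneg (by linarith) (measure_ne_top _ _)) hGq)
      (lintegral_conv_rpow_le ν hq hGm.enorm))
  have hI : Integrable (fun z : E × E => ψ z.1 • G (z.1 - z.2)) (volume.prod ν) := by
    refine ⟨Measurable.aestronglyMeasurable (by fun_prop), ?_⟩
    rw [HasFiniteIntegral, lintegral_prod _ (by fun_prop)]
    refine lt_of_le_of_lt (lintegral_mono fun x => ?_) hfin.lt_top
    rw [← lintegral_const_mul _ (by fun_prop)]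
    exact lintegral_mono fun y => (enorm_smul _ _).le
  have hI' : Integrable (fun z : E × E => ψ (z.1 + z.2) • G z.1) (volume.prod ν) := by
    refine ⟨Measurable.aestronglyMeasurable (by fun_prop), ?_⟩
    have h2 := hI.2
    rw [HasFiniteIntegral, lintegral_prod_symm _ (by fun_prop)] at h2 ⊢
    refine lt_of_le_of_lt (lintegral_mono fun y => le_of_eq ?_) h2
    rw [← lintegral_add_right_eq_self (fun x => ‖ψ x • G (x - y)‖ₑ) y]
    simp
  calc _ = ∫ z, ∫ y, ψ (z + y) • G z ∂ν := by simp_rw [integral_smul_const]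
    _ = ∫ y, ∫ z, ψ (z + y) • G z ∂volume ∂ν := integral_integral_swap hI'
    _ = ∫ y, ∫ z, ψ z • G (z - y) ∂volume ∂ν := by
        refine integral_congr_ae (ae_of_all _ fun y => ?_)
        simp only
        rw [← integral_add_right_eq_self (fun x => ψ x • G (x - y)) y]
        simp
    _ = ∫ z, ∫ y, ψ z • G (z - y) ∂ν := (integral_integral_swap hI).symm
    _ = _ := by simp_rw [integral_smul]

/-- If `(1 + |D|²)^{σ/2} F = G`, then `F` is the convolution of `G` with the Bessel kernel. -/
theorem ae_eq_integral_besselMeasure {p : ℝ≥0∞} [hp1 : Fact (1 ≤ p)] (hp : p ≠ ⊤) {σ : ℝ}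
    (hσ : 0 < σ) {F G : Lp ℂ p (volume : Measure E)}
    (h : TemperedDistribution.besselPotential E ℂ σ (F : 𝓢'(E, ℂ)) = (G : 𝓢'(E, ℂ))) :
    ∀ᵐ z, F z = ∫ y, G (z - y) ∂besselMeasure E σ := by
  have hP := isProbabilityMeasure_besselMeasure (E := E) hσ
  have hp0 : p ≠ 0 := (zero_lt_one.trans_le hp1.out).ne'
  have hq : 1 ≤ p.toReal := by
    rw [← ENNReal.toReal_one]; exact ENNReal.toReal_mono hp hp1.out
  have hGq := lintegral_enorm_rpow_ne_top hp0 hp (Lp.memLp G)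
  have hGm := Lp.stronglyMeasurable G
  have hconv : MemLp (fun z => ∫ y, G (z - y) ∂besselMeasure E σ) p volume := by
    refine ⟨StronglyMeasurable.aestronglyMeasurable ?_, ?_⟩
    · exact StronglyMeasurable.integral_prod_right' (f := fun z : E × E => G (z.1 - z.2))
        (hGm.comp_measurable (by fun_prop))
    · rw [eLpNorm_lt_top_iff_lintegral_rpow_enorm_lt_top hp0 hp]
      refine lt_of_le_of_lt (lintegral_mono fun z => ENNReal.rpow_le_rpow
        (enorm_integral_le_lintegral_enorm _) ENNReal.toReal_nonneg) ?_
      refine lt_of_le_of_lt (lintegral_conv_rpow_le (besselMeasure E σ) hq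
        hGm.measurable.enorm) ?_
      simpa using hGq.lt_top
  -- Both sides are locally integrable, so it is enough to test against smooth functions of compact
  -- support.
  refine ae_eq_of_integral_contDiff_smul_eq ((Lp.memLp F).locallyIntegrable hp1.out)
    (hconv.locallyIntegrable hp1.out) fun g hg hgc => ?_
  let ψ : 𝓢(E, ℂ) := HasCompactSupport.toSchwartzMap (f := fun x => (g x : ℂ))
    (hgc.comp_left (g := ((↑) : ℝ → ℂ)) Complex.ofReal_zero)
    (Complex.ofRealCLM.contDiff.comp hg)
  have hψ : ∀ x, ψ x = g x := fun x => rfl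
  rw [← TemperedDistribution.besselPotential_neg_apply_eq_iff] at h
  have h1 : (F : 𝓢'(E, ℂ)) ψ = ((TemperedDistribution.besselPotential E ℂ (-σ))
      (G : 𝓢'(E, ℂ))) ψ := by rw [h]
  rw [TemperedDistribution.besselPotential,
    TemperedDistribution.fourierMultiplierCLM_apply_apply, Lp.toTemperedDistribution_apply,
    Lp.toTemperedDistribution_apply] at h1
  simp_rw [fourier_smulLeftCLM_fourierInv_eq hσ] at h1
  rw [integral_mul_conv_eq ψ hGm hq hGq] at h1
  simpa [hψ] using h1

end Convolution

end LocalSmoothing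

end

/-! ### Smoothing a Bessel potential in the space variables only. -/

noncomputable section

namespace LocalSmoothing

open scoped Real Topology FourierTransform
open Filter

theorem min_add_tsub_eq (a b : ℝ≥0∞) : min a b + (a - b) = a := by
  rcases le_total a b with h | h
  · rw [min_eq_left h, tsub_eq_zero_of_le h, add_zero]
  · rw [min_eq_right h, add_tsub_cancel_of_le h]

section SpaceTime

variable {V : Type*} [NormedAddCommGroup V] [InnerProductSpace ℝ V] [FiniteDimensional ℝ V]
  [MeasurableSpace V] [BorelSpace V]

@[fun_prop]
theorem _root_.Measurable.heatKernel {α : Type*} [MeasurableSpace α] {f : α → ℝ} {g : α → V}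
    (hf : Measurable f) (hg : Measurable g) : Measurable fun a => heatKernel (f a) (g a) :=
  measurable_heatKernel.comp (hf.prodMk hg)

@[fun_prop]
theorem measurable_withLp_fst : Measurable (fun z : WithLp 2 (V × ℝ) => z.fst) :=
  (by fun_prop : Continuous fun z : WithLp 2 (V × ℝ) => z.fst).measurable

@[fun_prop]
theorem measurable_withLp_snd : Measurable (fun z : WithLp 2 (V × ℝ) => z.snd) :=
  (by fun_prop : Continuous fun z : WithLp 2 (V × ℝ) => z.snd).measurable

@[fun_prop]
theorem measurable_toLp_prod : Measurable (fun z : V × ℝ => WithLp.toLp 2 z) :=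
  (by fun_prop : Continuous fun z : V × ℝ => WithLp.toLp 2 z).measurable

theorem lintegral_withLp_prod {φ : WithLp 2 (V × ℝ) → ℝ≥0∞} (hφ : Measurable φ) :
    ∫⁻ z, φ z = ∫⁻ x : V, ∫⁻ t : ℝ, φ (WithLp.toLp 2 (x, t)) := by
  rw [← (WithLp.volume_preserving_toLp V ℝ).lintegral_comp hφ, Measure.volume_eq_prod,
    lintegral_prod _ (by fun_prop)]

theorem ae_withLp_prod {P : WithLp 2 (V × ℝ) → Prop} (h : ∀ᵐ z, P z) :
    ∀ᵐ x : V, ∀ᵐ t : ℝ, P (WithLp.toLp 2 (x, t)) := by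
  have h1 := (WithLp.volume_preserving_toLp V ℝ).quasiMeasurePreserving.ae h
  rw [Measure.volume_eq_prod] at h1
  exact Measure.ae_ae_of_ae_prod h1

/-- Convolution with the heat kernel in the space variables only. -/
def spatialHeatMeasure (V : Type*) [NormedAddCommGroup V] [InnerProductSpace ℝ V]
    [FiniteDimensional ℝ V] [MeasurableSpace V] [BorelSpace V] (s : ℝ) :
    Measure (WithLp 2 (V × ℝ)) :=
  (heatMeasure V s).map fun v => WithLp.toLp 2 (v, 0)

instance (s : ℝ) : SFinite (spatialHeatMeasure V s) := by
  unfold spatialHeatMeasure; infer_instance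

/-- The density of the heat kernel on space-time with time `u + s` in space and `u` in time. -/
def shiftedKernel (V : Type*) [NormedAddCommGroup V] [InnerProductSpace ℝ V]
    (s : ℝ) (z : ℝ × WithLp 2 (V × ℝ)) : ℝ≥0∞ :=
  ENNReal.ofReal (heatKernel (z.1 + s) z.2.fst) * ENNReal.ofReal (heatKernel z.1 z.2.snd)

@[fun_prop]
theorem measurable_shiftedKernel (s : ℝ) : Measurable (shiftedKernel V s) := by
  unfold shiftedKernel; fun_prop

theorem mixture_congr {E : Type*} [NormedAddCommGroup E] [InnerProductSpace ℝ E]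
    [FiniteDimensional ℝ E] [MeasurableSpace E] [BorelSpace E] (σ : ℝ) {κ κ' : ℝ × E → ℝ≥0∞}
    (h : ∀ u, 0 < u → ∀ y, κ (u, y) = κ' (u, y)) : mixture σ κ = mixture σ κ' := by
  unfold mixture
  rw [withDensity_congr_ae]
  have h1 : ∀ᵐ z ∂(gammaWeight (σ / 2)).prod (volume : Measure E), 0 < z.1 :=
    Measure.quasiMeasurePreserving_fst.ae (ae_gammaWeight_pos _)
  filter_upwards [h1] with z hz
  exact h z.1 hz z.2

theorem besselMeasure_eq_mixture (σ : ℝ) :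
    besselMeasure (WithLp 2 (V × ℝ)) σ = mixture σ (shiftedKernel V 0) := by
  refine mixture_congr σ fun u hu z => ?_
  rw [shiftedKernel, heatKernel_prod hu, ENNReal.ofReal_mul (heatKernel_pos hu _).le, add_zero]

theorem lintegral_heatMeasure_add {s u : ℝ} (hs : 0 < s) (hu : 0 < u) {φ : V → ℝ≥0∞}
    (hφ : Measurable φ) :
    ∫⁻ v, ∫⁻ x, ENNReal.ofReal (heatKernel u x) * φ (v + x) ∂volume ∂heatMeasure V s =
      ∫⁻ x, ENNReal.ofReal (heatKernel (u + s) x) * φ x := by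
  rw [← lintegral_heatMeasure _ hφ.aemeasurable, add_comm u s, ← heatMeasure_conv hs hu,
    Measure.lintegral_conv hφ]
  refine lintegral_congr fun v => ?_
  rw [lintegral_heatMeasure u (by fun_prop)]

/-- For each u the space-time Gaussian is a product. Spatial smoothing affects only its first
factor, where the semigroup law turns time u into u + s. -/
theorem spatialHeatMeasure_conv_mixture (σ : ℝ) {s : ℝ} (hs : 0 < s) :
    (spatialHeatMeasure V s).conv (mixture σ (shiftedKernel V 0)) =
      mixture σ (shiftedKernel V s) := by
  have hsf : SFinite (mixture σ (shiftedKernel V 0)) := by unfold mixture; infer_instance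
  have hm0 := measurable_shiftedKernel (V := V) 0
  have hms := measurable_shiftedKernel (V := V) s
  refine Measure.ext_of_lintegral _ fun φ hφ => ?_
  rw [Measure.lintegral_conv hφ, lintegral_mixture σ hms hφ, spatialHeatMeasure, lintegral_map
    (Measurable.lintegral_prod_right' (f := fun z : WithLp 2 (V × ℝ) × WithLp 2 (V × ℝ) =>
      φ (z.1 + z.2)) (by fun_prop)) (by fun_prop)]
  have h1 : ∀ v : V, ∫⁻ y, φ (WithLp.toLp 2 (v, 0) + y) ∂mixture σ (shiftedKernel V 0) =
      ∫⁻ u, ∫⁻ y, shiftedKernel V 0 (u, y) * φ (WithLp.toLp 2 (v, 0) + y)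
        ∂volume ∂gammaWeight (σ / 2) := fun v => lintegral_mixture σ hm0 (by fun_prop)
  simp_rw [h1]
  rw [lintegral_lintegral_swap (Measurable.aemeasurable (Measurable.lintegral_prod_right'
    (f := fun z : (V × ℝ) × WithLp 2 (V × ℝ) =>
      shiftedKernel V 0 (z.1.2, z.2) * φ (WithLp.toLp 2 (z.1.1, 0) + z.2)) (by fun_prop)))]
  refine lintegral_congr_ae ?_
  filter_upwards [ae_gammaWeight_pos (σ / 2)] with u hu
  rw [lintegral_withLp_prod (by fun_prop)]
  have h2 : ∀ v : V, ∫⁻ y, shiftedKernel V 0 (u, y) * φ (WithLp.toLp 2 (v, 0) + y) =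
      ∫⁻ t : ℝ, ∫⁻ x : V, ENNReal.ofReal (heatKernel u x) *
        (ENNReal.ofReal (heatKernel u t) * φ (WithLp.toLp 2 (v + x, t))) := by
    intro v
    rw [lintegral_withLp_prod (by fun_prop), lintegral_lintegral_swap (by fun_prop)]
    refine lintegral_congr fun t => lintegral_congr fun x => ?_
    rw [shiftedKernel, ← mul_assoc, add_zero]
    congr 2
    rw [← WithLp.toLp_add, Prod.mk_add_mk, zero_add]
  simp_rw [h2]
  have h3 : Measurable fun z : (V × ℝ) × V => ENNReal.ofReal (heatKernel u z.2) *
      (ENNReal.ofReal (heatKernel u z.1.2) * φ (WithLp.toLp 2 (z.1.1 + z.2, z.1.2))) := by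
    fun_prop
  rw [lintegral_lintegral_swap h3.lintegral_prod_right'.aemeasurable]
  have h4 : Measurable fun z : V × ℝ => shiftedKernel V s (u, WithLp.toLp 2 z) *
      φ (WithLp.toLp 2 z) := by fun_prop
  conv_rhs => rw [lintegral_lintegral_swap h4.aemeasurable]
  refine lintegral_congr fun t => ?_
  rw [lintegral_heatMeasure_add hs hu (φ := fun x => ENNReal.ofReal (heatKernel u t) *
    φ (WithLp.toLp 2 (x, t))) (by fun_prop)]
  refine lintegral_congr fun x => ?_
  rw [shiftedKernel, ← mul_assoc]
  rfl

/-- The absolute difference of the heat kernels at times `u` and `u + s`. -/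
def heatDiff (V : Type*) [NormedAddCommGroup V] [InnerProductSpace ℝ V] (s : ℝ) (z : ℝ × V) :
    ℝ≥0∞ :=
  (ENNReal.ofReal (heatKernel z.1 z.2) - ENNReal.ofReal (heatKernel (z.1 + s) z.2)) +
    (ENNReal.ofReal (heatKernel (z.1 + s) z.2) - ENNReal.ofReal (heatKernel z.1 z.2))

@[fun_prop]
theorem measurable_heatDiff (s : ℝ) : Measurable (heatDiff V s) := by
  unfold heatDiff; fun_prop

/-- The common part `c` cancels. This plays the role of integrating against the total variation of a
signed measure. -/
theorem enorm_integral_sub_integral_le {α : Type*} [MeasurableSpace α] {c ζ ζ' : Measure α}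
    {f : α → ℂ} (h : Integrable f (c + ζ)) (h' : Integrable f (c + ζ')) :
    ‖∫ x, f x ∂(c + ζ) - ∫ x, f x ∂(c + ζ')‖ₑ ≤ ∫⁻ x, ‖f x‖ₑ ∂(ζ + ζ') := by
  rw [integrable_add_measure] at h h'
  rw [integral_add_measure h.1 h.2, integral_add_measure h'.1 h'.2, add_sub_add_left_eq_sub,
    lintegral_add_measure]
  exact (enorm_sub_le).trans (add_le_add (enorm_integral_le_lintegral_enorm _)
    (enorm_integral_le_lintegral_enorm _))

theorem isFiniteMeasure_mixture_shiftedKernel {σ s : ℝ} (hσ : 0 < σ) (hs : 0 ≤ s) :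
    IsFiniteMeasure (mixture σ (shiftedKernel V s)) := by
  rcases hs.eq_or_lt with rfl | hs
  · rw [← besselMeasure_eq_mixture]
    have := isProbabilityMeasure_besselMeasure (E := WithLp 2 (V × ℝ)) hσ
    infer_instance
  · rw [← spatialHeatMeasure_conv_mixture σ hs, ← besselMeasure_eq_mixture]
    have := isProbabilityMeasure_besselMeasure (E := WithLp 2 (V × ℝ)) hσ
    have := isProbabilityMeasure_heatMeasure (V := V) hs
    have : IsFiniteMeasure (spatialHeatMeasure V s) := by
      unfold spatialHeatMeasure; infer_instance
    infer_instance

theorem integral_spatialHeatMeasure (s : ℝ) {F : WithLp 2 (V × ℝ) → ℂ} (hF : StronglyMeasurable F)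
    (z : WithLp 2 (V × ℝ)) :
    ∫ y, F (z - y) ∂spatialHeatMeasure V s =
      ∫ v, F (z - WithLp.toLp 2 (v, 0)) ∂heatMeasure V s := by
  rw [spatialHeatMeasure, integral_map (f := fun y => F (z - y)) (by fun_prop)]
  exact (hF.comp_measurable (by fun_prop)).aestronglyMeasurable

/-- The spatial high-frequency part of a Bessel potential is controlled by differences of heat
kernels. -/
theorem ae_enorm_sub_spatialHeat_le {p : ℝ≥0∞} [hp1 : Fact (1 ≤ p)] (hp : p ≠ ⊤) {σ s : ℝ}
    (hσ : 0 < σ) (hs : 0 < s) {F G : Lp ℂ p (volume : Measure (WithLp 2 (V × ℝ)))}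
    (h : TemperedDistribution.besselPotential (WithLp 2 (V × ℝ)) ℂ σ
      (F : 𝓢'(WithLp 2 (V × ℝ), ℂ)) = (G : 𝓢'(WithLp 2 (V × ℝ), ℂ))) :
    ∀ᵐ z, ‖F z - ∫ y, F (z - y) ∂spatialHeatMeasure V s‖ₑ ≤
      ∫⁻ u, ∫⁻ y, heatDiff V s (u, y.fst) * ENNReal.ofReal (heatKernel u y.snd) * ‖G (z - y)‖ₑ
        ∂volume ∂gammaWeight (σ / 2) := by
  have hp0 : p ≠ 0 := (zero_lt_one.trans_le hp1.out).ne'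
  have hq : 1 ≤ p.toReal := by
    rw [← ENNReal.toReal_one]; exact ENNReal.toReal_mono hp hp1.out
  have hGq := lintegral_enorm_rpow_ne_top hp0 hp (Lp.memLp G)
  have hGm := Lp.stronglyMeasurable G
  have hGm' := hGm.measurable
  set κ := shiftedKernel V 0
  set κ' := shiftedKernel V s
  have hκ : Measurable κ := measurable_shiftedKernel 0
  have hκ' : Measurable κ' := measurable_shiftedKernel s
  have hfin : IsFiniteMeasure (mixture σ κ) := isFiniteMeasure_mixture_shiftedKernel hσ le_rfl
  have hfin' : IsFiniteMeasure (mixture σ κ') := isFiniteMeasure_mixture_shiftedKernel hσ hs.le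
  have hFG := ae_eq_integral_besselMeasure hp hσ h
  rw [besselMeasure_eq_mixture] at hFG
  -- The common part is the mixture of the pointwise minimum. The two truncated differences left
  -- over add up to |κ - κ'|.
  have h1 : mixture σ κ = mixture σ (κ ⊓ κ') + mixture σ (κ - κ') := by
    rw [← mixture_add σ (hκ.inf hκ')]
    congr 1
    ext z
    exact (min_add_tsub_eq _ _).symm
  have h2 : mixture σ κ' = mixture σ (κ ⊓ κ') + mixture σ (κ' - κ) := by
    rw [← mixture_add σ (hκ.inf hκ'), inf_comm]
    congr 1
    ext z
    exact (min_add_tsub_eq _ _).symm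
  filter_upwards [hFG, ae_ae_sub_of_ae (spatialHeatMeasure V s) hFG,
    ae_integrable_sub hGm hq hGq (mixture σ κ), ae_integrable_sub hGm hq hGq (mixture σ κ')]
    with z hz1 hz2 hz3 hz4
  have h3 : ∫ y, F (z - y) ∂spatialHeatMeasure V s = ∫ y, G (z - y) ∂mixture σ κ' := by
    rw [integral_congr_ae hz2, ← spatialHeatMeasure_conv_mixture σ hs, integral_conv]
    · simp_rw [sub_sub]
    · rwa [spatialHeatMeasure_conv_mixture σ hs]
  rw [hz1, h3]
  rw [h1] at hz3 ⊢
  rw [h2] at hz4 ⊢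
  refine (enorm_integral_sub_integral_le hz3 hz4).trans (le_of_eq ?_)
  rw [← mixture_add σ (hκ.sub hκ'), lintegral_mixture σ ((hκ.sub hκ').add (hκ'.sub hκ))
    (φ := fun y => ‖G (z - y)‖ₑ) (hGm'.enorm.comp (by fun_prop))]
  refine lintegral_congr_ae ?_
  filter_upwards [ae_gammaWeight_pos (σ / 2)] with u hu
  refine lintegral_congr fun y => ?_
  simp only [Pi.add_apply, Pi.sub_apply, κ, κ', shiftedKernel, heatDiff, add_zero]
  rw [← ENNReal.sub_mul fun _ _ => ENNReal.ofReal_ne_top,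
    ← ENNReal.sub_mul fun _ _ => ENNReal.ofReal_ne_top, ← add_mul]

end SpaceTime

end LocalSmoothing

end

/-! ### A majorant independent of time. -/

noncomputable section

namespace LocalSmoothing

open scoped Real Topology FourierTransform
open Filter

section SpaceTime

variable {V : Type*} [NormedAddCommGroup V] [InnerProductSpace ℝ V] [FiniteDimensional ℝ V]
  [MeasurableSpace V] [BorelSpace V]

theorem heatKernel_real_le {u : ℝ} (hu : 0 < u) (t : ℝ) :
    heatKernel u t ≤ (π / u) ^ (1 / 2 : ℝ) := by
  unfold heatKernel
  rw [Module.finrank_self, Nat.cast_one]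
  refine mul_le_of_le_one_right (by positivity) (Real.exp_le_one_iff.2 ?_)
  have : 0 ≤ π ^ 2 / u * ‖t‖ ^ 2 := by positivity
  linarith

/-- The heat semigroup on the line maps `L^q` to `L^∞`. -/
theorem lintegral_heatKernel_mul_le {q u : ℝ} (hq : 1 ≤ q) (hu : 0 < u) {g : ℝ → ℝ≥0∞}
    (hg : Measurable g) (t : ℝ) :
    ∫⁻ r, ENNReal.ofReal (heatKernel u r) * g (t - r) ≤
      ENNReal.ofReal ((π / u) ^ (1 / (2 * q))) * (∫⁻ r, g r ^ q) ^ (1 / q) := by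
  have hq0 : 0 < q := by linarith
  have := isProbabilityMeasure_heatMeasure (V := ℝ) hu
  have h1 := rpow_lintegral_le_lintegral_rpow (ν := heatMeasure ℝ u) hq
    (g := fun r => g (t - r)) (by fun_prop)
  rw [lintegral_heatMeasure u (f := fun r => g (t - r)) (by fun_prop),
    lintegral_heatMeasure u (f := fun r => g (t - r) ^ q) (by fun_prop)] at h1
  have h2 : ∫⁻ r, ENNReal.ofReal (heatKernel u r) * g (t - r) ^ q ≤
      ENNReal.ofReal ((π / u) ^ (1 / 2 : ℝ)) * ∫⁻ r, g r ^ q := by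
    rw [← lintegral_sub_left_eq_self (fun r => g r ^ q) t,
      ← lintegral_const_mul _ (by fun_prop)]
    refine lintegral_mono fun r => ?_
    gcongr
    exact heatKernel_real_le hu r
  calc _ = ((∫⁻ r, ENNReal.ofReal (heatKernel u r) * g (t - r)) ^ q) ^ (1 / q) := by
        rw [← ENNReal.rpow_mul, mul_one_div_cancel hq0.ne', ENNReal.rpow_one]
    _ ≤ (ENNReal.ofReal ((π / u) ^ (1 / 2 : ℝ)) * ∫⁻ r, g r ^ q) ^ (1 / q) := by
        gcongr; exact h1.trans h2
    _ = _ := by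
        rw [ENNReal.mul_rpow_of_nonneg _ _ (by positivity),
          ENNReal.ofReal_rpow_of_nonneg (by positivity) (by positivity),
          ← Real.rpow_mul (by positivity)]
        congr 3
        field_simp

/-- The constant in `exists_majorant_of_besselPotential_eq`. -/
def majorantConst (d : ℕ) (σ q θ : ℝ) : ℝ :=
  2 * (d + 1) * π ^ (1 / (2 * q)) *
    (Real.Gamma (σ / 2 - (θ + 1 / (2 * q))) / Real.Gamma (σ / 2))

/-- The L¹ difference contributes (s/u)^θ and the weight u^{-1/(2q)}. What remains is the Gamma
moment of order -(θ + 1/(2q)). -/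
theorem lintegral_mixture_heatDiff_le {σ q θ s : ℝ} (hσ : 0 < σ) (hs : 0 < s)
    (hθ : 0 < θ) (hθ1 : θ ≤ 1) (hθσ : θ + 1 / (2 * q) < σ / 2) :
    mixture σ (fun z : ℝ × V => ENNReal.ofReal ((π / z.1) ^ (1 / (2 * q))) * heatDiff V s z) univ ≤
      ENNReal.ofReal (majorantConst (Module.finrank ℝ V) σ q θ * s ^ θ) := by
  rw [← lintegral_one, lintegral_mixture σ (φ := fun _ => 1) (by fun_prop) measurable_const]
  calc _ ≤ ∫⁻ u, ENNReal.ofReal (2 * (Module.finrank ℝ V + 1) * π ^ (1 / (2 * q)) * s ^ θ) *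
        ENNReal.ofReal (u ^ (-(θ + 1 / (2 * q)))) ∂gammaWeight (σ / 2) := by
        refine lintegral_mono_ae ?_
        filter_upwards [ae_gammaWeight_pos (σ / 2)] with u hu
        simp only [mul_one]
        rw [lintegral_const_mul _ (by fun_prop)]
        calc _ ≤ ENNReal.ofReal ((π / u) ^ (1 / (2 * q))) *
              ENNReal.ofReal (2 * (Module.finrank ℝ V + 1) * (s / u) ^ θ) := by
              gcongr
              exact lintegral_heatKernel_tsub_add_tsub_le hu hs hθ hθ1
          _ = _ := by
              rw [← ENNReal.ofReal_mul (by positivity), ← ENNReal.ofReal_mul (by positivity)]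
              congr 1
              rw [Real.div_rpow (by positivity) hu.le, Real.div_rpow hs.le hu.le,
                Real.rpow_neg hu.le, Real.rpow_add hu]
              field_simp
    _ = _ := by
        rw [lintegral_const_mul _ (by fun_prop),
          lintegral_gammaWeight_rpow_neg (half_pos hσ) hθσ, ← ENNReal.ofReal_mul (by positivity)]
        congr 1
        rw [majorantConst]
        ring

/-- A quantitative Sobolev embedding in t. The time factor of the kernel bounds G(x,·) in L^∞ by its
L^q norm N(x), which removes t. There remains the convolution of N with a measure on space of mass
O(s^θ), to which Young's inequality applies. -/
theorem exists_majorant_of_besselPotential_eq {p : ℝ≥0∞} [hp1 : Fact (1 ≤ p)] (hp : p ≠ ⊤)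
    {σ θ s : ℝ} (hσ : 0 < σ) (hs : 0 < s) (hθ : 0 < θ) (hθ1 : θ ≤ 1)
    (hθσ : θ + 1 / (2 * p.toReal) < σ / 2) {F G : Lp ℂ p (volume : Measure (WithLp 2 (V × ℝ)))}
    (h : TemperedDistribution.besselPotential (WithLp 2 (V × ℝ)) ℂ σ
      (F : 𝓢'(WithLp 2 (V × ℝ), ℂ)) = (G : 𝓢'(WithLp 2 (V × ℝ), ℂ))) :
    ∃ H : V → ℝ≥0∞, Measurable H ∧
      (∀ᵐ z, ‖F z - ∫ y, F (z - y) ∂spatialHeatMeasure V s‖ₑ ≤ H z.fst) ∧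
      ∫⁻ x, H x ^ p.toReal ≤
        ENNReal.ofReal (majorantConst (Module.finrank ℝ V) σ p.toReal θ * s ^ θ) ^ p.toReal *
          ∫⁻ z, ‖G z‖ₑ ^ p.toReal := by
  have hq : 1 ≤ p.toReal := by
    rw [← ENNReal.toReal_one]; exact ENNReal.toReal_mono hp hp1.out
  have hq0 : 0 < p.toReal := by linarith
  have hGm : Measurable G := (Lp.stronglyMeasurable G).measurable
  set q := p.toReal
  set ζ : Measure V := mixture σ
    (fun z : ℝ × V => ENNReal.ofReal ((π / z.1) ^ (1 / (2 * q))) * heatDiff V s z) with hζ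
  have hmass := lintegral_mixture_heatDiff_le (V := V) hσ hs hθ hθ1 hθσ
  have : IsFiniteMeasure ζ := ⟨hmass.trans_lt ENNReal.ofReal_lt_top⟩
  set N : V → ℝ≥0∞ := fun x => (∫⁻ t : ℝ, ‖G (WithLp.toLp 2 (x, t))‖ₑ ^ q) ^ (1 / q) with hN
  have hNm : Measurable N := (Measurable.lintegral_prod_right'
    (f := fun z : V × ℝ => ‖G (WithLp.toLp 2 z)‖ₑ ^ q) (by fun_prop)).pow_const _
  refine ⟨fun x => ∫⁻ y, N (x - y) ∂ζ, Measurable.lintegral_prod_right'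
    (f := fun z : V × V => N (z.1 - z.2)) (by fun_prop), ?_, ?_⟩
  · filter_upwards [ae_enorm_sub_spatialHeat_le hp hσ hs h] with z hz
    refine hz.trans ?_
    rw [hζ, lintegral_mixture σ (by fun_prop) (φ := fun y => N (z.fst - y)) (by fun_prop)]
    refine lintegral_mono_ae ?_
    filter_upwards [ae_gammaWeight_pos (σ / 2)] with u hu
    rw [lintegral_withLp_prod (by fun_prop)]
    refine lintegral_mono fun x => ?_
    calc _ = heatDiff V s (u, x) * ∫⁻ t : ℝ, ENNReal.ofReal (heatKernel u t) *
          ‖G (WithLp.toLp 2 (z.fst - x, z.snd - t))‖ₑ := by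
          rw [← lintegral_const_mul _ (by fun_prop)]
          refine lintegral_congr fun t => ?_
          rw [mul_assoc]
          rfl
      _ ≤ heatDiff V s (u, x) *
          (ENNReal.ofReal ((π / u) ^ (1 / (2 * q))) * N (z.fst - x)) := by
          gcongr
          exact lintegral_heatKernel_mul_le hq hu
            (g := fun t => ‖G (WithLp.toLp 2 (z.fst - x, t))‖ₑ) (by fun_prop) z.snd
      _ = _ := by ring
  · refine (lintegral_conv_rpow_le ζ hq hNm).trans ?_
    have hNq : ∫⁻ x, N x ^ q = ∫⁻ z, ‖G z‖ₑ ^ q := by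
      rw [lintegral_withLp_prod (by fun_prop)]
      refine lintegral_congr fun x => ?_
      rw [hN]
      simp only
      rw [← ENNReal.rpow_mul, one_div_mul_cancel hq0.ne', ENNReal.rpow_one]
    rw [hNq]
    gcongr

end SpaceTime

end LocalSmoothing

end

/-! ### Averages over one window of dilations. -/

noncomputable section

namespace LocalSmoothing

open scoped Real Topology
open Filter

section Average

variable {n : ℕ} {γ : ℝ → Space n} {χ : ℝ → ℝ}

theorem integrable_average (hγ : Continuous γ) (hχ : Continuous χ) (hχc : HasCompactSupport χ)
    {f : Space n → ℂ} (hf : Continuous f) (t : ℝ) (x : Space n) :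
    Integrable (fun s => χ s • f (x - t • γ s)) :=
  Continuous.integrable_of_hasCompactSupport (by fun_prop) hχc.smul_right

theorem continuous_average (hγ : Continuous γ) (hχ : Continuous χ) (hχc : HasCompactSupport χ)
    {f : Space n → ℂ} (hf : Continuous f) :
    Continuous fun z : ℝ × Space n => average γ χ z.1 f z.2 := by
  have h : ∀ z : ℝ × Space n, average γ χ z.1 f z.2 =
      ∫ s in tsupport χ, χ s • f (z.2 - z.1 • γ s) := fun z =>
    (setIntegral_eq_integral_of_forall_compl_eq_zero fun s hs => by
      rw [image_eq_zero_of_notMem_tsupport hs, zero_smul]).symm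
  simp_rw [h]
  exact continuous_parametric_integral_of_continuous (by fun_prop) hχc

theorem average_sub (hγ : Continuous γ) (hχ : Continuous χ) (hχc : HasCompactSupport χ)
    {f g : Space n → ℂ} (hf : Continuous f) (hg : Continuous g) (t : ℝ) (x : Space n) :
    average γ χ t (fun y => f y - g y) x = average γ χ t f x - average γ χ t g x := by
  unfold average
  rw [← integral_sub (integrable_average hγ hχ hχc hf t x) (integrable_average hγ hχ hχc hg t x)]
  simp_rw [smul_sub]

/-- Averages commute with the heat semigroup. -/
theorem average_heat (hγ : Continuous γ) (hχ : Continuous χ) (hχc : HasCompactSupport χ)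
    {f : Space n → ℂ} (hf : BddCont f) {u : ℝ} (hu : 0 < u) (t : ℝ) (x : Space n) :
    average γ χ t (heat u f) x = ∫ v, average γ χ t f (x - v) ∂heatMeasure (Space n) u := by
  have := isProbabilityMeasure_heatMeasure (V := Space n) hu
  have hfc := hf.continuous
  obtain ⟨M, hM⟩ := hf.bounded
  have hI : Integrable (fun z : ℝ × Space n => χ z.1 • f (x - t • γ z.1 - z.2))
      (volume.prod (heatMeasure (Space n) u)) := by
    refine Integrable.mono' (((hχ.integrable_of_hasCompactSupport hχc).norm.mul_const M).comp_fst
      (heatMeasure (Space n) u)) (Continuous.aestronglyMeasurable (by fun_prop))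
      (ae_of_all _ fun z => ?_)
    rw [norm_smul]
    gcongr
    exact hM _
  calc _ = ∫ s, ∫ v, χ s • f (x - t • γ s - v) ∂heatMeasure (Space n) u := by
        unfold average heat
        simp_rw [integral_smul]
    _ = ∫ v, ∫ s, χ s • f (x - t • γ s - v) ∂volume ∂heatMeasure (Space n) u :=
        integral_integral_swap hI
    _ = _ := by
        unfold average
        simp_rw [sub_right_comm]

/-- Any nondegenerate window suffices, because the ratio of consecutive scales is later taken to be
d/c rather than 2. Positivity of c comes from the support of ρ. -/
theorem exists_Icc_le_abs {ρ : ℝ → ℝ} (hρ : Continuous ρ) (hsupp : tsupport ρ ⊆ Icc 1 2)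
    (hne : ρ ≠ 0) :
    ∃ c d ρ₀ : ℝ, 0 < c ∧ c < d ∧ 0 < ρ₀ ∧ ∀ t ∈ Icc c d, ρ₀ ≤ |ρ t| := by
  obtain ⟨t₀, ht₀⟩ := Function.ne_iff.1 hne
  have ht1 : 1 ≤ t₀ := (hsupp (subset_tsupport ρ ht₀)).1
  have hpos : 0 < |ρ t₀| := abs_pos.2 ht₀
  have hnhds : ∀ᶠ t in 𝓝 t₀, |ρ t₀| / 2 < |ρ t| :=
    (hρ.abs.tendsto t₀).eventually (lt_mem_nhds (by linarith))
  obtain ⟨ε, hε, hball⟩ := Metric.eventually_nhds_iff.1 hnhds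
  refine ⟨t₀, t₀ + ε / 2, |ρ t₀| / 2, by linarith, by linarith, by linarith, fun t ht => ?_⟩
  refine (hball ?_).le
  rw [Real.dist_eq, abs_lt]
  constructor <;> linarith [ht.1, ht.2]

/-- The local smoothing hypothesis gives decay for the averages over a compact range of dilations
of the high-frequency part of a function. -/
theorem exists_lintegral_iSup_average_sub_heat_le (hγ : Continuous γ) (hχ : Continuous χ)
    (hχc : HasCompactSupport χ) {ρ : ℝ → ℝ} (hρ : Continuous ρ) {c d ρ₀ : ℝ} (hρ₀ : 0 < ρ₀)
    (hρcd : ∀ t ∈ Icc c d, ρ₀ ≤ |ρ t|) {p : ℝ≥0∞} [hp1 : Fact (1 ≤ p)] (hp : p ≠ ⊤) {σ : ℝ}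
    (hσ : 1 / p.toReal < σ) (hLS : MapsLpBoundedlyIntoSobolev p σ (localizedAverage γ χ ρ)) :
    ∃ (C : ℝ≥0) (θ : ℝ), 0 < θ ∧ ∀ f : Space n → ℂ, BddCont f → MemLp f p volume →
      ∀ s : ℝ, 0 < s →
        ∫⁻ x, (⨆ t ∈ Icc c d, ‖average γ χ t f x - average γ χ t (heat s f) x‖ₑ) ^ p.toReal ≤
          (C * ENNReal.ofReal (s ^ θ)) ^ p.toReal * ∫⁻ x, ‖f x‖ₑ ^ p.toReal := by
  have hp0 : p ≠ 0 := (zero_lt_one.trans_le hp1.out).ne'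
  have hq : 1 ≤ p.toReal := by
    rw [← ENNReal.toReal_one]; exact ENNReal.toReal_mono hp hp1.out
  set q := p.toReal with hqdef
  have hq0 : 0 < q := by linarith
  have hσ0 : 0 < σ := lt_trans (by positivity) hσ
  -- Half of the gap provided by σ > 1/q keeps the Gamma moment finite; the cap 1 is required by the
  -- L¹ estimate.
  set θ := min 1 ((σ / 2 - 1 / (2 * q)) / 2) with hθdef
  have hgap : 0 < σ / 2 - 1 / (2 * q) := by
    have : 1 / (2 * q) = 1 / q / 2 := by field_simp
    rw [this]; linarith
  have hθ : 0 < θ := lt_min one_pos (by linarith)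
  have hθ1 : θ ≤ 1 := min_le_left _ _
  have hθσ : θ + 1 / (2 * q) < σ / 2 := by
    have := min_le_right 1 ((σ / 2 - 1 / (2 * q)) / 2)
    rw [← hθdef] at this
    linarith
  obtain ⟨K, hK⟩ := hLS
  set B := majorantConst (Module.finrank ℝ (Space n)) σ q θ
  refine ⟨(ρ₀⁻¹).toNNReal * B.toNNReal * K, θ, hθ, fun f hf hfp s hs => ?_⟩
  have := isProbabilityMeasure_heatMeasure (V := Space n) hs
  obtain ⟨F, G, hF, hFG, hG⟩ := hK f hfp
  obtain ⟨H, hHm, hH, hHint⟩ := exists_majorant_of_besselPotential_eq hp hσ0 hs hθ hθ1 hθσ hFG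
  have hAc := continuous_average hγ hχ hχc hf.continuous
  have hAhc := continuous_average hγ hχ hχc (hf.heat hs).continuous
  set A := localizedAverage γ χ ρ f with hA
  have hAm : StronglyMeasurable A := by
    refine Continuous.stronglyMeasurable ?_
    rw [hA]
    unfold localizedAverage
    exact (hρ.comp (by fun_prop)).smul
      (hAc.comp (by fun_prop : Continuous fun z : SpaceTime n => (z.snd, z.fst)))
  -- Spatial heat flow commutes with A_t and with multiplication by ρ(t), so F minus its spatial
  -- smoothing is ρ(t)A_t(f - P_s f).
  have hAH : ∀ᵐ z : SpaceTime n, ‖ρ z.snd • (average γ χ z.snd f z.fst -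
      average γ χ z.snd (heat s f) z.fst)‖ₑ ≤ H z.fst := by
    filter_upwards [hH, hF, ae_ae_sub_of_ae (spatialHeatMeasure (Space n) s) hF] with z h1 h2 h3
    rw [integral_congr_ae h3, h2, integral_spatialHeatMeasure s hAm] at h1
    convert h1 using 2
    rw [smul_sub]
    congr 1
    rw [average_heat hγ hχ hχc hf hs, ← integral_smul]
    refine integral_congr_ae (ae_of_all _ fun v => ?_)
    simp [hA, localizedAverage]
  have hae : ∀ᵐ x : Space n, ∀ t : ℝ, ‖ρ t • (average γ χ t f x -
      average γ χ t (heat s f) x)‖ₑ ≤ H x := by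
    filter_upwards [ae_withLp_prod hAH] with x hx t
    -- For fixed x the bound is a closed condition on t that holds almost everywhere, hence on a
    -- dense set, hence for every t.
    have hcl : IsClosed {t : ℝ | ‖ρ t • (average γ χ t f x -
        average γ χ t (heat s f) x)‖ₑ ≤ H x} := by
      refine isClosed_le ?_ continuous_const
      refine Continuous.enorm (hρ.smul (Continuous.sub ?_ ?_))
      · exact hAc.comp (by fun_prop : Continuous fun t : ℝ => (t, x))
      · exact hAhc.comp (by fun_prop : Continuous fun t : ℝ => (t, x))
    have hd : Dense {t : ℝ | ‖ρ t • (average γ χ t f x -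
        average γ χ t (heat s f) x)‖ₑ ≤ H x} := Measure.dense_of_ae hx
    have := hcl.closure_eq ▸ hd t
    exact this
  have hGle : ∫⁻ z, ‖G z‖ₑ ^ q ≤ (K : ℝ≥0∞) ^ q * ∫⁻ x, ‖f x‖ₑ ^ q := by
    rw [lintegral_enorm_rpow_eq hp0 hp, lintegral_enorm_rpow_eq hp0 hp,
      ← ENNReal.mul_rpow_of_nonneg _ _ hq0.le, ← Lp.enorm_def]
    gcongr
  calc _ ≤ ∫⁻ x, (ENNReal.ofReal ρ₀⁻¹ * H x) ^ q := by
        refine lintegral_mono_ae ?_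
        filter_upwards [hae] with x hx
        gcongr
        refine iSup₂_le fun t ht => ?_
        have h1 := hx t
        rw [enorm_smul] at h1
        have h2 : ENNReal.ofReal ρ₀ ≤ ‖ρ t‖ₑ := by
          rw [← ofReal_norm]; exact ENNReal.ofReal_le_ofReal (hρcd t ht)
        rw [ENNReal.ofReal_inv_of_pos hρ₀, mul_comm, ← div_eq_mul_inv,
          ENNReal.le_div_iff_mul_le (Or.inl (by simpa using hρ₀)) (Or.inl ENNReal.ofReal_ne_top),
          mul_comm]
        exact (mul_le_mul_left h2 _).trans h1
    _ = ENNReal.ofReal ρ₀⁻¹ ^ q * ∫⁻ x, H x ^ q := by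
        simp_rw [ENNReal.mul_rpow_of_nonneg _ _ hq0.le]
        rw [lintegral_const_mul _ (by fun_prop)]
    _ ≤ ENNReal.ofReal ρ₀⁻¹ ^ q * (ENNReal.ofReal (B * s ^ θ) ^ q *
          ((K : ℝ≥0∞) ^ q * ∫⁻ x, ‖f x‖ₑ ^ q)) := by
        gcongr
        exact hHint.trans (by gcongr)
    _ = _ := by
        rw [← mul_assoc, ← mul_assoc, ← ENNReal.mul_rpow_of_nonneg _ _ hq0.le,
          ← ENNReal.mul_rpow_of_nonneg _ _ hq0.le, ENNReal.ofReal_mul' (by positivity)]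
        congr 2
        push_cast
        rw [ENNReal.ofReal, ENNReal.ofReal, ENNReal.ofReal]
        ring

end Average

end LocalSmoothing

end

/-! ### Summation in L^q, parabolic scaling, and low frequencies. -/

noncomputable section

namespace LocalSmoothing

open scoped Real Topology
open Filter

section Sums

variable {α : Type*} [MeasurableSpace α] {μ : Measure α}

theorem lintegral_add_rpow_le {q : ℝ} (hq : 1 ≤ q) {f g : α → ℝ≥0∞} (hf : Measurable f)
    (hg : Measurable g) {a b X : ℝ≥0∞} (hfa : ∫⁻ x, f x ^ q ∂μ ≤ a ^ q * X)
    (hgb : ∫⁻ x, g x ^ q ∂μ ≤ b ^ q * X) : ∫⁻ x, (f x + g x) ^ q ∂μ ≤ (a + b) ^ q * X := by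
  have hq0 : 0 < q := by linarith
  have key : ∀ {c Y : ℝ≥0∞}, Y ≤ c ^ q * X → Y ^ (1 / q) ≤ c * X ^ (1 / q) := by
    intro c Y h
    calc Y ^ (1 / q) ≤ (c ^ q * X) ^ (1 / q) := by gcongr
      _ = _ := by
        rw [ENNReal.mul_rpow_of_nonneg _ _ (by positivity), ← ENNReal.rpow_mul,
          mul_one_div_cancel hq0.ne', ENNReal.rpow_one]
  have h := ENNReal.lintegral_Lp_add_le hf.aemeasurable hg.aemeasurable (μ := μ) hq
  have h1 := h.trans (add_le_add (key hfa) (key hgb))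
  rw [← add_mul] at h1
  calc _ = ((∫⁻ x, (f x + g x) ^ q ∂μ) ^ (1 / q)) ^ q := by
        rw [← ENNReal.rpow_mul, one_div_mul_cancel hq0.ne', ENNReal.rpow_one]
    _ ≤ ((a + b) * X ^ (1 / q)) ^ q := by gcongr; exact h1
    _ = _ := by
        rw [ENNReal.mul_rpow_of_nonneg _ _ hq0.le, ← ENNReal.rpow_mul,
          one_div_mul_cancel hq0.ne', ENNReal.rpow_one]

theorem lintegral_tsum_rpow_le {q : ℝ} (hq : 1 ≤ q) {f : ℕ → α → ℝ≥0∞}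
    (hf : ∀ j, Measurable (f j)) {c : ℕ → ℝ≥0∞} {X : ℝ≥0∞}
    (h : ∀ j, ∫⁻ x, f j x ^ q ∂μ ≤ c j ^ q * X) :
    ∫⁻ x, (∑' j, f j x) ^ q ∂μ ≤ (∑' j, c j) ^ q * X := by
  have hq0 : 0 < q := by linarith
  have hfin : ∀ J, ∫⁻ x, (∑ j ∈ Finset.range J, f j x) ^ q ∂μ ≤
      (∑ j ∈ Finset.range J, c j) ^ q * X := by
    intro J
    induction J with
    | zero => simp [ENNReal.zero_rpow_of_pos hq0]
    | succ J ih =>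
      simp_rw [Finset.sum_range_succ]
      exact lintegral_add_rpow_le hq (by fun_prop) (hf J) ih (h J)
  have hsup : ∀ x, (∑' j, f j x) ^ q = ⨆ J, (∑ j ∈ Finset.range J, f j x) ^ q := by
    intro x
    rw [ENNReal.tsum_eq_iSup_nat]
    exact (ENNReal.orderIsoRpow q hq0).map_iSup _
  simp_rw [hsup]
  rw [lintegral_iSup (fun J => by fun_prop)]
  · refine iSup_le fun J => (hfin J).trans ?_
    gcongr
    exact ENNReal.sum_le_tsum _
  · intro J J' hJ x
    simp only
    gcongr

/-- The supremum over windows is replaced by an ℓ^q sum; the Littlewood–Paley inequality makes this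
affordable. -/
theorem lintegral_iSup_rpow_le {ι : Type*} [Countable ι] {q : ℝ} (hq : 0 < q) {f : ι → α → ℝ≥0∞}
    (hf : ∀ i, Measurable (f i)) :
    ∫⁻ x, (⨆ i, f i x) ^ q ∂μ ≤ ∑' i, ∫⁻ x, f i x ^ q ∂μ := by
  rw [← lintegral_tsum fun i => ((hf i).pow_const q).aemeasurable]
  refine lintegral_mono fun x => ?_
  have : (⨆ i, f i x) ^ q = ⨆ i, f i x ^ q := (ENNReal.orderIsoRpow q hq).map_iSup _
  rw [this]
  exact iSup_le fun i => ENNReal.le_tsum (f := fun i => f i x ^ q) i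

end Sums

section Dilation

variable {V : Type*} [NormedAddCommGroup V] [InnerProductSpace ℝ V] [FiniteDimensional ℝ V]
  [MeasurableSpace V] [BorelSpace V]

theorem lintegral_comp_smul_pos {κ : ℝ} (hκ : 0 < κ) {g : V → ℝ≥0∞} (hg : Measurable g) :
    ∫⁻ x, g (κ • x) = ENNReal.ofReal ((κ ^ Module.finrank ℝ V)⁻¹) * ∫⁻ x, g x := by
  rw [← lintegral_map hg (measurable_const_smul κ), Measure.map_addHaar_smul _ hκ.ne',
    lintegral_smul_measure, abs_of_pos (by positivity), smul_eq_mul]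

theorem heat_comp_smul {f : V → ℂ} (hf : BddCont f) {κ s : ℝ} (hκ : 0 < κ) (hs : 0 < s) (x : V) :
    heat s (fun y => f (κ • y)) x = heat (κ ^ 2 * s) f (κ • x) := by
  unfold heat
  rw [← map_smul_heatMeasure hs hκ, integral_map (f := fun y => f (κ • x - y)) (by fun_prop)
    (hf.continuous.comp (by fun_prop)).measurable.aestronglyMeasurable]
  simp_rw [smul_sub]

/-- At time κ² the heat measure is the κ-dilate of a fixed one, so convergence as κ → 0 follows by
domination. -/
theorem heat_sq_eq {f : V → ℂ} (hf : BddCont f) {κ : ℝ} (hκ : 0 < κ) (x : V) :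
    heat (κ ^ 2) f x = ∫ y, f (x - κ • y) ∂heatMeasure V 1 := by
  have h := map_smul_heatMeasure (V := V) one_pos hκ
  rw [mul_one] at h
  unfold heat
  rw [← h, integral_map (f := fun y => f (x - y)) (by fun_prop)
    (hf.continuous.comp (by fun_prop)).measurable.aestronglyMeasurable]

theorem tendsto_heat {f : V → ℂ} (hf : BddCont f) {κ : ℕ → ℝ} (hκ : ∀ i, 0 < κ i)
    (hlim : Tendsto κ atTop (𝓝 0)) (x : V) :
    Tendsto (fun i => heat (κ i ^ 2) f x) atTop (𝓝 (f x)) := by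
  have := isProbabilityMeasure_heatMeasure (V := V) one_pos
  simp_rw [heat_sq_eq hf (hκ _)]
  obtain ⟨M, hM⟩ := hf.bounded
  have h1 : f x = ∫ _, f x ∂heatMeasure V 1 := by simp
  rw [h1]
  refine tendsto_integral_of_dominated_convergence (fun _ => M) (fun i => ?_) (integrable_const _)
    (fun i => ae_of_all _ fun y => hM _) (ae_of_all _ fun y => ?_)
  · exact (hf.continuous.comp (by fun_prop)).measurable.aestronglyMeasurable
  · have : Tendsto (fun i => x - κ i • y) atTop (𝓝 (x - (0 : ℝ) • y)) :=
      tendsto_const_nhds.sub (hlim.smul_const y)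
    rw [zero_smul, sub_zero] at this
    exact (hf.continuous.tendsto x).comp this

end Dilation

section Average

variable {n : ℕ} {γ : ℝ → Space n} {χ : ℝ → ℝ}

theorem average_comp_smul (κ t : ℝ) (f : Space n → ℂ) (x : Space n) :
    average γ χ t (fun y => f (κ • y)) x = average γ χ (κ * t) f (κ • x) := by
  unfold average
  simp_rw [smul_sub, smul_smul]

theorem BddCont.average (hγ : Continuous γ) (hχ : Continuous χ) (hχc : HasCompactSupport χ)
    {f : Space n → ℂ} (hf : BddCont f) (t : ℝ) : BddCont (average γ χ t f) := by
  obtain ⟨M, hM⟩ := hf.bounded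
  refine ⟨(continuous_average hγ hχ hχc hf.continuous).comp
    (by fun_prop : Continuous fun x : Space n => (t, x)), ∫ s, ‖χ s‖ * M, fun x => ?_⟩
  refine norm_integral_le_of_norm_le ((hχ.integrable_of_hasCompactSupport hχc).norm.mul_const M)
    (ae_of_all _ fun s => ?_)
  rw [norm_smul]
  gcongr
  exact hM _

/-- Even an uncountable supremum of continuous functions is lower semicontinuous. -/
theorem measurable_biSup_enorm {ι : Type*} {X : Type*} [TopologicalSpace X] [MeasurableSpace X]
    [BorelSpace X] (T : Set ι) {f : ι → X → ℂ} (hf : ∀ t, Continuous (f t)) :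
    Measurable fun x => ⨆ t ∈ T, ‖f t x‖ₑ :=
  (lowerSemicontinuous_biSup fun t _ => (hf t).enorm.lowerSemicontinuous).measurable

/-- The dilated version of `exists_lintegral_iSup_average_sub_heat_le`. -/
theorem lintegral_iSup_average_sub_heat_dilate_le (hγ : Continuous γ) (hχ : Continuous χ)
    (hχc : HasCompactSupport χ) {J : Set ℝ} {q s : ℝ} {C : ℝ≥0∞}
    {P : (Space n → ℂ) → Prop} (hP : ∀ f (κ : ℝ), 0 < κ → P f → P fun x => f (κ • x))
    (h : ∀ f : Space n → ℂ, BddCont f → P f →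
      ∫⁻ x, (⨆ t ∈ J, ‖average γ χ t f x - average γ χ t (heat s f) x‖ₑ) ^ q ≤
        C * ∫⁻ x, ‖f x‖ₑ ^ q)
    (hs : 0 < s) {κ : ℝ} (hκ : 0 < κ) {f : Space n → ℂ} (hf : BddCont f) (hfP : P f) :
    ∫⁻ x, (⨆ t ∈ J, ‖average γ χ (κ * t) f x - average γ χ (κ * t) (heat (κ ^ 2 * s) f) x‖ₑ) ^ q
      ≤ C * ∫⁻ x, ‖f x‖ₑ ^ q := by
  have hg : BddCont fun x => f (κ • x) := hf.comp (continuous_const_smul κ)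
  have h1 := h _ hg (hP f κ hκ hfP)
  have h2 : heat s (fun x => f (κ • x)) = fun x => heat (κ ^ 2 * s) f (κ • x) :=
    funext fun x => heat_comp_smul hf hκ hs x
  rw [h2] at h1
  simp_rw [average_comp_smul] at h1
  have hh := hf.heat (by positivity : 0 < κ ^ 2 * s)
  rw [lintegral_comp_smul_pos hκ (g := fun x => (⨆ t ∈ J, ‖average γ χ (κ * t) f x -
      average γ χ (κ * t) (heat (κ ^ 2 * s) f) x‖ₑ) ^ q)
    ((measurable_biSup_enorm J fun t => ((hf.average hγ hχ hχc _).sub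
      (hh.average hγ hχ hχc _)).continuous).pow_const q),
    lintegral_comp_smul_pos hκ (g := fun x => ‖f x‖ₑ ^ q)
      (measurable_enorm_rpow hf.continuous q), mul_left_comm] at h1
  refine (ENNReal.mul_le_mul_iff_right ?_ ENNReal.ofReal_ne_top).1 h1
  simp; positivity

/-- Averages of the heat extension are controlled by the heat extension of the modulus. -/
theorem enorm_average_heat_le (hχ : Continuous χ) {Γ : ℝ}
    (hΓ : ∀ s, ‖γ s‖ ≤ Γ) {f : Space n → ℂ} (hf : BddCont f) {u B t : ℝ} (hu : 0 < u)
    (htB : t ^ 2 * Γ ^ 2 ≤ B * u) (x : Space n) :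
    ‖average γ χ t (heat u f) x‖ₑ ≤
      (∫⁻ s, ‖χ s‖ₑ) * ENNReal.ofReal (2 ^ (Module.finrank ℝ (Space n) / 2 : ℝ) *
        Real.exp (π ^ 2 * B)) * heatE (2 * u) (fun y => ‖f y‖ₑ) x := by
  set K := ENNReal.ofReal (2 ^ (Module.finrank ℝ (Space n) / 2 : ℝ) * Real.exp (π ^ 2 * B))
  have hfm' := hf.continuous.measurable
  have hfm : Measurable fun y => ‖f y‖ₑ := hfm'.enorm
  have hk := measurable_ofReal_heatKernel (V := Space n)
  have hku := hk u
  have hk2u := hk (2 * u)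
  -- A shift on the parabolic scale √u costs a constant and a doubling of the time.
  have hpt : ∀ v : Space n, ‖v‖ ^ 2 ≤ B * u →
      ‖heat u f (x - v)‖ₑ ≤ K * heatE (2 * u) (fun y => ‖f y‖ₑ) x := by
    intro v hv
    calc _ ≤ ∫⁻ y, ‖f (x - v - y)‖ₑ ∂heatMeasure (Space n) u :=
          enorm_integral_le_lintegral_enorm _
      _ = ∫⁻ y, ENNReal.ofReal (heatKernel u y) * ‖f (x - v - y)‖ₑ :=
          lintegral_heatMeasure u (by fun_prop)
      _ = ∫⁻ y, ENNReal.ofReal (heatKernel u (y - v)) * ‖f (x - y)‖ₑ := by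
          rw [← lintegral_sub_right_eq_self
            (fun y => ENNReal.ofReal (heatKernel u y) * ‖f (x - v - y)‖ₑ) v]
          simp
      _ ≤ ∫⁻ y, K * (ENNReal.ofReal (heatKernel (2 * u) y) * ‖f (x - y)‖ₑ) := by
          refine lintegral_mono fun y => ?_
          rw [← mul_assoc, ← ENNReal.ofReal_mul (by positivity)]
          gcongr
          exact heatKernel_sub_le hu hv
      _ = _ := by
          rw [lintegral_const_mul _ (by fun_prop), heatE_eq hfm]
  calc _ ≤ ∫⁻ s, ‖χ s • heat u f (x - t • γ s)‖ₑ := enorm_integral_le_lintegral_enorm _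
    _ ≤ ∫⁻ s, ‖χ s‖ₑ * (K * heatE (2 * u) (fun y => ‖f y‖ₑ) x) := by
        refine lintegral_mono fun s => ?_
        rw [enorm_smul]
        gcongr
        refine hpt _ (le_trans ?_ htB)
        rw [norm_smul, mul_pow, Real.norm_eq_abs, sq_abs]
        gcongr
        exact hΓ s
    _ ≤ _ := by
        rw [mul_assoc, lintegral_mul_const _ hχ.measurable.enorm]

end Average

end LocalSmoothing

end

/-! ### The maximal inequality for bounded continuous functions. -/

noncomputable section

namespace LocalSmoothing

open scoped Real Topology
open Filter

theorem enorm_le_enorm_add_tsum {E : Type*} [NormedAddCommGroup E] {u : ℕ → E} {L : E}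
    (hu : Tendsto u atTop (𝓝 L)) : ‖L‖ₑ ≤ ‖u 0‖ₑ + ∑' j, ‖u (j + 1) - u j‖ₑ := by
  refine le_of_tendsto hu.enorm (Eventually.of_forall fun J => ?_)
  have h : u J = u 0 + ∑ j ∈ Finset.range J, (u (j + 1) - u j) := by
    rw [Finset.sum_range_sub]; abel
  rw [h]
  refine (enorm_add_le _ _).trans ?_
  gcongr
  exact (enorm_sum_le _ _).trans (ENNReal.sum_le_tsum _)

section Average

variable {n : ℕ} {γ : ℝ → Space n} {χ : ℝ → ℝ}

/-- Telescoping decomposition of an average along the scales `a m`. -/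
theorem enorm_average_le_add_tsum (hγ : Continuous γ) (hχ : Continuous χ)
    (hχc : HasCompactSupport χ) {f : Space n → ℂ} (hf : BddCont f) {a : ℕ → ℝ}
    (ha : ∀ m, 0 < a m) (hlim : Tendsto a atTop (𝓝 0)) (t : ℝ) (x : Space n) :
    ‖average γ χ t f x‖ₑ ≤
      (2 * ‖average γ χ t (heat (a 0) f) x‖ₑ + ‖average γ χ t (heat (a 0 + a 0) f) x‖ₑ) +
      ∑' j, (‖average γ χ t (fun y => heat (a (j + 1)) f y - heat (a j) f y) x -
          average γ χ t (heat (a j) fun y => heat (a (j + 1)) f y - heat (a j) f y) x‖ₑ +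
        ‖average γ χ t (fun y => heat (a (j + 1)) f y - heat (a j) f y) x -
          average γ χ t (heat (a (j + 1)) fun y => heat (a (j + 1)) f y - heat (a j) f y) x‖ₑ) := by
  set φ : ℝ → ℂ := fun u => average γ χ t (heat u f) x with hφ
  have hA := hf.average hγ hχ hχc t
  have haverage : ∀ u, 0 < u → φ u = heat u (average γ χ t f) x := fun u hu =>
    average_heat hγ hχ hχc hf hu t x
  have hlimφ : ∀ b : ℕ → ℝ, (∀ m, 0 < b m) → Tendsto b atTop (𝓝 0) →
      Tendsto (fun j => φ (b j)) atTop (𝓝 (average γ χ t f x)) := by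
    intro b hb hb0
    have h := tendsto_heat hA (κ := fun i => √(b i)) (fun i => Real.sqrt_pos.2 (hb i))
      (by simpa using hb0.sqrt) x
    refine h.congr fun j => ?_
    rw [haverage _ (hb j), Real.sq_sqrt (hb j).le]
  have hc : ∀ {u}, 0 < u → Continuous (heat u f) := fun hu => (hf.heat hu).continuous
  set D : ℕ → Space n → ℂ := fun j y => heat (a (j + 1)) f y - heat (a j) f y with hD
  have hDA : ∀ j, average γ χ t (D j) x = φ (a (j + 1)) - φ (a j) := fun j =>
    average_sub hγ hχ hχc (hc (ha _)) (hc (ha _)) t x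
  have hDh : ∀ j u, 0 < u → average γ χ t (heat u (D j)) x =
      φ (a (j + 1) + u) - φ (a j + u) := by
    intro j u hu
    have h : heat u (D j) = fun y => heat (a (j + 1) + u) f y - heat (a j + u) f y := by
      ext y
      rw [hD, heat_sub (hf.heat (ha _)) (hf.heat (ha _)) hu, heat_heat hf (ha _) hu,
        heat_heat hf (ha _) hu]
    rw [h, average_sub hγ hχ hχc (hc (add_pos (ha _) hu)) (hc (add_pos (ha _) hu))]
  -- From 2P - P² = 1 - (1 - P)². In the increment of τ the mixed terms φ(a_j + a_{j+1}) cancel,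
  -- leaving (1 - P_{a_j})D_j + (1 - P_{a_{j+1}})D_j, each with a factor to which local decay
  -- applies.
  set τ : ℕ → ℂ := fun j => 2 * φ (a j) - φ (a j + a j) with hτ
  have hτlim : Tendsto τ atTop (𝓝 (average γ χ t f x)) := by
    have h1 := ((hlimφ a ha hlim).const_mul 2).sub
      (hlimφ (fun j => a j + a j) (fun j => add_pos (ha j) (ha j)) (by simpa using hlim.add hlim))
    convert h1 using 2
    ring
  refine (enorm_le_enorm_add_tsum hτlim).trans (add_le_add ?_ (ENNReal.tsum_le_tsum fun j => ?_))
  · refine enorm_sub_le.trans ?_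
    rw [enorm_mul]
    gcongr
    simp [enorm_eq_nnnorm]
  · rw [hDA, hDh _ _ (ha _), hDh _ _ (ha _)]
    refine le_trans (le_of_eq ?_) (enorm_add_le _ _)
    congr 1
    simp only [hτ]
    rw [add_comm (a j) (a (j + 1))]
    ring

theorem lintegral_enorm_rpow_comp_smul_ne_top {q : ℝ} (f : Space n → ℂ) (hf : Continuous f) {κ : ℝ}
    (hκ : 0 < κ) (h : ∫⁻ x, ‖f x‖ₑ ^ q ≠ ⊤) : ∫⁻ x, ‖f (κ • x)‖ₑ ^ q ≠ ⊤ := by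
  rw [lintegral_comp_smul_pos hκ (g := fun x => ‖f x‖ₑ ^ q) (measurable_enorm_rpow hf q)]
  exact ENNReal.mul_ne_top ENNReal.ofReal_ne_top h

/-- The high-frequency pieces at relative scale `j`, over all dyadic ranges of dilations. -/
theorem lintegral_iSup_high_frequency_le (hγ : Continuous γ) (hχ : Continuous χ)
    (hχc : HasCompactSupport χ) {J : Set ℝ} {q : ℝ} (hq : 2 ≤ q) {s s' : ℝ} (hs : 0 < s)
    (hs' : 0 < s') {C : ℝ≥0∞}
    (h : ∀ u ∈ ({s, s'} : Set ℝ), ∀ f : Space n → ℂ, BddCont f → ∫⁻ x, ‖f x‖ₑ ^ q ≠ ⊤ →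
      ∫⁻ x, (⨆ t ∈ J, ‖average γ χ t f x - average γ χ t (heat u f) x‖ₑ) ^ q ≤
        C ^ q * ∫⁻ x, ‖f x‖ₑ ^ q)
    {κ : ℤ → ℝ} (hκ : ∀ k, 0 < κ k) {D : ℤ → Space n → ℂ} (hD : ∀ k, BddCont (D k))
    {X : ℝ≥0∞} (hX : X ≠ ⊤) (hDX : ∑' k, ∫⁻ x, ‖D k x‖ₑ ^ q ≤ X) :
    ∫⁻ x, (⨆ k, ((⨆ t ∈ J, ‖average γ χ (κ k * t) (D k) x -
          average γ χ (κ k * t) (heat (κ k ^ 2 * s) (D k)) x‖ₑ) +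
        ⨆ t ∈ J, ‖average γ χ (κ k * t) (D k) x -
          average γ χ (κ k * t) (heat (κ k ^ 2 * s') (D k)) x‖ₑ)) ^ q ≤ (C + C) ^ q * X := by
  have hfin : ∀ k, ∫⁻ x, ‖D k x‖ₑ ^ q ≠ ⊤ := fun k =>
    ne_top_of_le_ne_top hX ((ENNReal.le_tsum (f := fun k => ∫⁻ x, ‖D k x‖ₑ ^ q) k).trans hDX)
  have hmeas : ∀ u, 0 < u → ∀ k, Measurable fun x => ⨆ t ∈ J, ‖average γ χ (κ k * t) (D k) x -
      average γ χ (κ k * t) (heat (κ k ^ 2 * u) (D k)) x‖ₑ := fun u hu k =>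
    measurable_biSup_enorm J fun t => (((hD k).average hγ hχ hχc _).sub
      (((hD k).heat (mul_pos (pow_pos (hκ k) 2) hu)).average hγ hχ hχc _)).continuous
  have hest : ∀ u, 0 < u → u ∈ ({s, s'} : Set ℝ) → ∀ k, ∫⁻ x, (⨆ t ∈ J,
      ‖average γ χ (κ k * t) (D k) x -
        average γ χ (κ k * t) (heat (κ k ^ 2 * u) (D k)) x‖ₑ) ^ q ≤
      C ^ q * ∫⁻ x, ‖D k x‖ₑ ^ q := fun u hu huss k =>
    lintegral_iSup_average_sub_heat_dilate_le hγ hχ hχc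
      (P := fun f => Continuous f ∧ ∫⁻ x, ‖f x‖ₑ ^ q ≠ ⊤)
      (fun f κ hκ hf => ⟨hf.1.comp (continuous_const_smul κ),
        lintegral_enorm_rpow_comp_smul_ne_top f hf.1 hκ hf.2⟩)
      (fun f hf hf' => h u huss f hf hf'.2) hu (hκ k) (hD k) ⟨(hD k).continuous, hfin k⟩
  calc _ ≤ _ := lintegral_iSup_rpow_le (by linarith) fun k => (hmeas s hs k).add (hmeas s' hs' k)
    _ ≤ ∑' k, (C + C) ^ q * ∫⁻ x, ‖D k x‖ₑ ^ q := ENNReal.tsum_le_tsum fun k =>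
        lintegral_add_rpow_le (by linarith) (hmeas s hs k) (hmeas s' hs' k)
          (hest s hs (by simp) k) (hest s' hs' (by simp) k)
    _ ≤ _ := by
        rw [ENNReal.tsum_mul_left]
        gcongr

/-- The maximal inequality for bounded continuous functions. -/
theorem exists_lintegral_maximalFunction_le (hγ : Continuous γ) {Γ : ℝ} (hΓ : ∀ s, ‖γ s‖ ≤ Γ)
    (hχ : Continuous χ) (hχc : HasCompactSupport χ) {c d : ℝ} (hc : 0 < c) (hcd : c < d)
    {q : ℝ} (hq : 2 ≤ q) {C : ℝ≥0} {θ : ℝ} (hθ : 0 < θ)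
    (h : ∀ f : Space n → ℂ, BddCont f → ∫⁻ x, ‖f x‖ₑ ^ q ≠ ⊤ → ∀ s : ℝ, 0 < s →
      ∫⁻ x, (⨆ t ∈ Icc c d, ‖average γ χ t f x - average γ χ t (heat s f) x‖ₑ) ^ q ≤
        (C * ENNReal.ofReal (s ^ θ)) ^ q * ∫⁻ x, ‖f x‖ₑ ^ q) :
    ∃ C' : ℝ≥0, ∀ f : Space n → ℂ, BddCont f → ∫⁻ x, ‖f x‖ₑ ^ q ≠ ⊤ →
      ∫⁻ x, maximalFunction γ χ (Ioi 0) f x ^ q ≤ C' ^ q * ∫⁻ x, ‖f x‖ₑ ^ q := by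
  have hd : 0 < d := hc.trans hcd
  -- With this ratio the windows l^k[c,d] cover (0,∞) however short [c,d] is; heat times scale by
  -- its square.
  set l := d / c with hl
  have hl1 : 1 < l := (one_lt_div hc).2 hcd
  have hl0 : 0 < l := by linarith
  set a : ℤ → ℝ := fun m => (l ^ (-m)) ^ 2 with ha
  have ha0 : ∀ m, 0 < a m := fun m => by positivity
  have hanti : ∀ m, a (m + 1) < a m := by
    intro m
    simp only [ha]
    gcongr
    linarith
  have hale : ∀ j : ℕ, a (j + 1) ≤ a j := fun j => (hanti _).le
  set B := d ^ 2 * Γ ^ 2 with hB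
  set K : ℝ≥0∞ := (∫⁻ s, ‖χ s‖ₑ) * ENNReal.ofReal
    (2 ^ (Module.finrank ℝ (Space n) / 2 : ℝ) * Real.exp (π ^ 2 * B)) with hK
  have hKtop : K ≠ ⊤ := ENNReal.mul_ne_top
    (hχ.integrable_of_hasCompactSupport hχc).hasFiniteIntegral.ne ENNReal.ofReal_ne_top
  -- The 3 is 2 + 1, from the initial terms 2φ(a_0) and φ(2a_0) of the telescoping.
  set b : ℝ≥0∞ := 3 * K *
    ((2 * ENNReal.ofReal (2 ^ (Module.finrank ℝ (Space n) / 2 : ℝ))) ^ 2) ^ (1 / q) with hb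
  have hbtop : b ≠ ⊤ := by
    refine ENNReal.mul_ne_top (ENNReal.mul_ne_top (by simp) hKtop)
      (ENNReal.rpow_ne_top_of_nonneg (by positivity) (ENNReal.pow_ne_top
        (ENNReal.mul_ne_top (by simp) ENNReal.ofReal_ne_top)))
  set ca : ℕ → ℝ≥0∞ := fun j => C * ENNReal.ofReal (a j ^ θ) with hca
  -- One `ca j` for each half of the increment. The factor 2 absorbs the Littlewood–Paley constant,
  -- as 2^{q-1} ≤ 2^q.
  set cb : ℕ → ℝ≥0∞ := fun j => (ca j + ca j) * 2 with hcb
  have hsumtop : ∑' j, cb j ≠ ⊤ := by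
    -- The gain over relative scales is geometric with ratio l^{-2θ} < 1.
    have hr : ∀ j : ℕ, a j ^ θ = ((l ^ (-2 : ℤ)) ^ θ) ^ j := by
      intro j
      rw [← Real.rpow_natCast, ← Real.rpow_mul (by positivity), mul_comm θ,
        Real.rpow_mul (by positivity), Real.rpow_natCast]
      congr 1
      simp only [ha]
      rw [← zpow_natCast, ← zpow_natCast, ← zpow_mul, ← zpow_mul]
      congr 1
      push_cast
      ring
    have hr1 : (l ^ (-2 : ℤ)) ^ θ < 1 :=
      Real.rpow_lt_one (by positivity) (zpow_lt_one_of_neg₀ hl1 (by norm_num)) hθ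
    simp only [hcb, hca, ENNReal.tsum_mul_right, ENNReal.tsum_add, ENNReal.tsum_mul_left, hr]
    have hg : ∑' j : ℕ, ENNReal.ofReal (((l ^ (-2 : ℤ)) ^ θ) ^ j) ≠ ⊤ := by
      rw [← ENNReal.ofReal_tsum_of_nonneg (fun j => by positivity)
        (summable_geometric_of_lt_one (by positivity) hr1)]
      exact ENNReal.ofReal_ne_top
    exact ENNReal.mul_ne_top (ENNReal.add_ne_top.2
      ⟨ENNReal.mul_ne_top ENNReal.coe_ne_top hg, ENNReal.mul_ne_top ENNReal.coe_ne_top hg⟩) (by simp)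
  refine ⟨(b + ∑' j, cb j).toNNReal, fun f hf hfX => ?_⟩
  rw [ENNReal.coe_toNNReal (ENNReal.add_ne_top.2 ⟨hbtop, hsumtop⟩)]
  set X := ∫⁻ x, ‖f x‖ₑ ^ q with hXdef
  set D : ℤ → Space n → ℂ := fun m y => heat (a (m + 1)) f y - heat (a m) f y with hD
  have hDb : ∀ m, BddCont (D m) := fun m => (hf.heat (ha0 _)).sub (hf.heat (ha0 _))
  have hDX : ∑' m, ∫⁻ x, ‖D m x‖ₑ ^ q ≤ 2 ^ (q - 1) * X :=
    tsum_lintegral_heat_sub_heat_rpow_le hf hq ha0 hanti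
  set κ : ℤ → ℝ := fun k => l ^ k with hκ
  have hκ0 : ∀ k, 0 < κ k := fun k => by positivity
  have hκa : ∀ (k j : ℤ), κ k ^ 2 * a j = a (j - k) := by
    intro k j
    simp only [hκ, ha]
    rw [← mul_pow, ← zpow_add₀ hl0.ne']
    congr 2
    ring
  -- Here j is the frequency scale relative to the window k. After rescaling by κ_k the piece
  -- D_{j-k} is tested with heat times a_j and a_{j+1}, because κ_k² a_j = a_{j-k}.
  set Φ : ℕ → Space n → ℝ≥0∞ := fun j x => ⨆ k : ℤ,
    ((⨆ t ∈ Icc c d, ‖average γ χ (κ k * t) (D (j - k)) x -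
        average γ χ (κ k * t) (heat (κ k ^ 2 * a j) (D (j - k))) x‖ₑ) +
      ⨆ t ∈ Icc c d, ‖average γ χ (κ k * t) (D (j - k)) x -
        average γ χ (κ k * t) (heat (κ k ^ 2 * a (j + 1)) (D (j - k))) x‖ₑ) with hΦ
  have hΦm : ∀ j, Measurable (Φ j) := by
    intro j
    refine Measurable.iSup fun k => ?_
    refine Measurable.add ?_ ?_ <;>
    exact measurable_biSup_enorm _ fun t => (((hDb _).average hγ hχ hχc _).sub
      (((hDb _).heat (mul_pos (pow_pos (hκ0 k) 2) (ha0 _))).average hγ hχ hχc _)).continuous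
  have hΦle : ∀ j, ∫⁻ x, Φ j x ^ q ≤ cb j ^ q * X := by
    intro j
    refine (lintegral_iSup_high_frequency_le hγ hχ hχc hq (ha0 j) (ha0 (j + 1)) (C := ca j) ?_
      hκ0 (D := fun k => D (j - k)) (fun k => hDb _) (X := 2 ^ (q - 1) * X)
      (ENNReal.mul_ne_top (by simp) hfX) ?_).trans ?_
    · intro u hu g hg hgX
      have hu' : 0 < u ∧ u ≤ a j := by
        rcases hu with rfl | rfl
        · exact ⟨ha0 _, le_rfl⟩
        · exact ⟨ha0 _, hale j⟩
      refine (h g hg hgX u hu'.1).trans ?_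
      simp only [hca]
      gcongr
      exacts [hu'.1.le, hu'.2]
    · refine le_trans (le_of_eq ?_) hDX
      exact (Equiv.subLeft (j : ℤ)).tsum_eq fun m => ∫⁻ x, ‖D m x‖ₑ ^ q
    · rw [← mul_assoc]
      gcongr
      simp only [hcb]
      rw [ENNReal.mul_rpow_of_nonneg _ _ (by linarith)]
      gcongr
      · norm_num
      · linarith
  -- An enumeration of all the times 2a_m and 4a_m at which the low-frequency terms need the heat
  -- maximal function.
  obtain ⟨e, he⟩ := exists_surjective_nat (ℤ × Bool)
  set r : ℕ → ℝ := fun i => if (e i).2 then 2 * a (e i).1 else 2 * (a (e i).1 + a (e i).1) with hr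
  have hr0 : ∀ i, 0 < r i := by
    intro i
    have := ha0 (e i).1
    simp only [hr]
    split_ifs <;> positivity
  set N : Space n → ℝ≥0∞ := fun x => ⨆ i, heatE (r i) (fun y => ‖f y‖ₑ) x with hN
  have hfm : Measurable fun y => ‖f y‖ₑ := hf.continuous.measurable.enorm
  have hNm : Measurable N := Measurable.iSup fun i => measurable_heatE hfm _
  have hNle1 : ∀ m x, heatE (2 * a m) (fun y => ‖f y‖ₑ) x ≤ N x := by
    intro m x
    obtain ⟨i, hi⟩ := he (m, true)
    have := le_iSup (fun i => heatE (r i) (fun y => ‖f y‖ₑ) x) i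
    simpa [hr, hi] using this
  have hNle2 : ∀ m x, heatE (2 * (a m + a m)) (fun y => ‖f y‖ₑ) x ≤ N x := by
    intro m x
    obtain ⟨i, hi⟩ := he (m, false)
    have := le_iSup (fun i => heatE (r i) (fun y => ‖f y‖ₑ) x) i
    simpa [hr, hi] using this
  have hNint : ∫⁻ x, (3 * K * N x) ^ q ≤ b ^ q * X := by
    have hmul : ∀ x, (3 * K * N x) ^ q = (3 * K) ^ q * N x ^ q := fun x =>
      ENNReal.mul_rpow_of_nonneg _ _ (by linarith)
    simp_rw [hmul]
    rw [lintegral_const_mul _ (by fun_prop), hb,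
      ENNReal.mul_rpow_of_nonneg (3 * K) _ (by linarith : 0 ≤ q), mul_assoc, ← ENNReal.rpow_mul,
      one_div_mul_cancel (by linarith), ENNReal.rpow_one]
    gcongr
    exact lintegral_iSup_heatE_rpow_le hq hr0 hfm
  refine le_trans (lintegral_mono fun x => ?_) (lintegral_add_rpow_le (by linarith) (by fun_prop)
    (Measurable.tsum hΦm) hNint (lintegral_tsum_rpow_le (by linarith) hΦm hΦle))
  gcongr
  refine iSup₂_le fun t (ht : 0 < t) => ?_
  -- From l^k ≤ t/c < l^{k+1} and cl = d it follows that t/l^k lies in [c,d].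
  obtain ⟨k, hk1, hk2⟩ := exists_mem_Ico_zpow (div_pos ht hc) hl1
  set t' := t / κ k with ht'
  have htt' : t = κ k * t' := by rw [ht']; field_simp [(hκ0 k).ne']
  have ht'mem : t' ∈ Icc c d := by
    constructor
    · rw [ht', le_div_iff₀ (hκ0 k)]
      rw [le_div_iff₀ hc] at hk1
      linarith
    · rw [ht', div_le_iff₀ (hκ0 k)]
      rw [div_lt_iff₀ hc, zpow_add_one₀ hl0.ne'] at hk2
      have : l ^ k * l * c = d * κ k := by rw [hl]; field_simp; rfl
      linarith
  set a' : ℕ → ℝ := fun j => a (j - k) with ha'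
  have ha'lim : Tendsto a' atTop (𝓝 0) := by
    have h1 : ∀ j : ℕ, a' j = κ k ^ 2 * (l⁻¹ ^ 2) ^ j := by
      intro j
      simp only [ha']
      rw [← hκa]
      simp only [ha]
      congr 1
      rw [zpow_neg, zpow_natCast, ← inv_pow, ← pow_mul, ← pow_mul, mul_comm]
    have h2 := (tendsto_pow_atTop_nhds_zero_of_lt_one (r := l⁻¹ ^ 2) (by positivity)
      (pow_lt_one₀ (by positivity) (inv_lt_one_of_one_lt₀ hl1) (by norm_num))).const_mul (κ k ^ 2)
    rw [mul_zero] at h2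
    exact h2.congr fun j => (h1 j).symm
  refine (enorm_average_le_add_tsum hγ hχ hχc hf (a := a') (fun j => ha0 _) ha'lim t x).trans ?_
  -- The initial heat time is κ_k², comparable to t², so displacement along the dilated curve is on
  -- the parabolic scale.
  have htB : t ^ 2 * Γ ^ 2 ≤ B * a' 0 := by
    have h1 : a' 0 = κ k ^ 2 := by simp [ha', ha, hκ]
    rw [h1, hB, htt', mul_pow]
    have : t' ^ 2 ≤ d ^ 2 := by
      have := ht'mem.1
      gcongr
      exact ht'mem.2
    calc κ k ^ 2 * t' ^ 2 * Γ ^ 2 ≤ κ k ^ 2 * d ^ 2 * Γ ^ 2 := by gcongr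
      _ = _ := by ring
  have hB0 : 0 ≤ B := by positivity
  have ha'0 := ha0 ((0 : ℕ) - k)
  refine add_le_add ?_ (ENNReal.tsum_le_tsum fun j => ?_)
  · have h1 := enorm_average_heat_le (γ := γ) hχ hΓ hf (ha0 _) htB x
    have h2 := enorm_average_heat_le (γ := γ) (B := B) (t := t) hχ hΓ hf
      (add_pos (ha0 ((0 : ℕ) - k)) (ha0 ((0 : ℕ) - k))) (htB.trans (by
        simp only [ha']; nlinarith)) x
    calc _ ≤ 2 * (K * N x) + K * N x := by
          gcongr
          · exact h1.trans (by gcongr; exact hNle1 _ x)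
          · exact h2.trans (by gcongr; exact hNle2 _ x)
      _ = _ := by ring
  · have e1 : a' j = κ k ^ 2 * a j := (hκa _ _).symm
    have e2 : a' (j + 1) = κ k ^ 2 * a (j + 1) := by
      rw [hκa]; simp only [ha']; push_cast; rfl
    have e3 : (fun y => heat (a' (j + 1)) f y - heat (a' j) f y) = D (j - k) := by
      simp only [hD, ha']
      have : ((j + 1 : ℕ) : ℤ) - k = j - k + 1 := by push_cast; ring
      rw [this]
    rw [e3, e1, e2, htt']
    refine le_iSup_of_le k (add_le_add ?_ ?_)
    · exact le_iSup₂ (f := fun t (_ : t ∈ Icc c d) => ‖average γ χ (κ k * t) (D (j - k)) x -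
        average γ χ (κ k * t) (heat (κ k ^ 2 * a j) (D (j - k))) x‖ₑ) t' ht'mem
    · exact le_iSup₂ (f := fun t (_ : t ∈ Icc c d) => ‖average γ χ (κ k * t) (D (j - k)) x -
        average γ χ (κ k * t) (heat (κ k ^ 2 * a (j + 1)) (D (j - k))) x‖ₑ) t' ht'mem

end Average

end LocalSmoothing

end

/-! ### Averages of functions defined almost everywhere. -/

noncomputable section

namespace LocalSmoothing

open scoped Real Topology
open Filter

section Approximation

variable {α : Type*} [MeasurableSpace α] {μ : Measure α} {p : ℝ≥0∞}

theorem lintegral_rpow_eq_eLpNorm (hp0 : p ≠ 0) (hp : p ≠ ⊤) (F : α → ℝ≥0∞) :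
    ∫⁻ x, F x ^ p.toReal ∂μ = eLpNorm F p μ ^ p.toReal := by
  simpa using lintegral_enorm_rpow_eq hp0 hp (μ := μ) F

theorem tsum_inv_two_pow : ∑' m : ℕ, (2⁻¹ : ℝ≥0∞) ^ m = 2 := by
  rw [ENNReal.tsum_geometric, ENNReal.one_sub_inv_two, inv_inv]

/-- The p-th powers have summable integrals, so their sum is finite almost everywhere and its terms
tend to zero. -/
theorem ae_tendsto_zero_of_eLpNorm_le (hp1 : 1 ≤ p) (hp : p ≠ ⊤) {F : ℕ → α → ℝ≥0∞}
    (hF : ∀ m, AEMeasurable (F m) μ) {K : ℝ≥0∞} (hK : K ≠ ⊤)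
    (h : ∀ m, eLpNorm (F m) p μ ≤ K * 2⁻¹ ^ m) :
    ∀ᵐ x ∂μ, Tendsto (fun m => F m x) atTop (𝓝 0) := by
  have hp0 : p ≠ 0 := (zero_lt_one.trans_le hp1).ne'
  have hq : 1 ≤ p.toReal := by
    rw [← ENNReal.toReal_one]; exact ENNReal.toReal_mono hp hp1
  have hq0 : 0 < p.toReal := by linarith
  have hsum : ∑' m, ∫⁻ x, F m x ^ p.toReal ∂μ ≠ ⊤ := by
    refine ne_top_of_le_ne_top (b := ∑' m : ℕ, K ^ p.toReal * (2⁻¹ : ℝ≥0∞) ^ m) ?_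
      (ENNReal.tsum_le_tsum fun m => ?_)
    · rw [ENNReal.tsum_mul_left, tsum_inv_two_pow]
      exact ENNReal.mul_ne_top (ENNReal.rpow_ne_top_of_nonneg hq0.le hK) (by simp)
    · rw [lintegral_rpow_eq_eLpNorm hp0 hp]
      calc _ ≤ (K * 2⁻¹ ^ m) ^ p.toReal := by gcongr; exact h m
        _ = K ^ p.toReal * ((2⁻¹ : ℝ≥0∞) ^ m) ^ p.toReal := ENNReal.mul_rpow_of_nonneg _ _ hq0.le
        _ ≤ _ := by
          gcongr
          refine (ENNReal.rpow_le_rpow_of_exponent_ge ?_ hq).trans_eq (ENNReal.rpow_one _)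
          exact pow_le_one₀ (zero_le) (by simp)
  rw [← lintegral_tsum fun m => (hF m).pow_const _] at hsum
  filter_upwards [ae_lt_top' (AEMeasurable.tsum fun m => (hF m).pow_const _) hsum] with x hx
  have h1 := ENNReal.tendsto_atTop_zero_of_tsum_ne_top hx.ne
  have h2 := (ENNReal.continuous_rpow_const (y := 1 / p.toReal)).tendsto 0 |>.comp h1
  rw [ENNReal.zero_rpow_of_pos (by positivity)] at h2
  refine h2.congr fun m => ?_
  simp only [Function.comp_apply]
  rw [← ENNReal.rpow_mul, mul_one_div_cancel hq0.ne', ENNReal.rpow_one]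

end Approximation

section ExtendedAverage

variable {n : ℕ} {γ : ℝ → Space n} {χ : ℝ → ℝ}

/-- The averages of an extended nonnegative function against the modulus of the cutoff. -/
def averageE (γ : ℝ → Space n) (χ : ℝ → ℝ) (t : ℝ) (g : Space n → ℝ≥0∞) (x : Space n) : ℝ≥0∞ :=
  ∫⁻ s, ‖χ s‖ₑ * g (x - t • γ s)

/-- The measure on the dilated curve whose convolutions are the averages `averageE`. -/
def averageMeasure (γ : ℝ → Space n) (χ : ℝ → ℝ) (t : ℝ) : Measure (Space n) :=
  (volume.withDensity fun s => ‖χ s‖ₑ).map fun s => t • γ s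

theorem lintegral_averageMeasure (hγ : Continuous γ) (hχ : Continuous χ) (t : ℝ)
    {g : Space n → ℝ≥0∞} (hg : Measurable g) :
    ∫⁻ y, g y ∂averageMeasure γ χ t = ∫⁻ s, ‖χ s‖ₑ * g (t • γ s) := by
  have hm : Measurable fun s => t • γ s := (hγ.const_smul t).measurable
  unfold averageMeasure
  rw [lintegral_map hg hm]
  exact lintegral_withDensity_eq_lintegral_mul _ hχ.measurable.enorm (hg.comp hm)

theorem averageE_eq (hγ : Continuous γ) (hχ : Continuous χ) (t : ℝ)
    {g : Space n → ℝ≥0∞} (hg : Measurable g) (x : Space n) :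
    averageE γ χ t g x = ∫⁻ y, g (x - y) ∂averageMeasure γ χ t :=
  (lintegral_averageMeasure hγ hχ t (g := fun y => g (x - y)) (by fun_prop)).symm

theorem averageMeasure_univ (hγ : Continuous γ) (hχ : Continuous χ) (t : ℝ) :
    averageMeasure γ χ t univ = ∫⁻ s, ‖χ s‖ₑ := by
  rw [← setLIntegral_one, setLIntegral_univ,
    lintegral_averageMeasure hγ hχ t (g := fun _ => 1) measurable_const]
  simp

theorem isFiniteMeasure_averageMeasure (hγ : Continuous γ) (hχ : Continuous χ)
    (hχc : HasCompactSupport χ) (t : ℝ) : IsFiniteMeasure (averageMeasure γ χ t) :=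
  ⟨by
    rw [averageMeasure_univ hγ hχ]
    exact (hχ.integrable_of_hasCompactSupport hχc).hasFiniteIntegral⟩

theorem measurable_averageE (hγ : Continuous γ) (hχ : Continuous χ)
    (hχc : HasCompactSupport χ) (t : ℝ) {g : Space n → ℝ≥0∞} (hg : Measurable g) :
    Measurable (averageE γ χ t g) := by
  have := isFiniteMeasure_averageMeasure hγ hχ hχc t
  simp_rw [funext (averageE_eq hγ hχ t hg)]
  exact Measurable.lintegral_prod_right' (f := fun z : Space n × Space n => g (z.1 - z.2))
    (by fun_prop)

theorem eLpNorm_averageE_le (hγ : Continuous γ) (hχ : Continuous χ)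
    (hχc : HasCompactSupport χ) {p : ℝ≥0∞} (hp1 : 1 ≤ p) (hp : p ≠ ⊤) (t : ℝ)
    {g : Space n → ℝ≥0∞} (hg : Measurable g) :
    eLpNorm (averageE γ χ t g) p volume ≤ (∫⁻ s, ‖χ s‖ₑ) * eLpNorm g p volume := by
  have := isFiniteMeasure_averageMeasure hγ hχ hχc t
  have hp0 : p ≠ 0 := (zero_lt_one.trans_le hp1).ne'
  have hq : 1 ≤ p.toReal := by
    rw [← ENNReal.toReal_one]; exact ENNReal.toReal_mono hp hp1
  rw [← ENNReal.rpow_le_rpow_iff (by linarith : 0 < p.toReal),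
    ENNReal.mul_rpow_of_nonneg _ _ (by linarith), ← lintegral_rpow_eq_eLpNorm hp0 hp,
    ← lintegral_rpow_eq_eLpNorm hp0 hp, ← averageMeasure_univ hγ hχ t]
  simp_rw [averageE_eq hγ hχ t hg]
  exact lintegral_conv_rpow_le _ hq hg

theorem ae_ae_average_of_ae (hγ : Continuous γ) (hχ : Continuous χ)
    (hχc : HasCompactSupport χ) (t : ℝ) {P : Space n → Prop} (h : ∀ᵐ y, P y) :
    ∀ᵐ x : Space n, ∀ᵐ s, χ s ≠ 0 → P (x - t • γ s) := by
  have := isFiniteMeasure_averageMeasure hγ hχ hχc t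
  filter_upwards [ae_ae_sub_of_ae (averageMeasure γ χ t) h] with x hx
  have h1 := ae_of_ae_map (hγ.const_smul t).measurable.aemeasurable hx
  rw [ae_withDensity_iff hχ.measurable.enorm] at h1
  filter_upwards [h1] with s hs h0
  exact hs (by simpa using h0)

theorem averageE_congr {x : Space n} {t : ℝ} {g g' : Space n → ℝ≥0∞}
    (h : ∀ᵐ s, χ s ≠ 0 → g (x - t • γ s) = g' (x - t • γ s)) :
    averageE γ χ t g x = averageE γ χ t g' x := by
  refine lintegral_congr_ae ?_
  filter_upwards [h] with s hs
  by_cases h0 : χ s = 0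
  · simp [h0]
  · simp only [hs h0]

theorem averageE_mono {x : Space n} {t : ℝ} {g g' : Space n → ℝ≥0∞}
    (h : ∀ᵐ s, χ s ≠ 0 → g (x - t • γ s) ≤ g' (x - t • γ s)) :
    averageE γ χ t g x ≤ averageE γ χ t g' x := by
  refine lintegral_mono_ae ?_
  filter_upwards [h] with s hs
  by_cases h0 : χ s = 0
  · simp [h0]
  · gcongr
    exact hs h0

theorem enorm_average_sub_le {f g : Space n → ℂ} {x : Space n} {t : ℝ}
    (hf : Integrable fun s => χ s • f (x - t • γ s))
    (hg : Integrable fun s => χ s • g (x - t • γ s)) :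
    ‖average γ χ t f x - average γ χ t g x‖ₑ ≤ averageE γ χ t (fun y => ‖f y - g y‖ₑ) x := by
  unfold average averageE
  rw [← integral_sub hf hg]
  refine (enorm_integral_le_lintegral_enorm _).trans (le_of_eq (lintegral_congr fun s => ?_))
  rw [← smul_sub, enorm_smul]

/-- Almost everywhere measurability of f does not pass to its restriction to a curve, so a
measurable f' agreeing with f along this particular curve is required. -/
theorem integrable_of_averageE_ne_top (hγ : Continuous γ) (hχ : Continuous χ)
    {f f' : Space n → ℂ} (hf' : StronglyMeasurable f') {x : Space n} {t : ℝ}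
    (hff' : ∀ᵐ s, χ s ≠ 0 → f (x - t • γ s) = f' (x - t • γ s))
    (h : averageE γ χ t (fun y => ‖f y‖ₑ) x ≠ ⊤) :
    Integrable fun s => χ s • f (x - t • γ s) := by
  refine ⟨⟨fun s => χ s • f' (x - t • γ s), hχ.stronglyMeasurable.smul
    (hf'.comp_measurable (by fun_prop)), ?_⟩, ?_⟩
  · filter_upwards [hff'] with s hs
    by_cases h0 : χ s = 0
    · simp [h0]
    · rw [hs h0]
  · rw [hasFiniteIntegral_iff_enorm, lt_top_iff_ne_top]
    simpa only [averageE, enorm_smul] using h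

theorem tendsto_average_of_tendsto_averageE (hγ : Continuous γ) (hχ : Continuous χ)
    (hχc : HasCompactSupport χ) {f f' : Space n → ℂ} (hf' : StronglyMeasurable f')
    {F : ℕ → Space n → ℂ} (hF : ∀ m, BddCont (F m)) {x : Space n} {t : ℝ}
    (hff' : ∀ᵐ s, χ s ≠ 0 → f (x - t • γ s) = f' (x - t • γ s))
    (h : Tendsto (fun m => averageE γ χ t (fun y => ‖f y - F m y‖ₑ) x) atTop (𝓝 0)) :
    Integrable (fun s => χ s • f (x - t • γ s)) ∧
      Tendsto (fun m => average γ χ t (F m) x) atTop (𝓝 (average γ χ t f x)) := by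
  have hFI : ∀ m, Integrable fun s => χ s • F m (x - t • γ s) := fun m =>
    integrable_average hγ hχ hχc (hF m).continuous t x
  have hI : Integrable fun s => χ s • f (x - t • γ s) := by
    -- One finite error suffices: f is then a bounded continuous function plus a difference
    -- integrable along the curve.
    obtain ⟨m, hm⟩ := (h.eventually (gt_mem_nhds ENNReal.zero_lt_top)).exists
    have h1 : Integrable fun s => χ s • (f (x - t • γ s) - F m (x - t • γ s)) := by
      refine integrable_of_averageE_ne_top (f := fun y => f y - F m y)
        (f' := fun y => f' y - F m y) hγ hχ (hf'.sub (hF m).continuous.stronglyMeasurable) ?_ hm.ne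
      filter_upwards [hff'] with s hs h0
      rw [hs h0]
    refine (h1.add (hFI m)).congr (ae_of_all _ fun s => ?_)
    simp only [Pi.add_apply, ← smul_add, sub_add_cancel]
  refine ⟨hI, tendsto_iff_edist_tendsto_0.2 (tendsto_of_tendsto_of_tendsto_of_le_of_le
    tendsto_const_nhds h (fun _ => zero_le) fun m => ?_)⟩
  rw [edist_comm, edist_eq_enorm_sub]
  exact enorm_average_sub_le hI (hFI m)

end ExtendedAverage

end LocalSmoothing

end

/-! ### Passage from bounded continuous functions to L^p. -/

noncomputable section

namespace LocalSmoothing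

open scoped Real Topology
open Filter

variable {n : ℕ} {γ : ℝ → Space n} {χ : ℝ → ℝ} {p : ℝ≥0∞} {C : ℝ≥0}

/-- The maximal inequality with constant `C`, for bounded continuous functions. -/
def MaximalBound (γ : ℝ → Space n) (χ : ℝ → ℝ) (p : ℝ≥0∞) (C : ℝ≥0) : Prop :=
  ∀ f : Space n → ℂ, BddCont f → MemLp f p volume →
    eLpNorm (maximalFunction γ χ (Ioi 0) f) p volume ≤ C * eLpNorm f p volume

theorem measurable_maximalFunction (hγ : Continuous γ) (hχ : Continuous χ)
    (hχc : HasCompactSupport χ) {f : Space n → ℂ} (hf : Continuous f) (T : Set ℝ) :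
    Measurable (maximalFunction γ χ T f) :=
  measurable_biSup_enorm T fun t => (continuous_average hγ hχ hχc hf).comp
    (by fun_prop : Continuous fun x : Space n => (t, x))

theorem eLpNorm_liminf_le {α : Type*} [MeasurableSpace α] {μ : Measure α} (hp0 : p ≠ 0)
    (hp : p ≠ ⊤) {F : ℕ → α → ℝ≥0∞} (hF : ∀ m, Measurable (F m)) :
    eLpNorm (fun x => liminf (fun m => F m x) atTop) p μ ≤
      liminf (fun m => eLpNorm (F m) p μ) atTop := by
  have hq : 0 < p.toReal := ENNReal.toReal_pos hp0 hp
  have hl : ∀ u : ℕ → ℝ≥0∞, liminf u atTop ^ p.toReal = liminf (fun m => u m ^ p.toReal) atTop :=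
    fun u => (ENNReal.orderIsoRpow p.toReal hq).liminf_apply
  rw [← ENNReal.rpow_le_rpow_iff hq, hl, ← lintegral_rpow_eq_eLpNorm hp0 hp]
  simp_rw [hl, ← lintegral_rpow_eq_eLpNorm hp0 hp]
  exact lintegral_liminf_le fun m => (hF m).pow_const _

theorem exists_bddCont_seq (hp : p ≠ ⊤) {f : Space n → ℂ} (hf : MemLp f p volume) :
    ∃ F : ℕ → Space n → ℂ, ∀ m, BddCont (F m) ∧ MemLp (F m) p volume ∧
      eLpNorm (fun x => f x - F m x) p volume ≤ 2⁻¹ ^ m := by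
  have h : ∀ m : ℕ, ∃ g : Space n → ℂ, BddCont g ∧ MemLp g p volume ∧
      eLpNorm (fun x => f x - g x) p volume ≤ 2⁻¹ ^ m := by
    intro m
    obtain ⟨g, hg, hgp⟩ := hf.exists_boundedContinuous_eLpNorm_sub_le hp
      (ε := 2⁻¹ ^ m) (pow_ne_zero _ (by simp))
    exact ⟨g, ⟨g.continuous, ‖g‖, g.norm_coe_le_norm⟩, hgp, hg⟩
  choose F hF using h
  exact ⟨F, hF⟩

theorem eLpNorm_le_add_inv_two_pow (hp1 : 1 ≤ p) {f g : Space n → ℂ} (hf : MemLp f p volume)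
    (hg : MemLp g p volume) {ε : ℝ≥0∞} (h : eLpNorm (fun x => f x - g x) p volume ≤ ε) :
    eLpNorm g p volume ≤ eLpNorm f p volume + ε := by
  have h1 : g = f - (f - g) := by simp
  calc eLpNorm g p volume = eLpNorm (f - (f - g)) p volume := by rw [← h1]
    _ ≤ eLpNorm f p volume + eLpNorm (f - g) p volume := eLpNorm_sub_le hf.1 (hf.1.sub hg.1) hp1
    _ ≤ _ := by gcongr; exact h

/-- Passage to the limit in the maximal inequality. -/
theorem eLpNorm_maximalFunction_le_of_tendsto (hγ : Continuous γ) (hχ : Continuous χ)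
    (hχc : HasCompactSupport χ) (hp1 : 1 ≤ p) (hp : p ≠ ⊤) (hM : MaximalBound γ χ p C)
    {f : Space n → ℂ} (hf : MemLp f p volume) {F : ℕ → Space n → ℂ}
    (hF : ∀ m, BddCont (F m) ∧ MemLp (F m) p volume ∧
      eLpNorm (fun x => f x - F m x) p volume ≤ 2⁻¹ ^ m) {T : Set ℝ} (hT : T ⊆ Ioi 0)
    (h : ∀ᵐ x : Space n, ∀ t ∈ T,
      Tendsto (fun m => average γ χ t (F m) x) atTop (𝓝 (average γ χ t f x))) :
    eLpNorm (maximalFunction γ χ T f) p volume ≤ C * eLpNorm f p volume := by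
  have hp0 : p ≠ 0 := (zero_lt_one.trans_le hp1).ne'
  have hlim : Tendsto (fun m : ℕ => (C : ℝ≥0∞) * (eLpNorm f p volume + 2⁻¹ ^ m)) atTop
      (𝓝 (C * (eLpNorm f p volume + 0))) :=
    ENNReal.Tendsto.const_mul (tendsto_const_nhds.add
      (ENNReal.tendsto_pow_atTop_nhds_zero_of_lt_one (by simp))) (Or.inr ENNReal.coe_ne_top)
  rw [add_zero] at hlim
  calc _ ≤ eLpNorm (fun x => liminf (fun m => maximalFunction γ χ (Ioi 0) (F m) x) atTop) p
        volume := by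
        refine eLpNorm_mono_enorm_ae ?_
        filter_upwards [h] with x hx
        simp only [enorm_eq_self]
        refine iSup₂_le fun t ht => ?_
        rw [← (hx t ht).enorm.liminf_eq]
        exact liminf_le_liminf (Eventually.of_forall fun m =>
          le_iSup₂ (f := fun t (_ : t ∈ Ioi (0 : ℝ)) => ‖average γ χ t (F m) x‖ₑ) t (hT ht))
    _ ≤ liminf (fun m => eLpNorm (maximalFunction γ χ (Ioi 0) (F m)) p volume) atTop :=
        eLpNorm_liminf_le hp0 hp fun m =>
          measurable_maximalFunction hγ hχ hχc (hF m).1.continuous _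
    _ ≤ liminf (fun m : ℕ => (C : ℝ≥0∞) * (eLpNorm f p volume + 2⁻¹ ^ m)) atTop := by
        refine liminf_le_liminf (Eventually.of_forall fun m => ?_)
        refine (hM _ (hF m).1 (hF m).2.1).trans ?_
        gcongr
        exact eLpNorm_le_add_inv_two_pow hp1 hf (hF m).2.1 (hF m).2.2
    _ = _ := hlim.liminf_eq

/-- Young's inequality bounds the averaged errors geometrically in L^p. The exceptional set depends
on t, which confines this argument to countable sets of dilations. -/
theorem ae_tendsto_average (hγ : Continuous γ) (hχ : Continuous χ)
    (hχc : HasCompactSupport χ) (hp1 : 1 ≤ p) (hp : p ≠ ⊤)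
    {f : Space n → ℂ} (hf : MemLp f p volume) {F : ℕ → Space n → ℂ}
    (hF : ∀ m, BddCont (F m) ∧ MemLp (F m) p volume ∧
      eLpNorm (fun x => f x - F m x) p volume ≤ 2⁻¹ ^ m) (t : ℝ) :
    ∀ᵐ x : Space n, Integrable (fun s => χ s • f (x - t • γ s)) ∧
      Tendsto (fun m => average γ χ t (F m) x) atTop (𝓝 (average γ χ t f x)) := by
  set f' := hf.1.mk f
  have hf' : StronglyMeasurable f' := hf.1.stronglyMeasurable_mk
  have hff' : ∀ᵐ y, f y = f' y := hf.1.ae_eq_mk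
  have hm : ∀ m, Measurable fun y => ‖f' y - F m y‖ₑ := fun m =>
    (hf'.measurable.sub (hF m).1.continuous.measurable).enorm
  have h0 := ae_tendsto_zero_of_eLpNorm_le (μ := volume) hp1 hp
    (F := fun m => averageE γ χ t fun y => ‖f' y - F m y‖ₑ)
    (fun m => (measurable_averageE hγ hχ hχc t (hm m)).aemeasurable)
    (hχ.integrable_of_hasCompactSupport hχc).hasFiniteIntegral.ne fun m => by
      refine (eLpNorm_averageE_le hγ hχ hχc hp1 hp t (hm m)).trans ?_
      gcongr
      refine le_trans (le_of_eq ?_) (hF m).2.2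
      refine eLpNorm_congr_enorm_ae ?_
      filter_upwards [hff'] with y hy
      simp [hy]
  filter_upwards [h0, ae_ae_average_of_ae hγ hχ hχc t hff'] with x hx hs
  refine tendsto_average_of_tendsto_averageE hγ hχ hχc hf' (fun m => (hF m).1) hs
    (hx.congr fun m => averageE_congr ?_)
  filter_upwards [hs] with s hs h0
  rw [hs h0]

/-- The maximal estimate over a countable set of dilations. -/
theorem MaximalBound.maximalEstimate_of_countable (hM : MaximalBound γ χ p C) (hγ : Continuous γ)
    (hχ : Continuous χ) (hχc : HasCompactSupport χ) (hp1 : 1 ≤ p) (hp : p ≠ ⊤)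
    {f : Space n → ℂ} (hf : MemLp f p volume) {T : Set ℝ} (hT : T ⊆ Ioi 0) (hTc : T.Countable) :
    MaximalEstimate γ χ p C T f := by
  obtain ⟨F, hF⟩ := exists_bddCont_seq hp hf
  have h := fun t => ae_tendsto_average hγ hχ hχc hp1 hp hf hF t
  have hT' := (ae_ball_iff hTc).2 fun t _ => h t
  refine ⟨?_, ?_, ?_⟩
  · filter_upwards [hT'] with x hx t ht using (hx t ht).1
  · refine AEMeasurable.biSup T hTc fun t _ => AEMeasurable.enorm ?_
    refine aemeasurable_of_tendsto_metrizable_ae atTop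
      (f := fun m => average γ χ t (F m)) (fun m => ?_) ?_
    · exact ((hF m).1.average hγ hχ hχc t).continuous.measurable.aemeasurable
    · filter_upwards [h t] with x hx using hx.2
  · refine eLpNorm_maximalFunction_le_of_tendsto hγ hχ hχc hp1 hp hM hf hF hT ?_
    filter_upwards [hT'] with x hx t ht using (hx t ht).2

/-- The maximal estimate for continuous functions. -/
theorem MaximalBound.maximalEstimate_of_continuous (hM : MaximalBound γ χ p C) (hγ : Continuous γ)
    (hχ : Continuous χ) (hχc : HasCompactSupport χ) (hp1 : 1 ≤ p) (hp : p ≠ ⊤)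
    {f : Space n → ℂ} (hf : MemLp f p volume) (hfc : Continuous f) :
    MaximalEstimate γ χ p C (Ioi 0) f := by
  refine ⟨ae_of_all _ fun x t _ => integrable_average hγ hχ hχc hfc t x,
    (measurable_maximalFunction hγ hχ hχc hfc _).aemeasurable, ?_⟩
  -- For continuous f the average is continuous in t, so positive rational dilations already
  -- determine the supremum.
  set T : Set ℝ := Ioi 0 ∩ range ((↑) : ℚ → ℝ)
  have hcount : T.Countable := (countable_range _).mono inter_subset_right
  refine le_trans (eLpNorm_mono_enorm fun x => ?_)
    (hM.maximalEstimate_of_countable hγ hχ hχc hp1 hp hf (T := T) inter_subset_left hcount).2.2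
  simp only [enorm_eq_self]
  have hcl : IsClosed {t : ℝ | ‖average γ χ t f x‖ₑ ≤ maximalFunction γ χ T f x} :=
    isClosed_le ((continuous_average hγ hχ hχc hfc).comp
      (by fun_prop : Continuous fun t : ℝ => (t, x))).enorm continuous_const
  refine iSup₂_le fun t ht => ?_
  refine closure_minimal (fun s hs => ?_) hcl
    (Rat.denseRange_cast.open_subset_closure_inter isOpen_Ioi ht)
  exact le_iSup₂ (f := fun t (_ : t ∈ T) => ‖average γ χ t f x‖ₑ) s hs

section Nonneg

/-- No cancellation occurs when both χ and φ are nonnegative. This is where the sign of χ is used.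
-/
theorem averageE_ofReal_le (hγ : Continuous γ) (hχ : Continuous χ) (hχc : HasCompactSupport χ)
    (hχ0 : ∀ s, 0 ≤ χ s) {φ : Space n → ℝ} (hφ : Continuous φ) (hφ0 : ∀ y, 0 ≤ φ y) (t : ℝ)
    (x : Space n) : averageE γ χ t (fun y => ENNReal.ofReal (φ y)) x ≤
      ‖average γ χ t (fun y => (φ y : ℂ)) x‖ₑ := by
  have hI : Integrable fun s => χ s * φ (x - t • γ s) :=
    Continuous.integrable_of_hasCompactSupport (by fun_prop) hχc.mul_right
  have h1 : average γ χ t (fun y => (φ y : ℂ)) x = ((∫ s, χ s * φ (x - t • γ s) : ℝ) : ℂ) := by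
    rw [← integral_complex_ofReal]
    unfold average
    simp
  rw [h1, ← ofReal_norm, Complex.norm_real, Real.norm_of_nonneg
    (integral_nonneg fun s => mul_nonneg (hχ0 s) (hφ0 _)), ofReal_integral_eq_lintegral_ofReal hI
    (ae_of_all _ fun s => mul_nonneg (hχ0 s) (hφ0 _))]
  refine le_of_eq (lintegral_congr fun s => ?_)
  rw [ENNReal.ofReal_mul (hχ0 s), ← ofReal_norm, Real.norm_of_nonneg (hχ0 s)]

/-- For a nonnegative cutoff, the full maximal function of a limit of nonnegative continuous
functions has a measurable majorant satisfying the maximal inequality. -/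
theorem MaximalBound.exists_majorant (hM : MaximalBound γ χ p C) (hγ : Continuous γ)
    (hχ : Continuous χ) (hχc : HasCompactSupport χ) (hχ0 : ∀ s, 0 ≤ χ s) (hp0 : p ≠ 0)
    (hp : p ≠ ⊤) {φ : ℕ → Space n → ℝ} (hφ : ∀ k, BddCont fun y => (φ k y : ℂ))
    (hφc : ∀ k, Continuous (φ k)) (hφ0 : ∀ k y, 0 ≤ φ k y) {Y : ℝ≥0∞} (hY : Y ≠ ⊤)
    (hφY : ∀ k, eLpNorm (φ k) p volume ≤ Y) {g : Space n → ℝ≥0∞}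
    (hg : ∀ y, Tendsto (fun k => ENNReal.ofReal (φ k y)) atTop (𝓝 (g y))) :
    ∃ H : Space n → ℝ≥0∞, Measurable H ∧ eLpNorm H p volume ≤ C * Y ∧
      ∀ x, ∀ t ∈ Ioi (0 : ℝ), averageE γ χ t g x ≤ H x := by
  have hmeas := fun k => measurable_maximalFunction hγ hχ hχc (hφ k).continuous (Ioi 0)
  have hnorm : ∀ k, eLpNorm (fun y => (φ k y : ℂ)) p volume = eLpNorm (φ k) p volume := fun k =>
    eLpNorm_congr_norm_ae (ae_of_all _ fun y => by simp)
  refine ⟨fun x => liminf (fun k => maximalFunction γ χ (Ioi 0) (fun y => (φ k y : ℂ)) x) atTop,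
    Measurable.liminf hmeas, (eLpNorm_liminf_le hp0 hp hmeas).trans ?_, fun x t ht => ?_⟩
  · refine liminf_le_of_frequently_le' (Frequently.of_forall fun k => ?_)
    have hk : eLpNorm (fun y => (φ k y : ℂ)) p volume ≤ Y := (hnorm k).trans_le (hφY k)
    refine (hM _ (hφ k) ⟨(hφ k).continuous.aestronglyMeasurable,
      hk.trans_lt hY.lt_top⟩).trans ?_
    gcongr
  · calc averageE γ χ t g x
        = ∫⁻ s, liminf (fun k => ‖χ s‖ₑ * ENNReal.ofReal (φ k (x - t • γ s))) atTop := by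
          refine lintegral_congr fun s => Eq.symm (Tendsto.liminf_eq ?_)
          exact ENNReal.Tendsto.const_mul (hg _) (Or.inr enorm_ne_top)
      _ ≤ liminf (fun k => averageE γ χ t (fun y => ENNReal.ofReal (φ k y)) x) atTop := by
          refine lintegral_liminf_le fun k => ?_
          have := (hφc k).measurable
          have := hχ.measurable
          have := hγ.measurable
          fun_prop
      _ ≤ _ := liminf_le_liminf (Eventually.of_forall fun k =>
          (averageE_ofReal_le hγ hχ hχc hχ0 (hφc k) (hφ0 k) t x).trans
            (le_iSup₂ (f := fun t (_ : t ∈ Ioi (0 : ℝ)) =>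
              ‖average γ χ t (fun y => (φ k y : ℂ)) x‖ₑ) t ht))

/-- For a nonnegative cutoff, almost every `x` has the property that null sets are invisible on
all dilated curves through `x` simultaneously. -/
theorem MaximalBound.ae_forall_ae_of_ae (hM : MaximalBound γ χ p C) (hγ : Continuous γ)
    (hχ : Continuous χ) (hχc : HasCompactSupport χ) (hχ0 : ∀ s, 0 ≤ χ s) (hp1 : 1 ≤ p)
    (hp : p ≠ ⊤) {P : Space n → Prop} (hP : ∀ᵐ y, P y) :
    ∀ᵐ x : Space n, ∀ t ∈ Ioi (0 : ℝ), ∀ᵐ s, χ s ≠ 0 → P (x - t • γ s) := by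
  have hp0 : p ≠ 0 := (zero_lt_one.trans_le hp1).ne'
  have hq : 0 < p.toReal := ENNReal.toReal_pos hp0 hp
  obtain ⟨N, hN, hNm, hN0⟩ := exists_measurable_superset_of_null (ae_iff.1 hP)
  have hmaj : ∀ k : ℕ, ∃ H : Space n → ℝ≥0∞, Measurable H ∧ eLpNorm H p volume ≤ C * 2⁻¹ ^ k ∧
      ∀ x, ∀ t ∈ Ioi (0 : ℝ), averageE γ χ t (N.indicator 1) x ≤ H x := by
    intro k
    -- The indicator of an open neighbourhood is a limit of continuous functions with values in
    -- [0,1], and its L^p norm is at most 2^{-k}. The majorants therefore tend to zero almost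
    -- everywhere, for all t at once.
    obtain ⟨U, hNU, hU, hUle⟩ := N.exists_isOpen_le_add volume
      (ε := ((2⁻¹ : ℝ≥0∞) ^ k) ^ p.toReal) (ENNReal.rpow_pos (ENNReal.pow_pos (by simp) k) (by simp)).ne'
    rw [hN0, zero_add] at hUle
    have hUc := hU.isClosed_compl
    set φ : ℕ → Space n → ℝ := fun j y => 1 - (hUc.apprSeq j y : ℝ) with hφ
    have h1 : ∀ j y, (hUc.apprSeq j y : ℝ) ≤ 1 := fun j y =>
      NNReal.coe_le_one.2 (HasOuterApproxClosed.apprSeq_apply_le_one hUc j y)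
    have hφ0 : ∀ j y, 0 ≤ φ j y := fun j y => sub_nonneg.2 (h1 j y)
    have hφ1 : ∀ j y, φ j y ≤ 1 := fun j y => sub_le_self _ NNReal.zero_le_coe
    have hφc : ∀ j, Continuous (φ j) := fun j =>
      continuous_const.sub (NNReal.continuous_coe.comp (hUc.apprSeq j).continuous)
    have hφn : ∀ j, eLpNorm (φ j) p volume ≤ 2⁻¹ ^ k := by
      intro j
      rw [← ENNReal.rpow_le_rpow_iff hq, ← lintegral_enorm_rpow_eq hp0 hp]
      refine le_trans (le_trans (lintegral_mono (g := U.indicator 1) fun y => ?_) ?_) hUle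
      · by_cases hy : y ∈ U
        · rw [indicator_of_mem hy, ← ofReal_norm, Real.norm_of_nonneg (hφ0 j y)]
          exact ENNReal.rpow_le_one (ENNReal.ofReal_le_one.2 (hφ1 j y)) hq.le
        · have : φ j y = 0 := by
            simp only [hφ]
            rw [HasOuterApproxClosed.apprSeq_apply_eq_one hUc j hy]
            simp
          simp [this, hq]
      · rw [lintegral_indicator_one hU.measurableSet]
    have hφlim : ∀ y, Tendsto (fun j => ENNReal.ofReal (φ j y)) atTop (𝓝 (U.indicator 1 y)) := by
      intro y
      have h2 := tendsto_pi_nhds.1 (HasOuterApproxClosed.tendsto_apprSeq hUc) y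
      have h3 : Tendsto (fun j => φ j y) atTop
          (𝓝 (1 - ((Uᶜ.indicator (fun _ => (1 : ℝ≥0)) y : ℝ≥0) : ℝ))) :=
        tendsto_const_nhds.sub ((NNReal.continuous_coe.tendsto _).comp h2)
      have h4 : U.indicator (1 : Space n → ℝ≥0∞) y =
          ENNReal.ofReal (1 - ((Uᶜ.indicator (fun _ => (1 : ℝ≥0)) y : ℝ≥0) : ℝ)) := by
        by_cases hy : y ∈ U <;> simp [hy]
      rw [h4]
      exact (ENNReal.continuous_ofReal.tendsto _).comp h3
    obtain ⟨H, hHm, hHn, hH⟩ := hM.exists_majorant hγ hχ hχc hχ0 hp0 hp (φ := φ)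
      (fun j => ⟨Complex.continuous_ofReal.comp (hφc j), 1, fun y => by
        rw [Complex.norm_real, Real.norm_of_nonneg (hφ0 j y)]; exact hφ1 j y⟩) hφc hφ0
      (by simp) hφn hφlim
    refine ⟨H, hHm, hHn, fun x t ht => le_trans (averageE_mono (ae_of_all _ fun s _ => ?_))
      (hH x t ht)⟩
    exact indicator_le_indicator_of_subset hNU (fun _ => zero_le) _
  choose H hHm hHn hH using hmaj
  filter_upwards [ae_tendsto_zero_of_eLpNorm_le hp1 hp (fun k => (hHm k).aemeasurable)
    ENNReal.coe_ne_top hHn] with x hx t ht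
  have h0 : averageE γ χ t (N.indicator 1) x = 0 :=
    le_antisymm (ge_of_tendsto' hx fun k => hH k x t ht) zero_le
  have hNi : Measurable (N.indicator (1 : Space n → ℝ≥0∞)) := measurable_one.indicator hNm
  have hχm := hχ.measurable
  have hγm := hγ.measurable
  unfold averageE at h0
  rw [lintegral_eq_zero_iff (by fun_prop)] at h0
  filter_upwards [h0] with s hs hχs
  by_contra hPs
  have hmem : x - t • γ s ∈ N := hN hPs
  simp [hmem, hχs] at hs

/-- For a nonnegative cutoff, averages of an `L^p` function are approximated uniformly in the
dilation parameter by averages of continuous functions. -/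
theorem MaximalBound.exists_averageE_sub_le (hM : MaximalBound γ χ p C) (hγ : Continuous γ)
    (hχ : Continuous χ) (hχc : HasCompactSupport χ) (hχ0 : ∀ s, 0 ≤ χ s) (hp1 : 1 ≤ p)
    (hp : p ≠ ⊤) {f : Space n → ℂ} (hf : MemLp f p volume) {F : ℕ → Space n → ℂ}
    (hF : ∀ m, BddCont (F m) ∧ MemLp (F m) p volume ∧
      eLpNorm (fun x => f x - F m x) p volume ≤ 2⁻¹ ^ m) :
    ∃ H : ℕ → Space n → ℝ≥0∞, ∀ᵐ x : Space n, Tendsto (fun m => H m x) atTop (𝓝 0) ∧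
      ∀ t ∈ Ioi (0 : ℝ), ∀ m, averageE γ χ t (fun y => ‖f y - F m y‖ₑ) x ≤ H m x := by
  have hp0 : p ≠ 0 := (zero_lt_one.trans_le hp1).ne'
  have hDn : ∀ m, eLpNorm (fun y => F (m + 1) y - F m y) p volume ≤ 2 * 2⁻¹ ^ m := by
    intro m
    have h1 : (fun y => F (m + 1) y - F m y) =
        (fun y => f y - F m y) - fun y => f y - F (m + 1) y := by
      ext y; simp
    rw [h1, two_mul]
    refine (eLpNorm_sub_le (hf.1.sub (hF m).2.1.1) (hf.1.sub (hF (m + 1)).2.1.1) hp1).trans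
      (add_le_add (hF m).2.2 ((hF (m + 1)).2.2.trans ?_))
    exact pow_le_pow_of_le_one zero_le (by simp) (Nat.le_succ m)
  -- Almost everywhere |f - F_m| is at most the series of the consecutive differences |F_{j+1} -
  -- F_j|, j ≥ m. Its partial sums are continuous, with norm at most 2·2^{-m}∑2^{-j} = 4·2^{-m}.
  set φ : ℕ → ℕ → Space n → ℝ := fun m K y =>
    ∑ j ∈ Finset.range K, ‖F (m + j + 1) y - F (m + j) y‖ with hφ
  have hFc := fun m => (hF m).1.continuous
  have hφc : ∀ m K, Continuous (φ m K) := fun m K => by simp only [hφ]; fun_prop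
  have hφ0 : ∀ m K y, 0 ≤ φ m K y := fun m K y => Finset.sum_nonneg fun j _ => norm_nonneg _
  have hφb : ∀ m K, BddCont fun y => (φ m K y : ℂ) := by
    intro m K
    have hb := fun j => ((hF (m + j + 1)).1.sub (hF (m + j)).1).bounded
    choose B hB using hb
    refine ⟨Complex.continuous_ofReal.comp (hφc m K), ∑ j ∈ Finset.range K, B j, fun y => ?_⟩
    rw [Complex.norm_real, Real.norm_of_nonneg (hφ0 m K y)]
    exact Finset.sum_le_sum fun j _ => hB j y
  have hφn : ∀ m K, eLpNorm (φ m K) p volume ≤ 4 * 2⁻¹ ^ m := by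
    intro m K
    have h1 : φ m K = ∑ j ∈ Finset.range K, fun y => ‖F (m + j + 1) y - F (m + j) y‖ := by
      ext y; simp [hφ]
    rw [h1]
    calc _ ≤ ∑ j ∈ Finset.range K, eLpNorm (fun y => ‖F (m + j + 1) y - F (m + j) y‖) p volume :=
          eLpNorm_sum_le (fun j _ => (by fun_prop : Continuous fun y =>
            ‖F (m + j + 1) y - F (m + j) y‖).aestronglyMeasurable) hp1
      _ ≤ ∑ j ∈ Finset.range K, 2 * 2⁻¹ ^ m * 2⁻¹ ^ j := by
          refine Finset.sum_le_sum fun j _ => ?_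
          rw [eLpNorm_norm, mul_assoc, ← pow_add]
          exact hDn _
      _ = 2 * 2⁻¹ ^ m * ∑ j ∈ Finset.range K, 2⁻¹ ^ j := by rw [Finset.mul_sum]
      _ ≤ 2 * 2⁻¹ ^ m * 2 := by
          gcongr
          exact (ENNReal.sum_le_tsum _).trans_eq tsum_inv_two_pow
      _ = _ := by ring
  have hmaj := fun m => hM.exists_majorant hγ hχ hχc hχ0 hp0 hp (hφb m) (hφc m) (hφ0 m)
    (Y := 4 * 2⁻¹ ^ m) (ENNReal.mul_ne_top (by simp) (by simp)) (hφn m)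
    (g := fun y => ∑' j, ‖F (m + j + 1) y - F (m + j) y‖ₑ) fun y => by
      simp only [hφ]
      simp_rw [ENNReal.ofReal_sum_of_nonneg fun _ _ => norm_nonneg _, ofReal_norm]
      exact ENNReal.tendsto_nat_tsum _
  choose H hHm hHn hH using hmaj
  refine ⟨H, ?_⟩
  have hlim : ∀ᵐ y : Space n, ∀ m, ‖f y - F m y‖ₑ ≤ ∑' j, ‖F (m + j + 1) y - F (m + j) y‖ₑ := by
    have h0 := ae_tendsto_zero_of_eLpNorm_le (μ := (volume : Measure (Space n))) hp1 hp
      (F := fun m y => ‖f y - F m y‖ₑ) (K := 1)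
      (fun m => (hf.1.sub (hF m).2.1.1).enorm) (by simp) fun m => by
        rw [one_mul]
        refine le_trans (le_of_eq (eLpNorm_congr_enorm_ae ?_)) (hF m).2.2
        exact ae_of_all _ fun y => by simp
    filter_upwards [h0] with y hy m
    have h1 : Tendsto (fun m => F m y) atTop (𝓝 (f y)) := by
      rw [tendsto_iff_edist_tendsto_0]
      refine hy.congr fun m => ?_
      rw [edist_comm, edist_eq_enorm_sub]
    have h2 : Tendsto (fun j => F (m + j) y - F m y) atTop (𝓝 (f y - F m y)) := by
      refine Tendsto.sub_const ?_ _
      have := (tendsto_add_atTop_iff_nat m).2 h1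
      exact this.congr fun j => by rw [add_comm]
    refine (enorm_le_enorm_add_tsum h2).trans (le_of_eq ?_)
    simp [add_assoc]
  filter_upwards [ae_tendsto_zero_of_eLpNorm_le hp1 hp (fun m => (hHm m).aemeasurable)
    (K := C * 4) (ENNReal.mul_ne_top ENNReal.coe_ne_top (by simp))
    (fun m => (hHn m).trans_eq (mul_assoc _ _ _).symm),
    hM.ae_forall_ae_of_ae hγ hχ hχc hχ0 hp1 hp hlim] with x hx hs
  refine ⟨hx, fun t ht m => le_trans (averageE_mono ?_) (hH m x t ht)⟩
  filter_upwards [hs t ht] with s hs h0 using hs h0 m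

/-- The maximal estimate for nonnegative cutoffs. -/
theorem MaximalBound.maximalEstimate_of_nonneg (hM : MaximalBound γ χ p C) (hγ : Continuous γ)
    (hχ : Continuous χ) (hχc : HasCompactSupport χ) (hχ0 : ∀ s, 0 ≤ χ s) (hp1 : 1 ≤ p)
    (hp : p ≠ ⊤) {f : Space n → ℂ} (hf : MemLp f p volume) :
    MaximalEstimate γ χ p C (Ioi 0) f := by
  obtain ⟨F, hF⟩ := exists_bddCont_seq hp hf
  obtain ⟨H, hH⟩ := hM.exists_averageE_sub_le hγ hχ hχc hχ0 hp1 hp hf hF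
  have hff' := hM.ae_forall_ae_of_ae hγ hχ hχc hχ0 hp1 hp hf.1.ae_eq_mk
  have hmain : ∀ᵐ x : Space n, Tendsto (fun m => H m x) atTop (𝓝 0) ∧ ∀ t ∈ Ioi (0 : ℝ),
      (Integrable (fun s => χ s • f (x - t • γ s)) ∧
        Tendsto (fun m => average γ χ t (F m) x) atTop (𝓝 (average γ χ t f x))) ∧
      ∀ m, averageE γ χ t (fun y => ‖f y - F m y‖ₑ) x ≤ H m x := by
    filter_upwards [hH, hff'] with x hx hs
    refine ⟨hx.1, fun t ht => ⟨tendsto_average_of_tendsto_averageE hγ hχ hχc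
      hf.1.stronglyMeasurable_mk (fun m => (hF m).1) (hs t ht) ?_, hx.2 t ht⟩⟩
    exact tendsto_of_tendsto_of_tendsto_of_le_of_le tendsto_const_nhds hx.1 (fun _ => zero_le)
      (hx.2 t ht)
  refine ⟨?_, ?_, ?_⟩
  · filter_upwards [hmain] with x hx t ht using (hx.2 t ht).1.1
  · refine aemeasurable_of_tendsto_metrizable_ae atTop
      (f := fun m => maximalFunction γ χ (Ioi 0) (F m)) (fun m =>
        (measurable_maximalFunction hγ hχ hχc (hF m).1.continuous _).aemeasurable) ?_
    filter_upwards [hmain] with x hx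
    have hd : ∀ m, ∀ t ∈ Ioi (0 : ℝ), ‖average γ χ t f x - average γ χ t (F m) x‖ₑ ≤ H m x :=
      fun m t ht => (enorm_average_sub_le (hx.2 t ht).1.1
        (integrable_average hγ hχ hχc (hF m).1.continuous t x)).trans ((hx.2 t ht).2 m)
    -- The maximal functions of f and F_m differ by at most H_m → 0, so the uncountable supremum for
    -- f is an almost everywhere limit of measurable functions.
    have hle1 : ∀ m, maximalFunction γ χ (Ioi 0) f x ≤
        maximalFunction γ χ (Ioi 0) (F m) x + H m x := by
      intro m
      refine iSup₂_le fun t ht => ?_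
      calc ‖average γ χ t f x‖ₑ = ‖average γ χ t (F m) x +
            (average γ χ t f x - average γ χ t (F m) x)‖ₑ := by rw [add_sub_cancel]
        _ ≤ _ := enorm_add_le _ _
        _ ≤ _ := add_le_add (le_iSup₂ (f := fun t (_ : t ∈ Ioi (0 : ℝ)) =>
            ‖average γ χ t (F m) x‖ₑ) t ht) (hd m t ht)
    have hle2 : ∀ m, maximalFunction γ χ (Ioi 0) (F m) x ≤
        maximalFunction γ χ (Ioi 0) f x + H m x := by
      intro m
      refine iSup₂_le fun t ht => ?_
      calc ‖average γ χ t (F m) x‖ₑ = ‖average γ χ t f x -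
            (average γ χ t f x - average γ χ t (F m) x)‖ₑ := by rw [sub_sub_cancel]
        _ ≤ _ := enorm_sub_le
        _ ≤ _ := add_le_add (le_iSup₂ (f := fun t (_ : t ∈ Ioi (0 : ℝ)) =>
            ‖average γ χ t f x‖ₑ) t ht) (hd m t ht)
    have hlo := ENNReal.Tendsto.sub (tendsto_const_nhds (x := maximalFunction γ χ (Ioi 0) f x))
      hx.1 (Or.inr ENNReal.zero_ne_top)
    have hhi := (tendsto_const_nhds (x := maximalFunction γ χ (Ioi 0) f x)).add hx.1
    rw [tsub_zero] at hlo
    rw [add_zero] at hhi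
    exact tendsto_of_tendsto_of_tendsto_of_le_of_le hlo hhi
      (fun m => tsub_le_iff_right.2 (hle1 m)) hle2
  · refine eLpNorm_maximalFunction_le_of_tendsto hγ hχ hχc hp1 hp hM hf hF subset_rfl ?_
    filter_upwards [hmain] with x hx t ht using (hx.2 t ht).1.2

end Nonneg

end LocalSmoothing

end

/-! ### Assembly, and reduction to a bounded continuous curve on the line. -/

namespace LocalSmoothing

open Filter

theorem exists_maximalBound {n : ℕ} {γ : ℝ → Space n} {χ : ℝ → ℝ} (hγ : Continuous γ) {Γ : ℝ}
    (hΓ : ∀ s, ‖γ s‖ ≤ Γ) (hχ : Continuous χ) (hχc : HasCompactSupport χ) {ρ : ℝ → ℝ}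
    (hρ : Continuous ρ) (hρ_supp : tsupport ρ ⊆ Icc 1 2) (hρ_ne : ρ ≠ 0) {p : ℝ≥0∞}
    [Fact (1 ≤ p)] (hp : 2 ≤ p) (hp_top : p ≠ ⊤) {σ : ℝ} (hσ : 1 / p.toReal < σ)
    (hLS : MapsLpBoundedlyIntoSobolev p σ (localizedAverage γ χ ρ)) :
    ∃ C : ℝ≥0, MaximalBound γ χ p C := by
  have hp0 : p ≠ 0 := (two_pos.trans_le hp).ne'
  have hq : 2 ≤ p.toReal := by
    have := ENNReal.toReal_mono hp_top hp
    simpa using this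
  obtain ⟨c, d, ρ₀, hc, hcd, hρ₀, hρcd⟩ := exists_Icc_le_abs hρ hρ_supp hρ_ne
  obtain ⟨C, θ, hθ, hC⟩ :=
    exists_lintegral_iSup_average_sub_heat_le hγ hχ hχc hρ hρ₀ hρcd hp_top hσ hLS
  have hmem : ∀ f : Space n → ℂ, BddCont f → ∫⁻ x, ‖f x‖ₑ ^ p.toReal ≠ ⊤ → MemLp f p volume := by
    intro f hf hfp
    refine ⟨hf.continuous.aestronglyMeasurable, lt_top_iff_ne_top.2 fun h => hfp ?_⟩
    rw [lintegral_enorm_rpow_eq hp0 hp_top, h, ENNReal.top_rpow_of_pos (by linarith)]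
  obtain ⟨C', hC'⟩ := exists_lintegral_maximalFunction_le hγ hΓ hχ hχc hc hcd hq hθ
    fun f hf hfp => hC f hf (hmem f hf hfp)
  refine ⟨C', fun f hf hfp => ?_⟩
  rw [← ENNReal.rpow_le_rpow_iff (by linarith : 0 < p.toReal),
    ENNReal.mul_rpow_of_nonneg _ _ (by linarith), ← lintegral_rpow_eq_eLpNorm hp0 hp_top,
    ← lintegral_enorm_rpow_eq hp0 hp_top]
  exact hC' f hf (lintegral_enorm_rpow_ne_top hp0 hp_top hfp)

theorem MaximalBound.maximalFunctionBoundedOnLp {n : ℕ} {γ : ℝ → Space n} {χ : ℝ → ℝ} {p : ℝ≥0∞}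
    {C : ℝ≥0} (hM : MaximalBound γ χ p C) (hγ : Continuous γ) (hχ : Continuous χ)
    (hχc : HasCompactSupport χ) (hp1 : 1 ≤ p) (hp : p ≠ ⊤) :
    MaximalFunctionBoundedOnLp γ χ p :=
  ⟨C, fun _ hf => ⟨fun h => h.elim (hM.maximalEstimate_of_continuous hγ hχ hχc hp1 hp hf)
      fun h0 => hM.maximalEstimate_of_nonneg hγ hχ hχc h0 hp1 hp hf,
    fun _ hT hTc => hM.maximalEstimate_of_countable hγ hχ hχc hp1 hp hf hT hTc⟩⟩

section Congr

variable {n : ℕ} {γ γ' : ℝ → Space n} {χ : ℝ → ℝ}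

theorem smul_comp_curve_congr (h : ∀ s, χ s ≠ 0 → γ s = γ' s) (f : Space n → ℂ) (t : ℝ)
    (x : Space n) : (fun s => χ s • f (x - t • γ s)) = fun s => χ s • f (x - t • γ' s) := by
  ext s
  by_cases h0 : χ s = 0
  · simp [h0]
  · rw [h s h0]

theorem average_curve_congr (h : ∀ s, χ s ≠ 0 → γ s = γ' s) : average γ χ = average γ' χ := by
  ext t f x
  simp only [average, smul_comp_curve_congr h]

theorem localizedAverage_curve_congr (h : ∀ s, χ s ≠ 0 → γ s = γ' s) (ρ : ℝ → ℝ) :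
    localizedAverage γ χ ρ = localizedAverage γ' χ ρ := by
  ext f z
  simp only [localizedAverage, average_curve_congr h]

theorem maximalFunctionBoundedOnLp_curve_congr (h : ∀ s, χ s ≠ 0 → γ s = γ' s) (p : ℝ≥0∞) :
    MaximalFunctionBoundedOnLp γ χ p ↔ MaximalFunctionBoundedOnLp γ' χ p := by
  have hM : maximalFunction γ χ = maximalFunction γ' χ := by
    ext T f x
    simp only [maximalFunction, average_curve_congr h]
  simp only [MaximalFunctionBoundedOnLp, MaximalEstimate, smul_comp_curve_congr h, hM]

end Congr

end LocalSmoothing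

theorem proposition2p1 (n : ℕ) (a b : ℝ) (hab : a < b)
    (γ : ℝ → LocalSmoothing.Space n) (hγ : ContDiffOn ℝ ∞ γ (Icc a b))
    (χ : ℝ → ℝ) (hχ : ContDiff ℝ ∞ χ) (hχ_supp : tsupport χ ⊆ interior (Icc a b))
    (ρ : ℝ → ℝ) (hρ : ContDiff ℝ ∞ ρ) (hρ_supp : tsupport ρ ⊆ Icc 1 2) (hρ_ne : ρ ≠ 0)
    (p : ℝ≥0∞) [Fact (1 ≤ p)] (hp : 2 ≤ p) (hp_top : p ≠ ⊤)
    (σ : ℝ) (hσ : 1 / p.toReal < σ)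
    (hLS : LocalSmoothing.MapsLpBoundedlyIntoSobolev p σ
      (LocalSmoothing.localizedAverage γ χ ρ)) :
    LocalSmoothing.MaximalFunctionBoundedOnLp γ χ p := by
  have hsub : tsupport χ ⊆ Icc a b := hχ_supp.trans interior_subset
  have hχc : HasCompactSupport χ := isCompact_Icc.of_isClosed_subset (isClosed_tsupport χ) hsub
  -- Only the values of γ on the support of χ matter. Extending γ by its endpoint values makes it
  -- continuous and bounded on ℝ without changing any average.
  set γ' : ℝ → LocalSmoothing.Space n := IccExtend hab.le ((Icc a b).domRestrict γ) with hγ'def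
  have hγ' : Continuous γ' := hγ.continuousOn.domRestrict.Icc_extend'
  have heq : ∀ s, χ s ≠ 0 → γ s = γ' s := fun s hs =>
    (IccExtend_of_mem hab.le ((Icc a b).domRestrict γ) (hsub (subset_tsupport χ hs))).symm
  obtain ⟨Γ, hΓ⟩ := isCompact_Icc.exists_bound_of_continuousOn hγ.continuousOn
  have hΓ' : ∀ s, ‖γ' s‖ ≤ Γ := fun s => hΓ _ (projIcc a b hab.le s).2
  rw [LocalSmoothing.localizedAverage_curve_congr heq] at hLS
  obtain ⟨C, hC⟩ := LocalSmoothing.exists_maximalBound hγ' hΓ' hχ.continuous hχc hρ.continuous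
    hρ_supp hρ_ne hp hp_top hσ hLS
  rw [LocalSmoothing.maximalFunctionBoundedOnLp_curve_congr heq]
  exact hC.maximalFunctionBoundedOnLp hγ' hχ.continuous hχc Fact.out hp_top
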